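/- Let $G=\mathrm{SL}_2$, let $\mathbb{A}=\mathbb{R}\times\mathbb{A}_f$ be the adeles of $\mathbb{Q}$, $K_\infty=\mathrm{SO}_2(\mathbb{R})$, $K_f=\prod_p \mathrm{SL}_2(\mathbb{Z}_p)$, $K=K_\infty\times K_f$, $\mathfrak{g}=\mathfrak{sl}_2(\mathbb{C})$, and let $\mathfrak{z}$ be the center of the universal enveloping algebra of $\mathfrak{g}$. Let $\rho$ be a representation of $G(\mathbb{Q})$ on a normed complex vector space $V$. A vector-valued automorphic form of type $\rho$ is a smooth function $F: G(\mathbb{A})\to V$ (that is, $F$ is right invariant under an open subgroup of $G(\mathbb{A}_f)$ and $C^\infty$ in the real variable) with $F(\gamma g)=\rho(\gamma)F(g)$ for all $\gamma\in G(\mathbb{Q})$, $g\in G(\mathbb{A})$, which is $K$-finite under right shifts, $\mathfrak{z}$-finite, and of moderate growth. Denote the space of these functions by $\mathcal{A}(G(\mathbb{Q})\backslash G(\mathbb{A}),\rho)$, and write $\mathcal{A}(G(\mathbb{Q})\backslash G(\mathbb{A}))$ if $\rho$ is the trivial representation on $\mathbb{C}$. The Lie algebra $\mathfrak{g}$ acts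 by left invariant vector fields, and $K_\infty$ and $G(\mathbb{A}_f)$ act by right shifts. A smooth $(\mathfrak{g},K_\infty)\times G(\mathbb{A}_f)$-representation is called automorphic if it is isomorphic to a subquotient of $\mathcal{A}(G(\mathbb{Q})\backslash G(\mathbb{A}))$, and vector-valued automorphic of type $\rho$ if it is isomorphic to a subquotient of $\mathcal{A}(G(\mathbb{Q})\backslash G(\mathbb{A}),\rho)$. For an integer $m\ge 0$, let $\mathrm{sym}^m$ be the representation of $\mathrm{SL}_2(\mathbb{R})$ on the space $\mathbb{C}[X]_m$ of polynomials of degree at most $m$ given by $$\mathrm{sym}^m\begin{pmatrix}a&b\\c&d\end{pmatrix}p=(a-cX)^m\,p\Big(\frac{dX-b}{a-cX}\Big),$$ and also its restriction to $G(\mathbb{Q})$ and the associated $(\mathfrak{g},K_\infty)$-module. For $0\le j\le m$ and $\tau=x+iy$ in the upper half plane, put $$\mathfrak{e}_{j,m-j}(\tau)=\frac{(-1)^{m-j}}{j!}\,y^{j-m}(X-\tau)^j(X-\overline{\tau})^{m-j}\in\mathbb{C}[X]_m .$$ For a function $f$ on the upper half plane put $(f|_k g)(\tau)=(c\tau+d)^{-k}f(g\tau)$,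 where $(c,d)$ is the bottom row of $g\in G(\mathbb{R})$, and define $\tilde{\mathfrak{e}}_{j,m-j}$ on $G(\mathbb{A})=G(\mathbb{Q})G(\mathbb{R})K_f$ by $$\tilde{\mathfrak{e}}_{j,m-j}(\gamma g_\infty k_f)=\mathrm{sym}^m(\gamma)\,\big(\mathfrak{e}_{j,m-j}\big|_{m-2j}\,g_\infty\big)(i),\qquad \gamma\in G(\mathbb{Q}),\ g_\infty\in G(\mathbb{R}),\ k_f\in K_f .$$ Then the functions $\tilde{\mathfrak{e}}_{j,m-j}$ are well defined and are vector-valued automorphic forms of type $\mathrm{sym}^m$. Let $\varpi(\mathfrak{e}_{j,m-j})\subset\mathcal{A}(G(\mathbb{Q})\backslash G(\mathbb{A}),\mathrm{sym}^m)$ be the representation generated by $\tilde{\mathfrak{e}}_{j,m-j}$. The following hold. 1. $\varpi(\mathfrak{e}_{j,m-j})=\varpi(\mathfrak{e}_{m,0})$ for all $0\le j\le m$. 2. $\varpi(\mathfrak{e}_{m,0})\cong\mathrm{sym}^m\otimes\bigotimes'_{v\ne\infty}\mathbb{1}_v$, where $\mathrm{sym}^m$ is an irreducible $(m+1)$-dimensional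 $(\mathfrak{g},K_\infty)$-module, $\mathbb{1}_v$ is the trivial representation of $G(\mathbb{Q}_v)$, and the restricted tensor product is taken with respect to spherical vectors. 3. For all $0\le j\le m$, the map $f\mapsto\tilde{\mathfrak{e}}_{j,m-j}\cdot f$ is an embedding of $G(\mathbb{A}_f)$-representations of $\mathcal{A}(G(\mathbb{Q})\backslash G(\mathbb{A}))$ into $\mathcal{A}(G(\mathbb{Q})\backslash G(\mathbb{A}),\mathrm{sym}^m)$. 4. If $\varpi\subseteq\mathcal{A}(G(\mathbb{Q})\backslash G(\mathbb{A}))$ is a subrepresentation, then the linear span $\varpi(\mathfrak{e}_{m,0})\cdot\varpi$ of the products of elements of the two spaces is a subrepresentation of $\mathcal{A}(G(\mathbb{Q})\backslash G(\mathbb{A}),\mathrm{sym}^m)$, and multiplication of functions is an isomorphism $\varpi(\mathfrak{e}_{m,0})\otimes\varpi\cong\varpi(\mathfrak{e}_{m,0})\cdot\varpi$ of $(\mathfrak{g},K_\infty)\times G(\mathbb{A}_f)$-representations. 5. If $\varpi$ is any automorphic representation, then $\varpi(\mathfrak{e}_{m,0})\otimes\varpi$ is vector-valued automorphic of type $\mathrm{sym}^m$.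 -/

import Mathlib

open scoped ContDiff TensorProduct
open IsDedekindDomain

noncomputable section

namespace VVAut

attribute [local instance 100] LieRing.ofAssociativeRing

/-! ### Groups -/

/-- The group `SL₂(R)`. -/
abbrev SL2 (R : Type*) [CommRing R] : Type _ := Matrix.SpecialLinearGroup (Fin 2) R

/-- The finite adeles of `ℚ`. -/
abbrev Af : Type := FiniteAdeleRing ℤ ℚ

/-- The adelic group `SL₂(𝔸) = SL₂(ℝ) × SL₂(𝔸_f)`. -/
abbrev GA : Type := SL2 ℝ × SL2 Af

/-- The diagonal embedding of `SL₂(ℚ)` into `SL₂(𝔸)`. -/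
def diag : SL2 ℚ →* GA :=
  (Matrix.SpecialLinearGroup.map (algebraMap ℚ ℝ)).prod
    (Matrix.SpecialLinearGroup.map (algebraMap ℚ Af))

/-- The component of a finite adele at a finite place. -/
def adeleEval (v : HeightOneSpectrum ℤ) : Af →+* v.adicCompletion ℚ where
  toFun a := a v
  map_one' := rfl
  map_mul' _ _ := rfl
  map_zero' := rfl
  map_add' _ _ := rfl

/-- The component `SL₂(𝔸_f) → SL₂(ℚ_v)` at a finite place. -/
def localComponent (v : HeightOneSpectrum ℤ) : SL2 Af →* SL2 (v.adicCompletion ℚ) :=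
  Matrix.SpecialLinearGroup.map (adeleEval v)

/-- The maximal compact subgroup `K_v = SL₂(ℤ_v)` of `SL₂(ℚ_v)`. -/
def Kfin (v : HeightOneSpectrum ℤ) : Subgroup (SL2 (v.adicCompletion ℚ)) :=
  (Matrix.SpecialLinearGroup.map
    (algebraMap (v.adicCompletionIntegers ℚ) (v.adicCompletion ℚ))).range

/-- The maximal compact subgroup `K_f = ∏_v SL₂(ℤ_v)` of `SL₂(𝔸_f)`. -/
def Kf : Subgroup (SL2 Af) := ⨅ v, (Kfin v).comap (localComponent v)

/-- The maximal compact subgroup `K_∞ = SO₂(ℝ)` of `SL₂(ℝ)`. -/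
def Kinf : Subgroup (SL2 ℝ) where
  carrier := {g | (g : Matrix (Fin 2) (Fin 2) ℝ) ∈ Matrix.orthogonalGroup (Fin 2) ℝ}
  one_mem' := by simp
  mul_mem' {a b} ha hb := by
    rw [Set.mem_ofPred_eq, Matrix.SpecialLinearGroup.coe_mul]
    exact mul_mem ha hb
  inv_mem' {a} ha := by
    have h1 : (a : Matrix (Fin 2) (Fin 2) ℝ) * star (a : Matrix (Fin 2) (Fin 2) ℝ) = 1 :=
      (Matrix.mem_orthogonalGroup_iff (Fin 2) ℝ).1 ha
    have h2 : ((a⁻¹ : SL2 ℝ) : Matrix (Fin 2) (Fin 2) ℝ) * (a : Matrix (Fin 2) (Fin 2) ℝ) = 1 := by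
      rw [← Matrix.SpecialLinearGroup.coe_mul, inv_mul_cancel, Matrix.SpecialLinearGroup.coe_one]
    have h3 : ((a⁻¹ : SL2 ℝ) : Matrix (Fin 2) (Fin 2) ℝ) = star (a : Matrix (Fin 2) (Fin 2) ℝ) :=
      left_inv_eq_right_inv h2 h1
    show ((a⁻¹ : SL2 ℝ) : Matrix (Fin 2) (Fin 2) ℝ) ∈ Matrix.orthogonalGroup (Fin 2) ℝ
    rw [h3]
    exact Unitary.star_mem ha

/-- The maximal compact subgroup `K = K_∞ × K_f` of `SL₂(𝔸)`. -/
def Kmax : Subgroup GA := Kinf.prod Kf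

/-- The rotation `exp (t J)` with `J = !![0, -1; 1, 0]`. -/
def rot (t : ℝ) : Kinf :=
  ⟨⟨!![Real.cos t, -Real.sin t; Real.sin t, Real.cos t], by
      rw [Matrix.det_fin_two_of]; nlinarith [Real.sin_sq_add_cos_sq t]⟩, by
    show (!![Real.cos t, -Real.sin t; Real.sin t, Real.cos t] : Matrix (Fin 2) (Fin 2) ℝ) ∈
      Matrix.orthogonalGroup (Fin 2) ℝ
    have h1 := Real.sin_sq_add_cos_sq t
    rw [Matrix.mem_orthogonalGroup_iff]
    ext i j
    fin_cases i <;> fin_cases j <;>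
      simp [Matrix.mul_apply, Fin.sum_univ_two] <;> nlinarith⟩

/-! ### The norm on `SL₂(𝔸)` -/

/-- The norm `(tr (gᵀ g))^{1/2}` on `SL₂(ℝ)`. -/
def normInf (g : SL2 ℝ) : ℝ := Real.sqrt (∑ i, ∑ j, (g i j) ^ 2)

/-- The maximum of the `v`-adic absolute values of the entries (for determinant one, those of the
inverse matrix are the same up to order). -/
def normFin (v : HeightOneSpectrum ℤ) (g : SL2 (v.adicCompletion ℚ)) : ℝ :=
  max (max ‖g 0 0‖ ‖g 0 1‖) (max ‖g 1 0‖ ‖g 1 1‖)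

/-- The standard norm on `SL₂(𝔸)`, the product of the local norms, almost all of which are `1`.
Any two norms on `SL₂(𝔸)` are bounded by constant multiples of powers of each other, so that
a function is of moderate growth for every norm if and only if it is for this one. -/
def adelicNorm (g : GA) : ℝ := normInf g.1 * ∏ᶠ v, normFin v (localComponent v g.2)

/-! ### The Lie algebra -/

/-- The complexified Lie algebra `𝔤 = 𝔰𝔩₂(ℂ)` of `SL₂(ℝ)`. -/
abbrev sl2 : Type := LieAlgebra.SpecialLinear.sl (Fin 2) ℂ

/-- The generator `J = !![0, -1; 1, 0]` of the Lie algebra of `K_∞`. -/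
def Jgen : sl2 := ⟨!![0, -1; 1, 0], by
  change Matrix.trace (!![0, -1; 1, 0] : Matrix (Fin 2) (Fin 2) ℂ) = 0
  simp [Matrix.trace_fin_two]⟩

/-- A real matrix, regarded as a complex matrix. -/
def toC : Matrix (Fin 2) (Fin 2) ℝ →+* Matrix (Fin 2) (Fin 2) ℂ := Complex.ofRealHom.mapMatrix

lemma toC_inv_mul (g : SL2 ℝ) : toC (g⁻¹ : SL2 ℝ).1 * toC g.1 = 1 := by
  rw [← map_mul, ← Matrix.SpecialLinearGroup.coe_mul, inv_mul_cancel,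
    Matrix.SpecialLinearGroup.coe_one, map_one]

/-- The adjoint action `X ↦ g X g⁻¹` of `SL₂(ℝ)` on `𝔤`. -/
def Ad (g : SL2 ℝ) (X : sl2) : sl2 :=
  ⟨toC g.1 * X.1 * toC (g⁻¹ : SL2 ℝ).1, by
    change Matrix.trace (toC g.1 * X.1 * toC (g⁻¹ : SL2 ℝ).1) = 0
    have hX : Matrix.trace X.1 = 0 := X.2
    rw [Matrix.trace_mul_comm, ← mul_assoc, toC_inv_mul, one_mul, hX]⟩

/-! ### Adelic modules -/

/-- Smooth `(𝔤, K_∞) × SL₂(𝔸_f)`-representations on a complex vector space `M`: a `𝔤`-module that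
is a locally finite representation of `K_∞`, whose differential is the action of the Lie algebra
of `K_∞`, and a smooth representation of `SL₂(𝔸_f)` that commutes with both. -/
structure AdelicModule (M : Type*) [AddCommGroup M] [Module ℂ M] where
  lie : sl2 →ₗ⁅ℂ⁆ Module.End ℂ M
  rhoInf : Representation ℂ Kinf M
  rhoFin : Representation ℂ (SL2 Af) M
  kFinite : ∀ v : M, FiniteDimensional ℂ (Submodule.span ℂ (Set.range fun k => rhoInf k v))
  deriv_rot : ∀ (v : M) (l : M →ₗ[ℂ] ℂ),
    HasDerivAt (fun t : ℝ => l (rhoInf (rot t) v)) (l (lie Jgen v)) 0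
  ad : ∀ (k : Kinf) (X : sl2) (v : M), rhoInf k (lie X v) = lie (Ad k X) (rhoInf k v)
  comm_lie : ∀ (h : SL2 Af) (X : sl2) (v : M), rhoFin h (lie X v) = lie X (rhoFin h v)
  comm_inf : ∀ (h : SL2 Af) (k : Kinf) (v : M), rhoFin h (rhoInf k v) = rhoInf k (rhoFin h v)
  smooth : ∀ v : M, ∃ U : OpenSubgroup (SL2 Af), ∀ u ∈ U, rhoFin u v = v

/-- The linear map `φ` commutes with the actions of `𝔤`, of `K_∞` and of `SL₂(𝔸_f)`. -/
structure Intertwines {M N : Type*} [AddCommGroup M] [Module ℂ M] [AddCommGroup N] [Module ℂ N]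
    (π : AdelicModule M) (σ : AdelicModule N) (φ : M →ₗ[ℂ] N) : Prop where
  lie : ∀ X v, φ (π.lie X v) = σ.lie X (φ v)
  inf : ∀ k v, φ (π.rhoInf k v) = σ.rhoInf k (φ v)
  fin : ∀ h v, φ (π.rhoFin h v) = σ.rhoFin h (φ v)

section Tensor

variable {M N : Type*} [AddCommGroup M] [Module ℂ M] [AddCommGroup N] [Module ℂ N]

/-- The action `X ⊗ 1 + 1 ⊗ X` of `𝔤` on a tensor product. -/
def tensorLie (f : sl2 →ₗ⁅ℂ⁆ Module.End ℂ M) (g : sl2 →ₗ⁅ℂ⁆ Module.End ℂ N) :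
    sl2 →ₗ⁅ℂ⁆ Module.End ℂ (M ⊗[ℂ] N) where
  toFun X := (f X).rTensor N + (g X).lTensor M
  map_add' X Y := by
    ext a b; simp; abel
  map_smul' c X := by
    ext a b; simp [TensorProduct.smul_tmul']
  map_lie' {X Y} := by
    ext a b
    simp only [LieHom.map_lie, LieRing.of_associative_ring_bracket,
      TensorProduct.AlgebraTensorModule.curry_apply, LinearMap.restrictScalars_self,
      TensorProduct.curry_apply, LinearMap.add_apply, LinearMap.sub_apply, Module.End.mul_apply,
      LinearMap.rTensor_tmul, LinearMap.lTensor_tmul, TensorProduct.sub_tmul,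
      TensorProduct.tmul_sub, map_add]
    abel

lemma AdelicModule.exists_fd (π : AdelicModule M) (v : M) :
    ∃ F : Submodule ℂ M, FiniteDimensional ℂ F ∧ (∀ k, π.rhoInf k v ∈ F) ∧ π.lie Jgen v ∈ F := by
  have := π.kFinite v
  refine ⟨Submodule.span ℂ (Set.range fun k => π.rhoInf k v) ⊔ Submodule.span ℂ {π.lie Jgen v},
    inferInstance, fun k => ?_, ?_⟩
  · exact Submodule.mem_sup_left (Submodule.subset_span ⟨k, rfl⟩)
  · exact Submodule.mem_sup_right (Submodule.mem_span_singleton_self _)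

lemma tensor_deriv (π : AdelicModule M) (σ : AdelicModule N) (v : M) (w : N)
    (l : M ⊗[ℂ] N →ₗ[ℂ] ℂ) :
    HasDerivAt (fun t : ℝ => l (π.rhoInf (rot t) v ⊗ₜ σ.rhoInf (rot t) w))
      (l (π.lie Jgen v ⊗ₜ w + v ⊗ₜ σ.lie Jgen w)) 0 := by
  have h0 : rot 0 = 1 := by
    apply Subtype.ext; apply Subtype.ext
    ext i j; fin_cases i <;> fin_cases j <;> simp [rot]
  obtain ⟨F, hF, hk, hJ⟩ := π.exists_fd v
  let b := Module.finBasis ℂ F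
  choose c hc using fun i => LinearMap.exists_extend (b.coord i)
  have hexp : ∀ x ∈ F, x = ∑ i, c i x • (b i : M) := by
    intro x hx
    have h1 : (∑ i, b.repr ⟨x, hx⟩ i • (b i : M)) = x := by
      have h := congrArg F.subtype (b.sum_repr ⟨x, hx⟩)
      simpa only [map_sum, map_smul, Submodule.subtype_apply] using h
    have h2 : ∀ i, c i x = b.repr ⟨x, hx⟩ i := fun i => LinearMap.congr_fun (hc i) ⟨x, hx⟩
    simp only [h2, h1]
  have hv : v ∈ F := by simpa using hk 1
  have key : ∀ x ∈ F, ∀ y : N, l (x ⊗ₜ y) = ∑ i, c i x * l ((b i : M) ⊗ₜ y) := by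
    intro x hx y
    conv_lhs => rw [hexp x hx]
    simp only [TensorProduct.sum_tmul, ← TensorProduct.smul_tmul', map_sum, map_smul, smul_eq_mul]
  have hd : HasDerivAt (fun t : ℝ => ∑ i, c i (π.rhoInf (rot t) v) *
      l ((b i : M) ⊗ₜ σ.rhoInf (rot t) w))
      (∑ i, (c i (π.lie Jgen v) * l ((b i : M) ⊗ₜ σ.rhoInf (rot 0) w) +
        c i (π.rhoInf (rot 0) v) * l ((b i : M) ⊗ₜ σ.lie Jgen w))) 0 := by
    refine HasDerivAt.fun_sum fun i _ => ?_
    exact (π.deriv_rot v (c i)).mul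
      (σ.deriv_rot w (l ∘ₗ (TensorProduct.mk ℂ M N (b i : M))))
  convert hd using 1
  · ext t; exact key _ (hk _) _
  · rw [map_add, key _ hJ, key _ hv, h0, Finset.sum_add_distrib]; simp

/-- The tensor product of two adelic modules with the diagonal actions. -/
def AdelicModule.tensor (π : AdelicModule M) (σ : AdelicModule N) :
    AdelicModule (M ⊗[ℂ] N) where
  lie := tensorLie π.lie σ.lie
  rhoInf := π.rhoInf.tprod σ.rhoInf
  rhoFin := π.rhoFin.tprod σ.rhoFin
  kFinite z := by
    induction z using TensorProduct.induction_on with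
    | zero =>
      have : (Set.range fun k => (π.rhoInf.tprod σ.rhoInf) k (0 : M ⊗[ℂ] N)) ⊆ {0} := by
        rintro _ ⟨k, rfl⟩; simp
      exact Submodule.finiteDimensional_of_le (Submodule.span_mono this)
    | tmul x y =>
      have := π.kFinite x
      have := σ.kFinite y
      have hfd : FiniteDimensional ℂ (Submodule.map₂ (TensorProduct.mk ℂ M N)
          (Submodule.span ℂ (Set.range fun k => π.rhoInf k x))
          (Submodule.span ℂ (Set.range fun k => σ.rhoInf k y))) :=
        Module.Finite.iff_fg.2 ((Module.Finite.iff_fg.1 (π.kFinite x)).map₂ _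
          (Module.Finite.iff_fg.1 (σ.kFinite y)))
      refine Submodule.finiteDimensional_of_le (Submodule.span_le.2 ?_) (S₂ := Submodule.map₂
        (TensorProduct.mk ℂ M N) (Submodule.span ℂ (Set.range fun k => π.rhoInf k x))
        (Submodule.span ℂ (Set.range fun k => σ.rhoInf k y)))
      rintro _ ⟨k, rfl⟩
      exact Submodule.apply_mem_map₂ _ (Submodule.subset_span ⟨k, rfl⟩)
        (Submodule.subset_span ⟨k, rfl⟩)
    | add x y hx hy =>
      refine Submodule.finiteDimensional_of_le (S₂ :=
        Submodule.span ℂ (Set.range fun k => (π.rhoInf.tprod σ.rhoInf) k x) ⊔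
        Submodule.span ℂ (Set.range fun k => (π.rhoInf.tprod σ.rhoInf) k y))
        (Submodule.span_le.2 ?_)
      rintro _ ⟨k, rfl⟩
      simp only [map_add]
      exact Submodule.add_mem_sup (Submodule.subset_span ⟨k, rfl⟩) (Submodule.subset_span ⟨k, rfl⟩)
  deriv_rot z l := by
    induction z using TensorProduct.induction_on with
    | zero => simpa using hasDerivAt_const (0 : ℝ) (0 : ℂ)
    | tmul x y => exact tensor_deriv π σ x y l
    | add x y hx hy => simpa using! hx.add hy
  ad k X z := by
    induction z using TensorProduct.induction_on with
    | zero => simp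
    | tmul x y => simp [tensorLie, π.ad, σ.ad]
    | add x y hx hy => simp only [map_add, hx, hy]
  comm_lie h X z := by
    induction z using TensorProduct.induction_on with
    | zero => simp
    | tmul x y => simp [tensorLie, π.comm_lie, σ.comm_lie]
    | add x y hx hy => simp only [map_add, hx, hy]
  comm_inf h k z := by
    induction z using TensorProduct.induction_on with
    | zero => simp
    | tmul x y => simp [π.comm_inf, σ.comm_inf]
    | add x y hx hy => simp only [map_add, hx, hy]
  smooth z := by
    induction z using TensorProduct.induction_on with
    | zero => exact ⟨⊤, by simp⟩
    | tmul x y =>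
      obtain ⟨U, hU⟩ := π.smooth x
      obtain ⟨U', hU'⟩ := σ.smooth y
      refine ⟨U ⊓ U', fun u hu => ?_⟩
      simp [hU u hu.1, hU' u hu.2]
    | add x y hx hy =>
      obtain ⟨U, hU⟩ := hx
      obtain ⟨U', hU'⟩ := hy
      refine ⟨U ⊓ U', fun u hu => ?_⟩
      rw [map_add, hU u hu.1, hU' u hu.2]

end Tensor

/-! ### Smooth functions -/

section Calculus

variable {𝕜 : Type*} [RCLike 𝕜] {E V : Type*} [NormedAddCommGroup E] [NormedSpace 𝕜 E]
  [NormedAddCommGroup V] [NormedSpace 𝕜 V]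

/-- The derivative of `f` at `A` along the linear vector field `A ↦ R A`. -/
def vecDeriv (f : E → V) (R : E →L[𝕜] E) (A : E) : V := fderiv 𝕜 f A (R A)

lemma vecDeriv_vecDeriv {f : E → V} {A : E} (hf : ContDiffAt 𝕜 2 f A) (R S : E →L[𝕜] E) :
    vecDeriv (vecDeriv f R) S A =
      fderiv 𝕜 (fderiv 𝕜 f) A (S A) (R A) + fderiv 𝕜 f A (R (S A)) := by
  have h1 : DifferentiableAt 𝕜 (fderiv 𝕜 f) A :=
    (hf.fderiv_right (m := 1) (by norm_num)).differentiableAt (by norm_num)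
  have h2 := h1.hasFDerivAt.clm_apply R.hasFDerivAt
  have h3 : fderiv 𝕜 (vecDeriv f R) A = _ := h2.fderiv
  rw [vecDeriv, h3]
  simp [add_comm]

lemma vecDeriv_bracket {f : E → V} {A : E} (hf : ContDiffAt 𝕜 2 f A) (R S : E →L[𝕜] E) :
    vecDeriv (vecDeriv f S) R A - vecDeriv (vecDeriv f R) S A =
      fderiv 𝕜 f A (S (R A) - R (S A)) := by
  rw [vecDeriv_vecDeriv hf, vecDeriv_vecDeriv hf, (hf.isSymmSndFDerivAt (by simp)) (R A) (S A),
    map_sub]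
  abel

lemma vecDeriv_smul_point {f : E → V} {c : 𝕜} (h : ∀ B, f (c • B) = f B) (R : E →L[𝕜] E) (A : E) :
    vecDeriv f R (c • A) = vecDeriv f R A := by
  have h1 : (fun B => f (c • B)) = f := funext h
  have h2 := fderiv_comp_smul (f := f) (x := A) c
  rw [h1] at h2
  simp [vecDeriv, h2]

lemma vecDeriv_contDiffOn {f : E → V} {s : Set E} (hs : IsOpen s) (hf : ContDiffOn 𝕜 ∞ f s)
    (R : E →L[𝕜] E) : ContDiffOn 𝕜 ∞ (vecDeriv f R) s :=
  (hf.fderiv_of_isOpen hs (m := ∞) (by simp)).clm_apply R.contDiff.contDiffOn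

lemma vecDeriv_comp {f g : E → V} {A : E} {T : E →L[𝕜] E} (h : f =ᶠ[nhds A] g ∘ T)
    (hg : DifferentiableAt 𝕜 g (T A)) (R : E →L[𝕜] E) :
    vecDeriv f R A = fderiv 𝕜 g (T A) (T (R A)) := by
  rw [vecDeriv, h.fderiv_eq, (hg.hasFDerivAt.comp A T.hasFDerivAt).fderiv]
  rfl

end Calculus

section Smooth

variable {V : Type*} [NormedAddCommGroup V] [NormedSpace ℂ V]

/-- The space of `2 × 2`-matrices as a normed space. -/
abbrev M2 (𝕜 : Type*) : Type _ := Fin 2 → Fin 2 → 𝕜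

/-- Right multiplication `A ↦ A * X` by a matrix as a continuous linear map. -/
def mulR {𝕜 : Type*} [RCLike 𝕜] (X : Matrix (Fin 2) (Fin 2) 𝕜) : M2 𝕜 →L[𝕜] M2 𝕜 :=
  LinearMap.toContinuousLinearMap
    { toFun A := Matrix.of.symm (Matrix.of A * X)
      map_add' A B := congrArg Matrix.of.symm (add_mul (Matrix.of A) (Matrix.of B) X)
      map_smul' c A := congrArg Matrix.of.symm (Matrix.smul_mul c (Matrix.of A) X) }

lemma mulR_apply {𝕜 : Type*} [RCLike 𝕜] (X : Matrix (Fin 2) (Fin 2) 𝕜) (A : M2 𝕜) :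
    mulR X A = Matrix.of.symm (Matrix.of A * X) := rfl

/-- The open set of real matrices of positive determinant. -/
def posDet : Set (M2 ℝ) := {A | 0 < (Matrix.of A).det}

lemma mem_posDet {A : M2 ℝ} : A ∈ posDet ↔ 0 < (Matrix.of A).det := Iff.rfl

/-- The retraction `A ↦ (det A)^{-1/2} A` of the matrices of positive determinant onto `SL₂(ℝ)`
(extended by `1`). It is a smooth submersion, so that a function `f` on `SL₂(ℝ)` is smooth if and
only if `A ↦ f (retr A)` is smooth on the matrices of positive determinant. -/
def retr (A : M2 ℝ) : SL2 ℝ :=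
  if h : 0 < (Matrix.of A).det then ⟨(Real.sqrt (Matrix.of A).det)⁻¹ • Matrix.of A, by
    rw [Matrix.det_smul, Fintype.card_fin, inv_pow, Real.sq_sqrt h.le, inv_mul_cancel₀ h.ne']⟩
  else 1

/-- The entries of an element of `SL₂(ℝ)`. -/
def entries (g : SL2 ℝ) : M2 ℝ := Matrix.of.symm g.1

@[simp] lemma of_entries (g : SL2 ℝ) : Matrix.of (entries g) = g.1 := rfl

lemma retr_entries (g : SL2 ℝ) : retr (entries g) = g := by
  apply Subtype.ext
  have h : g.1.det = 1 := g.2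
  simp [retr, h]

lemma retr_val {A : M2 ℝ} (h : A ∈ posDet) :
    (retr A).1 = (Real.sqrt (Matrix.of A).det)⁻¹ • Matrix.of A := by
  have h' : 0 < (Matrix.of A).det := h
  simp [retr, h']

lemma retr_neg {A : M2 ℝ} (h : ¬ 0 < (Matrix.of A).det) : retr A = 1 := by
  simp [retr, h]

lemma entries_mem_posDet (g : SL2 ℝ) : entries g ∈ posDet := by
  rw [mem_posDet, of_entries, g.2]; exact one_pos

lemma retr_smul {c : ℝ} (hc : 0 < c) (A : M2 ℝ) : retr (c • A) = retr A := by
  have h1 : Matrix.of (c • A) = c • Matrix.of A := rfl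
  by_cases h : 0 < (Matrix.of A).det
  · have h2 : 0 < (Matrix.of (c • A)).det := by
      rw [h1, Matrix.det_smul]; positivity
    apply Subtype.ext
    rw [retr_val h, retr_val h2, h1, Matrix.det_smul, Fintype.card_fin,
      Real.sqrt_mul (by positivity), Real.sqrt_sq hc.le, smul_smul, mul_inv_rev, mul_assoc,
      inv_mul_cancel₀ hc.ne', mul_one]
  · have h2 : ¬ 0 < (Matrix.of (c • A)).det := by
      rw [h1, Matrix.det_smul, Fintype.card_fin]
      intro h3
      exact h (pos_of_mul_pos_right h3 (by positivity))
    rw [retr_neg h, retr_neg h2]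

lemma det_mulR (A : M2 ℝ) (x : SL2 ℝ) :
    (Matrix.of (mulR x.1 A)).det = (Matrix.of A).det := by
  rw [mulR_apply, Equiv.apply_symm_apply, Matrix.det_mul, x.2, mul_one]

lemma mulR_mem_posDet {A : M2 ℝ} (h : A ∈ posDet) (x : SL2 ℝ) : mulR x.1 A ∈ posDet := by
  rw [mem_posDet, det_mulR]; exact h

lemma retr_mulR {A : M2 ℝ} (h : A ∈ posDet) (x : SL2 ℝ) : retr (mulR x.1 A) = retr A * x := by
  apply Subtype.ext
  rw [retr_val (mulR_mem_posDet h x), det_mulR, Matrix.SpecialLinearGroup.coe_mul, retr_val h,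
    Matrix.smul_mul]
  rfl

lemma isOpen_posDet : IsOpen posDet :=
  isOpen_lt continuous_const (Continuous.matrix_det continuous_id)

/-- The space of smooth functions `SL₂(𝔸) → V`: smooth in the real variable, and invariant under
right translation by an open subgroup of `SL₂(𝔸_f)`. -/
def smoothSubmodule (V : Type*) [NormedAddCommGroup V] [NormedSpace ℂ V] :
    Submodule ℂ (GA → V) where
  carrier := {F | (∃ U : OpenSubgroup (SL2 Af), ∀ x y, ∀ u ∈ U, F (x, y * u) = F (x, y)) ∧
    ∀ y, ContDiffOn ℝ ∞ (fun A => F (retr A, y)) posDet}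
  zero_mem' := ⟨⟨⊤, by simp⟩, fun y => contDiffOn_const⟩
  add_mem' {F G} hF hG := by
    obtain ⟨⟨U, hU⟩, hF⟩ := hF
    obtain ⟨⟨U', hU'⟩, hG⟩ := hG
    refine ⟨⟨U ⊓ U', fun x y u hu => ?_⟩, fun y => (hF y).add (hG y)⟩
    simp [hU x y u hu.1, hU' x y u hu.2]
  smul_mem' c F hF := by
    obtain ⟨⟨U, hU⟩, hF⟩ := hF
    refine ⟨⟨U, fun x y u hu => ?_⟩, fun y => (hF y).const_smul c⟩
    simp [hU x y u hu]

/-- Smooth functions `SL₂(𝔸) → V`. -/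
def SmoothFn (V : Type*) [NormedAddCommGroup V] [NormedSpace ℂ V] : Type _ := smoothSubmodule V

instance (V : Type*) [NormedAddCommGroup V] [NormedSpace ℂ V] : AddCommGroup (SmoothFn V) :=
  inferInstanceAs (AddCommGroup (smoothSubmodule V))

instance (V : Type*) [NormedAddCommGroup V] [NormedSpace ℂ V] : Module ℂ (SmoothFn V) :=
  inferInstanceAs (Module ℂ (smoothSubmodule V))

lemma SmoothFn.ext {F G : SmoothFn V} (h : ∀ p, F.1 p = G.1 p) : F = G :=
  Subtype.ext (funext h)

/-- The right translation action of `SL₂(𝔸)` on smooth functions, `(h · F)(g) = F(g h)`. -/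
def rightShift : Representation ℂ GA (SmoothFn V) where
  toFun h :=
    { toFun F := ⟨fun g => F.1 (g * h), by
        obtain ⟨⟨U, hU⟩, hF⟩ := F.2
        refine ⟨⟨U.comap (MulAut.conj h.2⁻¹).toMonoidHom (by
          show Continuous fun u => h.2⁻¹ * u * (h.2⁻¹)⁻¹
          fun_prop), fun x y u hu => ?_⟩, fun y => ?_⟩
        · have h1 := hU (x * h.1) (y * h.2) (h.2⁻¹ * u * (h.2⁻¹)⁻¹) hu
          have h2 : y * h.2 * (h.2⁻¹ * u * (h.2⁻¹)⁻¹) = y * u * h.2 := by group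
          rw [h2] at h1
          exact h1
        · have h1 : ContDiffOn ℝ ∞ (fun A => F.1 (retr (mulR h.1.1 A), y * h.2)) posDet :=
            (hF (y * h.2)).comp (mulR h.1.1).contDiff.contDiffOn
              fun A hA => mulR_mem_posDet hA h.1
          refine h1.congr fun A hA => ?_
          rw [retr_mulR hA]; rfl⟩
      map_add' _ _ := rfl
      map_smul' _ _ := rfl }
  map_one' := LinearMap.ext fun F => SmoothFn.ext fun p => by
    show F.1 (p * 1) = F.1 p
    rw [mul_one]
  map_mul' h h' := LinearMap.ext fun F => SmoothFn.ext fun p => by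
    show F.1 (p * (h * h')) = F.1 (p * h * h')
    rw [mul_assoc]

lemma rightShift_apply (h g : GA) (F : SmoothFn V) :
    (rightShift h F).1 g = F.1 (g * h) := rfl

/-- The extension of a function on `SL₂(𝔸)` in the real variable along the retraction. -/
def realExt (F : GA → V) (y : SL2 Af) (A : M2 ℝ) : V := F (retr A, y)

lemma realExt_contDiffAt (F : SmoothFn V) (y : SL2 Af) {A : M2 ℝ}
    (hA : A ∈ posDet) : ContDiffAt ℝ ∞ (realExt F.1 y) A :=
  (F.2.2 y).contDiffAt (isOpen_posDet.mem_nhds hA)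

lemma realExt_differentiableAt (F : SmoothFn V) (y : SL2 Af) {A : M2 ℝ}
    (hA : A ∈ posDet) : DifferentiableAt ℝ (realExt F.1 y) A :=
  (realExt_contDiffAt F y hA).differentiableAt (by simp)

/-- The derivative of `F` in the direction of the left invariant vector field on `SL₂(ℝ)` given by
the real matrix `X` (of trace zero): `(X F)(g) = d/dt F(g exp(t X))` at `t = 0`. -/
def lieFun (X : Matrix (Fin 2) (Fin 2) ℝ) (F : GA → V) : GA → V :=
  fun g => vecDeriv (realExt F g.2) (mulR X) (entries g.1)

/-- `lieFun X F` is the derivative along each curve in `SL₂(ℝ)` through `g` with velocity `g X`,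
for instance the curve `t ↦ g exp(t X)`. -/
lemma hasDerivAt_curve (F : SmoothFn V) (X : Matrix (Fin 2) (Fin 2) ℝ) (g : GA) {c : ℝ → SL2 ℝ}
    (h0 : c 0 = g.1) (hc : ∀ i j, HasDerivAt (fun t => c t i j) ((g.1.1 * X) i j) 0) :
    HasDerivAt (fun t => F.1 (c t, g.2)) (lieFun X F.1 g) 0 := by
  have hc' : HasDerivAt (fun t => entries (c t)) (mulR X (entries g.1)) 0 :=
    hasDerivAt_pi.2 fun i => hasDerivAt_pi.2 fun j => hc i j
  have h1 := (realExt_differentiableAt F g.2 (entries_mem_posDet (c 0))).hasFDerivAt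
  have h2 := h1.comp_hasDerivAt (0 : ℝ) hc'
  rw [h0] at h2
  refine h2.congr_of_eventuallyEq (Filter.Eventually.of_forall fun t => ?_)
  simp [realExt, retr_entries]

lemma realExt_lieFun (F : GA → V) (X : Matrix (Fin 2) (Fin 2) ℝ) (A : M2 ℝ) (y : SL2 Af)
    (hA : A ∈ posDet) :
    realExt (lieFun X F) y A = vecDeriv (realExt F y) (mulR X) A := by
  have hA' : 0 < (Matrix.of A).det := hA
  have hc : 0 < (Real.sqrt (Matrix.of A).det)⁻¹ := inv_pos.2 (Real.sqrt_pos.2 hA')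
  have h1 : entries (retr A) = (Real.sqrt (Matrix.of A).det)⁻¹ • A := by
    rw [entries, retr_val hA]; rfl
  rw [realExt, lieFun, h1]
  exact vecDeriv_smul_point (fun B => by simp [realExt, retr_smul hc]) _ _

/-- The action of a real matrix on smooth functions. -/
def lieReal (X : Matrix (Fin 2) (Fin 2) ℝ) : Module.End ℂ (SmoothFn V) where
  toFun F := ⟨lieFun X F.1, by
    obtain ⟨⟨U, hU⟩, hF⟩ := F.2
    refine ⟨⟨U, fun x y u hu => ?_⟩, fun y => ?_⟩
    · have : realExt F.1 (y * u) = realExt F.1 y := funext fun A => hU _ _ u hu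
      simp only [lieFun, this]
    · exact (vecDeriv_contDiffOn isOpen_posDet (hF y) (mulR X)).congr
        fun A hA => realExt_lieFun F.1 X A y hA⟩
  map_add' F G := SmoothFn.ext fun p => by
    have h1 := fderiv_add (realExt_differentiableAt F p.2 (entries_mem_posDet p.1))
      (realExt_differentiableAt G p.2 (entries_mem_posDet p.1))
    have h2 : realExt (F + G).1 p.2 = realExt F.1 p.2 + realExt G.1 p.2 := rfl
    show vecDeriv (realExt (F + G).1 p.2) (mulR X) (entries p.1) = _
    rw [h2, vecDeriv, h1]; rfl
  map_smul' c F := SmoothFn.ext fun p => by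
    have h1 := fderiv_const_smul (realExt_differentiableAt F p.2 (entries_mem_posDet p.1)) c
    have h2 : realExt (c • F).1 p.2 = c • realExt F.1 p.2 := rfl
    show vecDeriv (realExt (c • F).1 p.2) (mulR X) (entries p.1) = _
    rw [h2, vecDeriv, h1]; rfl

lemma lieReal_val (X : Matrix (Fin 2) (Fin 2) ℝ) (F : SmoothFn V) :
    (lieReal X F).1 = lieFun X F.1 := rfl

lemma lieReal_add (X Y : Matrix (Fin 2) (Fin 2) ℝ) :
    (lieReal (X + Y) : Module.End ℂ (SmoothFn V)) = lieReal X + lieReal Y := by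
  refine LinearMap.ext fun F => SmoothFn.ext fun p => ?_
  have h : mulR (X + Y) (entries p.1) = mulR X (entries p.1) + mulR Y (entries p.1) := by
    simp only [mulR_apply, mul_add]; rfl
  show fderiv ℝ (realExt F.1 p.2) (entries p.1) (mulR (X + Y) (entries p.1)) = _
  rw [h, map_add]; rfl

lemma lieReal_smul (c : ℝ) (X : Matrix (Fin 2) (Fin 2) ℝ) :
    (lieReal (c • X) : Module.End ℂ (SmoothFn V)) = (c : ℂ) • lieReal X := by
  refine LinearMap.ext fun F => SmoothFn.ext fun p => ?_
  have h : mulR (c • X) (entries p.1) = c • mulR X (entries p.1) := by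
    simp only [mulR_apply, Matrix.mul_smul]; rfl
  show fderiv ℝ (realExt F.1 p.2) (entries p.1) (mulR (c • X) (entries p.1)) = _
  rw [h, map_smul]; rfl

lemma lieReal_bracket (X Y : Matrix (Fin 2) (Fin 2) ℝ) :
    (lieReal (X * Y - Y * X) : Module.End ℂ (SmoothFn V)) =
      lieReal X * lieReal Y - lieReal Y * lieReal X := by
  refine LinearMap.ext fun F => SmoothFn.ext fun p => ?_
  have hp := entries_mem_posDet p.1
  have h1 := vecDeriv_bracket ((realExt_contDiffAt F p.2 hp).of_le (by norm_cast))
    (mulR X) (mulR Y)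
  have h2 : ∀ Z W : Matrix (Fin 2) (Fin 2) ℝ, (lieReal Z (lieReal W F)).1 p =
      vecDeriv (vecDeriv (realExt F.1 p.2) (mulR W)) (mulR Z) (entries p.1) := by
    intro Z W
    have h3 : realExt (lieFun W F.1) p.2 =ᶠ[nhds (entries p.1)]
        vecDeriv (realExt F.1 p.2) (mulR W) := by
      filter_upwards [isOpen_posDet.mem_nhds hp] with A hA using realExt_lieFun F.1 W A p.2 hA
    show fderiv ℝ (realExt (lieFun W F.1) p.2) (entries p.1) _ = _
    rw [h3.fderiv_eq]; rfl
  have h4 : mulR (X * Y - Y * X) (entries p.1) =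
      mulR Y (mulR X (entries p.1)) - mulR X (mulR Y (entries p.1)) := by
    simp only [mulR_apply, mul_sub, Equiv.apply_symm_apply, mul_assoc]
    rfl
  show fderiv ℝ (realExt F.1 p.2) (entries p.1) (mulR (X * Y - Y * X) (entries p.1)) =
    (lieReal X (lieReal Y F)).1 p - (lieReal Y (lieReal X F)).1 p
  rw [h2, h2, h1, h4]

lemma rightShift_lieReal (h : GA) (X : Matrix (Fin 2) (Fin 2) ℝ) (F : SmoothFn V) :
    rightShift h (lieReal X F) =
      lieReal (h.1.1 * X * (h.1⁻¹ : SL2 ℝ).1) (rightShift h F) := by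
  refine SmoothFn.ext fun p => ?_
  have hx : (h.1⁻¹ : SL2 ℝ).1 * h.1.1 = 1 := by
    rw [← Matrix.SpecialLinearGroup.coe_mul, inv_mul_cancel, Matrix.SpecialLinearGroup.coe_one]
  have hp := entries_mem_posDet p.1
  have h0 : mulR h.1.1 (entries p.1) = entries (p.1 * h.1) := rfl
  have h1 : realExt (rightShift h F).1 p.2 =ᶠ[nhds (entries p.1)]
      realExt F.1 (p.2 * h.2) ∘ (mulR h.1.1) := by
    filter_upwards [isOpen_posDet.mem_nhds hp] with A hA
    simp only [realExt, Function.comp_apply, retr_mulR hA]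
    rfl
  have h2 := vecDeriv_comp h1 (realExt_differentiableAt F (p.2 * h.2)
    (mulR_mem_posDet hp h.1)) (mulR (h.1.1 * X * (h.1⁻¹ : SL2 ℝ).1))
  have h3 : mulR h.1.1 (mulR (h.1.1 * X * (h.1⁻¹ : SL2 ℝ).1) (entries p.1)) =
      mulR X (mulR h.1.1 (entries p.1)) := by
    simp only [mulR_apply, Equiv.apply_symm_apply, mul_assoc, hx, mul_one]
  rw [h3] at h2
  exact h2.symm

end Smooth

/-! ### Automorphic forms -/

section ComplexLie

variable {V : Type*} [NormedAddCommGroup V] [NormedSpace ℂ V]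

lemma lieReal_sub (X Y : Matrix (Fin 2) (Fin 2) ℝ) :
    (lieReal (X - Y) : Module.End ℂ (SmoothFn V)) = lieReal X - lieReal Y := by
  have h : X - Y = X + (-1 : ℝ) • Y := by simp [sub_eq_add_neg]
  rw [h, lieReal_add, lieReal_smul]
  simp [sub_eq_add_neg]

lemma lieReal_zero : (lieReal 0 : Module.End ℂ (SmoothFn V)) = 0 := by
  have h := lieReal_sub (V := V) 0 0
  rwa [sub_self, sub_self] at h

/-- The real parts of the entries of a matrix. -/
def reM (X : Matrix (Fin 2) (Fin 2) ℂ) : Matrix (Fin 2) (Fin 2) ℝ := X.map Complex.re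

/-- The imaginary parts of the entries of a matrix. -/
def imM (X : Matrix (Fin 2) (Fin 2) ℂ) : Matrix (Fin 2) (Fin 2) ℝ := X.map Complex.im

lemma reM_mul (X Y : Matrix (Fin 2) (Fin 2) ℂ) :
    reM (X * Y) = reM X * reM Y - imM X * imM Y := by
  ext i j
  simp [reM, imM, Matrix.mul_apply, Fin.sum_univ_two]; ring

lemma imM_mul (X Y : Matrix (Fin 2) (Fin 2) ℂ) :
    imM (X * Y) = reM X * imM Y + imM X * reM Y := by
  ext i j
  simp [reM, imM, Matrix.mul_apply, Fin.sum_univ_two]; ring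

lemma reM_conj (g h : Matrix (Fin 2) (Fin 2) ℝ) (X : Matrix (Fin 2) (Fin 2) ℂ) :
    reM (toC g * X * toC h) = g * reM X * h := by
  ext i j
  simp [reM, toC, Matrix.mul_apply, Fin.sum_univ_two]

lemma imM_conj (g h : Matrix (Fin 2) (Fin 2) ℝ) (X : Matrix (Fin 2) (Fin 2) ℂ) :
    imM (toC g * X * toC h) = g * imM X * h := by
  ext i j
  simp [imM, toC, Matrix.mul_apply, Fin.sum_univ_two]

/-- The action of `𝔤` on smooth functions by left invariant vector fields, extended linearly from
the real matrices: `X = Y + i Z` acts as `Y + i Z`. -/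
def lieAct : sl2 →ₗ⁅ℂ⁆ Module.End ℂ (SmoothFn V) where
  toFun X := lieReal (reM X.1) + Complex.I • lieReal (imM X.1)
  map_add' X Y := by
    have h1 : reM (X + Y).1 = reM X.1 + reM Y.1 := by ext i j; simp [reM]
    have h2 : imM (X + Y).1 = imM X.1 + imM Y.1 := by ext i j; simp [imM]
    rw [h1, h2, lieReal_add, lieReal_add, smul_add]
    abel
  map_smul' c X := by
    have h1 : reM (c • X).1 = c.re • reM X.1 - c.im • imM X.1 := by
      ext i j; simp [reM, imM]
    have h2 : imM (c • X).1 = c.re • imM X.1 + c.im • reM X.1 := by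
      ext i j; simp [reM, imM]
    rw [h1, h2, lieReal_sub, lieReal_add]
    simp only [lieReal_smul, RingHom.id_apply]
    conv_rhs => rw [← Complex.re_add_im c]
    match_scalars <;> first | ring1 | linear_combination (-(c.im : ℂ)) * Complex.I_mul_I
  map_lie' {X Y} := by
    have h0 : (⁅X, Y⁆ : sl2).1 = X.1 * Y.1 - Y.1 * X.1 := rfl
    have h1 : reM (⁅X, Y⁆ : sl2).1 = (reM X.1 * reM Y.1 - reM Y.1 * reM X.1) -
        (imM X.1 * imM Y.1 - imM Y.1 * imM X.1) := by
      have : reM (X.1 * Y.1 - Y.1 * X.1) = reM (X.1 * Y.1) - reM (Y.1 * X.1) := by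
        ext i j; simp [reM]
      rw [h0, this, reM_mul, reM_mul]; abel
    have h2 : imM (⁅X, Y⁆ : sl2).1 = (reM X.1 * imM Y.1 - imM Y.1 * reM X.1) +
        (imM X.1 * reM Y.1 - reM Y.1 * imM X.1) := by
      have : imM (X.1 * Y.1 - Y.1 * X.1) = imM (X.1 * Y.1) - imM (Y.1 * X.1) := by
        ext i j; simp [imM]
      rw [h0, this, imM_mul, imM_mul]; abel
    rw [h1, h2, lieReal_sub, lieReal_add]
    simp only [lieReal_bracket, LieRing.of_associative_ring_bracket, add_mul, mul_add,
      smul_mul_assoc, mul_smul_comm]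
    match_scalars <;>
      first | ring1 | linear_combination Complex.I_mul_I | linear_combination -Complex.I_mul_I

lemma lieAct_apply (X : sl2) (F : SmoothFn V) :
    lieAct X F = lieReal (reM X.1) F + Complex.I • lieReal (imM X.1) F := rfl

lemma rightShift_lieAct (h : GA) (X : sl2) (F : SmoothFn V) :
    rightShift h (lieAct X F) = lieAct (Ad h.1 X) (rightShift h F) := by
  simp only [lieAct_apply, map_add, map_smul, rightShift_lieReal]
  have h1 : reM (Ad h.1 X).1 = h.1.1 * reM X.1 * (h.1⁻¹ : SL2 ℝ).1 := reM_conj _ _ _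
  have h2 : imM (Ad h.1 X).1 = h.1.1 * imM X.1 * (h.1⁻¹ : SL2 ℝ).1 := imM_conj _ _ _
  rw [h1, h2]

/-- The element of `SL₂(𝔸)` given by an element of `K_∞`. -/
def infIn : Kinf →* GA := (MonoidHom.inl (SL2 ℝ) (SL2 Af)).comp Kinf.subtype

/-- The element of `SL₂(𝔸)` given by an element of `SL₂(𝔸_f)`. -/
def finIn : SL2 Af →* GA := MonoidHom.inr (SL2 ℝ) (SL2 Af)

lemma Ad_one (X : sl2) : Ad 1 X = X := by
  apply Subtype.ext
  simp [Ad]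

lemma rightShift_rot (F : SmoothFn V) (g : GA) :
    HasDerivAt (fun t : ℝ => (rightShift (infIn (rot t)) F).1 g) ((lieAct Jgen F).1 g) 0 := by
  have h1 : reM Jgen.1 = !![0, -1; 1, 0] := by
    ext i j; fin_cases i <;> fin_cases j <;> simp [reM, Jgen]
  have h2 : imM Jgen.1 = 0 := by
    ext i j; fin_cases i <;> fin_cases j <;> simp [imM, Jgen]
  have h3 : lieAct Jgen F = lieReal !![0, -1; 1, 0] F := by
    rw [lieAct_apply, h1, h2, lieReal_zero]; simp
  rw [h3]
  have h0 : (rot 0 : Kinf).1 = 1 := by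
    apply Subtype.ext
    ext i j; fin_cases i <;> fin_cases j <;> simp [rot]
  have h4 := hasDerivAt_curve F !![0, -1; 1, 0] g (c := fun t => g.1 * (rot t).1) (by simp [h0]) (by
    have hc := Real.hasDerivAt_cos 0
    have hs := Real.hasDerivAt_sin 0
    simp only [Real.sin_zero, Real.cos_zero, neg_zero] at hc hs
    intro i j
    have e1 : HasDerivAt (fun t => g.1 i 0 * Real.cos t + g.1 i 1 * Real.sin t) (g.1 i 1) 0 := by
      simpa using! (hc.const_mul (g.1 i 0)).add (hs.const_mul (g.1 i 1))
    have e2 : HasDerivAt (fun t => g.1 i 0 * (-Real.sin t) + g.1 i 1 * Real.cos t)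
        (-(g.1 i 0)) 0 := by
      simpa using! (hs.neg.const_mul (g.1 i 0)).add (hc.const_mul (g.1 i 1))
    have e3 : ∀ (t : ℝ) (j : Fin 2), (g.1 * (rot t).1) i j =
        g.1 i 0 * (rot t).1 0 j + g.1 i 1 * (rot t).1 1 j := fun t j => by
      rw [Matrix.SpecialLinearGroup.coe_mul, Matrix.mul_apply, Fin.sum_univ_two]
    simp only [e3]
    fin_cases j
    · simpa [Matrix.mul_apply, Fin.sum_univ_two, rot] using! e1
    · simpa [Matrix.mul_apply, Fin.sum_univ_two, rot] using! e2)
  refine h4.congr_of_eventuallyEq (Filter.Eventually.of_forall fun t => ?_)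
  show F.1 (g * infIn (rot t)) = F.1 (g.1 * (rot t).1, g.2)
  refine congrArg F.1 ?_
  show g * infIn (rot t) = (g.1 * (rot t).1, g.2)
  exact Prod.ext rfl (mul_one g.2)

end ComplexLie

section Forms

variable {V : Type*} [NormedAddCommGroup V] [NormedSpace ℂ V]

lemma one_le_normInf (g : SL2 ℝ) : 1 ≤ normInf g := by
  rw [normInf, Real.one_le_sqrt]
  have h : g 0 0 * g 1 1 - g 0 1 * g 1 0 = 1 := by
    have := g.2
    rwa [Matrix.det_fin_two] at this
  simp only [Fin.sum_univ_two]
  nlinarith [sq_nonneg (g 0 0 - g 1 1), sq_nonneg (g 0 1 + g 1 0)]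

lemma one_le_normFin (v : HeightOneSpectrum ℤ) (g : SL2 (v.adicCompletion ℚ)) :
    1 ≤ normFin v g := by
  by_contra hlt
  simp only [normFin, not_le, max_lt_iff, Valued.toNormedField.norm_lt_one_iff] at hlt
  obtain ⟨⟨h1, h2⟩, h3, h4⟩ := hlt
  have h : g 0 0 * g 1 1 - g 0 1 * g 1 0 = 1 := by
    have := g.2
    rwa [Matrix.det_fin_two] at this
  have h5 : Valued.v (g 0 0 * g 1 1 - g 0 1 * g 1 0) < 1 := by
    refine Valuation.map_sub_lt _ ?_ ?_
    · rw [map_mul]; exact mul_lt_one_of_lt_of_le h1 h4.le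
    · rw [map_mul]; exact mul_lt_one_of_lt_of_le h2 h3.le
  rw [h, map_one] at h5
  exact lt_irrefl _ h5

lemma one_le_adelicNorm (g : GA) : 1 ≤ adelicNorm g := by
  refine one_le_mul_of_one_le_of_one_le (one_le_normInf _) ?_
  refine finprod_induction (fun r : ℝ => 1 ≤ r) le_rfl
    (fun a b ha hb => one_le_mul_of_one_le_of_one_le ha hb) fun v => one_le_normFin v _

lemma orbit_add {ι M : Type*} [AddCommGroup M] [Module ℂ M] {T : ι → Module.End ℂ M} {x y : M}
    (hx : FiniteDimensional ℂ (Submodule.span ℂ (Set.range fun i => T i x)))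
    (hy : FiniteDimensional ℂ (Submodule.span ℂ (Set.range fun i => T i y))) :
    FiniteDimensional ℂ (Submodule.span ℂ (Set.range fun i => T i (x + y))) := by
  refine Submodule.finiteDimensional_of_le (S₂ := Submodule.span ℂ (Set.range fun i => T i x) ⊔
    Submodule.span ℂ (Set.range fun i => T i y)) (Submodule.span_le.2 ?_)
  rintro _ ⟨i, rfl⟩
  simp only [map_add]
  exact Submodule.add_mem_sup (Submodule.subset_span ⟨i, rfl⟩) (Submodule.subset_span ⟨i, rfl⟩)

lemma orbit_smul {ι M : Type*} [AddCommGroup M] [Module ℂ M] {T : ι → Module.End ℂ M} {x : M}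
    (c : ℂ) (hx : FiniteDimensional ℂ (Submodule.span ℂ (Set.range fun i => T i x))) :
    FiniteDimensional ℂ (Submodule.span ℂ (Set.range fun i => T i (c • x))) := by
  refine Submodule.finiteDimensional_of_le (S₂ := Submodule.span ℂ (Set.range fun i => T i x))
    (Submodule.span_le.2 ?_)
  rintro _ ⟨i, rfl⟩
  simp only [map_smul]
  exact Submodule.smul_mem _ _ (Submodule.subset_span ⟨i, rfl⟩)

lemma orbit_zero {ι M : Type*} [AddCommGroup M] [Module ℂ M] (T : ι → Module.End ℂ M) :
    FiniteDimensional ℂ (Submodule.span ℂ (Set.range fun i => T i 0)) := by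
  refine Submodule.finiteDimensional_of_le (S₂ := ⊥) (Submodule.span_le.2 ?_)
  rintro _ ⟨i, rfl⟩
  simp

/-- The universal enveloping algebra `U(𝔤)`. -/
abbrev Ug : Type := UniversalEnvelopingAlgebra ℂ sl2

/-- The action of the universal enveloping algebra on smooth functions. -/
def envAct : Ug →ₐ[ℂ] Module.End ℂ (SmoothFn V) := UniversalEnvelopingAlgebra.lift ℂ lieAct

/-- `F` is `K`-finite for the action by right shifts. -/
def IsKFinite (F : SmoothFn V) : Prop :=
  FiniteDimensional ℂ (Submodule.span ℂ (Set.range fun k : Kmax => rightShift (k : GA) F))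

/-- `F` is finite under the action of the center `𝔷` of the universal enveloping algebra. -/
def IsZFinite (F : SmoothFn V) : Prop :=
  FiniteDimensional ℂ
    (Submodule.span ℂ (Set.range fun z : Subalgebra.center ℂ Ug => envAct (z : Ug) F))

/-- `F` is of moderate growth. -/
def HasModerateGrowth (F : SmoothFn V) : Prop :=
  ∃ (C : ℝ) (a : ℕ), ∀ g, ‖F.1 g‖ ≤ C * adelicNorm g ^ a

/-- The space `𝒜(SL₂(ℚ) \ SL₂(𝔸), ρ)` of vector-valued automorphic forms of type `ρ`. -/
def AutForm (ρ : Representation ℂ (SL2 ℚ) V) : Submodule ℂ (SmoothFn V) where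
  carrier := {F | (∀ γ g, F.1 (diag γ * g) = ρ γ (F.1 g)) ∧ IsKFinite F ∧ IsZFinite F ∧
    HasModerateGrowth F}
  zero_mem' := ⟨fun γ g => (map_zero (ρ γ)).symm, orbit_zero _, orbit_zero _, 0, 0, fun g => by
    show ‖(0 : V)‖ ≤ _
    simp⟩
  add_mem' {F G} hF hG := by
    obtain ⟨h1, h2, h3, C, a, h4⟩ := hF
    obtain ⟨k1, k2, k3, D, b, k4⟩ := hG
    refine ⟨fun γ g => ?_, orbit_add (T := fun k : Kmax => rightShift (k : GA)) h2 k2,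
      orbit_add (T := fun z : Subalgebra.center ℂ Ug => envAct (z : Ug)) h3 k3,
      |C| + |D|, a + b, fun g => ?_⟩
    · show F.1 _ + G.1 _ = ρ γ (F.1 g + G.1 g)
      rw [h1, k1, map_add]
    · have hN := one_le_adelicNorm g
      have e1 : adelicNorm g ^ a ≤ adelicNorm g ^ (a + b) := pow_le_pow_right₀ hN (by omega)
      have e2 : adelicNorm g ^ b ≤ adelicNorm g ^ (a + b) := pow_le_pow_right₀ hN (by omega)
      calc ‖F.1 g + G.1 g‖ ≤ C * adelicNorm g ^ a + D * adelicNorm g ^ b :=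
            (norm_add_le _ _).trans (add_le_add (h4 g) (k4 g))
        _ ≤ |C| * adelicNorm g ^ (a + b) + |D| * adelicNorm g ^ (a + b) := by
            have := le_abs_self C
            have := le_abs_self D
            gcongr
        _ = _ := by ring
  smul_mem' c F hF := by
    obtain ⟨h1, h2, h3, C, a, h4⟩ := hF
    refine ⟨fun γ g => ?_, orbit_smul (T := fun k : Kmax => rightShift (k : GA)) c h2,
      orbit_smul (T := fun z : Subalgebra.center ℂ Ug => envAct (z : Ug)) c h3,
      ‖c‖ * C, a, fun g => ?_⟩
    · show c • F.1 _ = ρ γ (c • F.1 g)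
      rw [h1, map_smul]
    · show ‖c • F.1 g‖ ≤ _
      rw [norm_smul, mul_assoc]
      exact mul_le_mul_of_nonneg_left (h4 g) (norm_nonneg c)

/-- The space `𝒜(SL₂(ℚ) \ SL₂(𝔸))` of (scalar) automorphic forms. -/
abbrev ScalarForm : Submodule ℂ (SmoothFn ℂ) := AutForm (Representation.trivial ℂ (SL2 ℚ) ℂ)

/-- A space of smooth functions that is stable under `(𝔤, K_∞) × SL₂(𝔸_f)`. -/
structure IsStable (W : Submodule ℂ (SmoothFn V)) : Prop where
  lie_mem : ∀ X, ∀ F ∈ W, lieAct X F ∈ W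
  inf_mem : ∀ k, ∀ F ∈ W, rightShift (infIn k) F ∈ W
  fin_mem : ∀ h, ∀ F ∈ W, rightShift (finIn h) F ∈ W

/-- A subrepresentation of the space of vector-valued automorphic forms of type `ρ`. -/
structure IsSubrep (ρ : Representation ℂ (SL2 ℚ) V) (W : Submodule ℂ (SmoothFn V)) : Prop
    extends IsStable W where
  le_autForm : W ≤ AutForm ρ

/-- The `(𝔤, K_∞) × SL₂(𝔸_f)`-representation generated by a smooth function. -/
def generated (F : SmoothFn V) : Submodule ℂ (SmoothFn V) := sInf {W | IsStable W ∧ F ∈ W}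

lemma IsKFinite.inf {F : SmoothFn V} (hF : IsKFinite F) :
    FiniteDimensional ℂ (Submodule.span ℂ (Set.range fun k : Kinf => rightShift (infIn k) F)) := by
  have : FiniteDimensional ℂ (Submodule.span ℂ
    (Set.range fun k : Kmax => rightShift (k : GA) F)) := hF
  refine Submodule.finiteDimensional_of_le (Submodule.span_le.2 ?_) (S₂ := Submodule.span ℂ
    (Set.range fun k : Kmax => rightShift (k : GA) F))
  rintro _ ⟨k, rfl⟩
  exact Submodule.subset_span ⟨⟨infIn k, ⟨k.2, one_mem Kf⟩⟩, rfl⟩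

/-- A functional on a space of smooth functions may be differentiated along the action of `K_∞`
at a `K_∞`-finite function. -/
lemma deriv_functional {W : Submodule ℂ (SmoothFn V)} {F : SmoothFn V} {c : ℝ → W} {d : W}
    (hc : ∀ t, (c t).1 = rightShift (infIn (rot t)) F) (hd : d.1 = lieAct Jgen F)
    (hF : FiniteDimensional ℂ
      (Submodule.span ℂ (Set.range fun k : Kinf => rightShift (infIn k) F)))
    (l : W →ₗ[ℂ] ℂ) : HasDerivAt (fun t => l (c t)) (l d) 0 := by
  let E : Submodule ℂ W := (Submodule.span ℂ (Set.range fun k : Kinf => rightShift (infIn k) F) ⊔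
    Submodule.span ℂ {lieAct Jgen F}).comap W.subtype
  have hE : FiniteDimensional ℂ E := by
    have h1 : FiniteDimensional ℂ (E.map W.subtype) :=
      Submodule.finiteDimensional_of_le (Submodule.map_comap_le _ _)
    exact (E.equivMapOfInjective W.subtype W.injective_subtype).symm.finiteDimensional
  have hcE : ∀ t, c t ∈ E := fun t => by
    rw [Submodule.mem_comap, Submodule.subtype_apply, hc]
    exact Submodule.mem_sup_left (Submodule.subset_span ⟨_, rfl⟩)
  have hdE : d ∈ E := by
    rw [Submodule.mem_comap, Submodule.subtype_apply, hd]
    exact Submodule.mem_sup_right (Submodule.mem_span_singleton_self _)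
  let S : Submodule ℂ (Module.Dual ℂ E) :=
    { carrier := {l | HasDerivAt (fun t => l ⟨c t, hcE t⟩) (l ⟨d, hdE⟩) 0}
      zero_mem' := hasDerivAt_const _ _
      add_mem' := fun ha hb => HasDerivAt.add ha hb
      smul_mem' := fun a _ hb => HasDerivAt.const_smul a hb }
  have hS : S.dualCoannihilator = ⊥ := by
    rw [eq_bot_iff]
    intro x hx
    rw [Submodule.mem_dualCoannihilator] at hx
    rw [Submodule.mem_bot]
    apply Subtype.ext; apply Subtype.ext
    refine SmoothFn.ext fun p => ?_
    show x.1.1.1 p = 0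
    by_contra hne
    obtain ⟨φ, -, hφ⟩ := exists_dual_vector ℂ (x.1.1.1 p) (norm_ne_zero_iff.2 hne)
    let ev : Module.Dual ℂ E :=
      φ.toLinearMap ∘ₗ LinearMap.proj p ∘ₗ (smoothSubmodule V).subtype ∘ₗ W.subtype ∘ₗ E.subtype
    have h1 : ev ∈ S := by
      have h2 := (φ.restrictScalars ℝ).hasFDerivAt.comp_hasDerivAt (0 : ℝ) (rightShift_rot F p)
      show HasDerivAt (fun t => φ ((c t).1.1 p)) (φ (d.1.1 p)) 0
      simp only [hc, hd]
      exact h2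
    have h3 : φ (x.1.1.1 p) = 0 := hx ev h1
    rw [hφ] at h3
    exact hne (by simpa using h3)
  have hS' : S = ⊤ := by
    rw [← Subspace.dualCoannihilator_dualAnnihilator_eq (W := S), hS,
      Submodule.dualAnnihilator_bot]
  have : l ∘ₗ E.subtype ∈ S := by rw [hS']; trivial
  exact this

/-- The adelic module given by a subrepresentation of a space of automorphic forms. -/
def IsSubrep.toModule {ρ : Representation ℂ (SL2 ℚ) V} {W : Submodule ℂ (SmoothFn V)}
    (h : IsSubrep ρ W) : AdelicModule W where
  lie :=
    { toFun X := (lieAct X).restrict (h.lie_mem X)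
      map_add' X Y := by ext F : 2; simp
      map_smul' c X := by ext F : 2; simp
      map_lie' {X Y} := by
        refine LinearMap.ext fun F => Subtype.ext ?_
        show lieAct ⁅X, Y⁆ F.1 = lieAct X (lieAct Y F.1) - lieAct Y (lieAct X F.1)
        rw [LieHom.map_lie]; rfl }
  rhoInf :=
    { toFun k := (rightShift (infIn k)).restrict (h.inf_mem k)
      map_one' := by ext F : 2; simp
      map_mul' k k' := by ext F : 2; simp }
  rhoFin :=
    { toFun k := (rightShift (finIn k)).restrict (h.fin_mem k)
      map_one' := by ext F : 2; simp
      map_mul' k k' := by ext F : 2; simp }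
  kFinite F := by
    have h1 := IsKFinite.inf (h.le_autForm F.2).2.1
    have h2 : FiniteDimensional ℂ ((Submodule.span ℂ (Set.range fun k : Kinf =>
        (rightShift (infIn k)).restrict (h.inf_mem k) F)).map W.subtype) := by
      rw [Submodule.map_span, ← Set.range_comp]
      exact h1
    exact (Submodule.equivMapOfInjective W.subtype W.injective_subtype _).symm.finiteDimensional
  deriv_rot F l :=
    deriv_functional (F := F.1) (fun t => rfl) rfl (IsKFinite.inf (h.le_autForm F.2).2.1) l
  ad k X F := Subtype.ext (rightShift_lieAct (infIn k) X F.1)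
  comm_lie y X F := Subtype.ext (by
    have h1 := rightShift_lieAct (finIn y) X F.1
    have h2 : (finIn y).1 = 1 := rfl
    rw [h2, Ad_one] at h1
    exact h1)
  comm_inf y k F := Subtype.ext (by
    show rightShift (finIn y) (rightShift (infIn k) F.1) =
      rightShift (infIn k) (rightShift (finIn y) F.1)
    rw [← Module.End.mul_apply, ← Module.End.mul_apply, ← map_mul, ← map_mul]
    congr 2
    exact Prod.ext (by simp [finIn, infIn]) (by simp [finIn, infIn]))
  smooth F := by
    obtain ⟨⟨U, hU⟩, -⟩ := F.1.2
    refine ⟨U, fun u hu => Subtype.ext (SmoothFn.ext fun p => ?_)⟩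
    have h1 := hU p.1 p.2 u hu
    show F.1.1 (p * finIn u) = F.1.1 p
    have h2 : p * finIn u = (p.1, p.2 * u) := Prod.ext (mul_one _) rfl
    rw [h2, h1]

/-- An adelic module is vector-valued automorphic of type `ρ` if it is a subquotient of the space
of vector-valued automorphic forms of type `ρ`, that is, a quotient of a subrepresentation. -/
def IsAutomorphic (ρ : Representation ℂ (SL2 ℚ) V) {M : Type*} [AddCommGroup M] [Module ℂ M]
    (π : AdelicModule M) : Prop :=
  ∃ (W : Submodule ℂ (SmoothFn V)) (hW : IsSubrep ρ W) (φ : W →ₗ[ℂ] M),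
    Function.Surjective φ ∧ Intertwines hW.toModule π φ

/-- The product of a vector-valued and a scalar smooth function. -/
def mulFn : SmoothFn V →ₗ[ℂ] SmoothFn ℂ →ₗ[ℂ] SmoothFn V :=
  LinearMap.mk₂ ℂ (fun u f => ⟨fun g => f.1 g • u.1 g, by
      obtain ⟨⟨U, hU⟩, hu⟩ := u.2
      obtain ⟨⟨U', hU'⟩, hf⟩ := f.2
      refine ⟨⟨U ⊓ U', fun x y z hz => ?_⟩, fun y => (hf y).smul (hu y)⟩
      simp only [hU x y z hz.1, hU' x y z hz.2]⟩)
    (fun u u' f => SmoothFn.ext fun p => smul_add (f.1 p) (u.1 p) (u'.1 p))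
    (fun c u f => SmoothFn.ext fun p => smul_comm (f.1 p) c (u.1 p))
    (fun u f f' => SmoothFn.ext fun p => add_smul (f.1 p) (f'.1 p) (u.1 p))
    (fun c u f => SmoothFn.ext fun p => smul_assoc c (f.1 p) (u.1 p))

lemma mulFn_apply (u : SmoothFn V) (f : SmoothFn ℂ) (g : GA) :
    (mulFn u f).1 g = f.1 g • u.1 g := rfl

end Forms

/-! ### The representations `sym^m` and the functions `𝔢_{j,m-j}` -/

section Sym

/-- The space `ℂ[X]_m` of polynomials of degree at most `m`; the vector `p` of coefficients stands
for the polynomial `∑ i, p i * X ^ i`. -/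
abbrev PolyLE (m : ℕ) : Type := Fin (m + 1) → ℂ

variable {m : ℕ}

/-- For `A = !![a, b; c, d]` and a polynomial `p` of degree at most `m`, the polynomial
`∑ i, p i * (d X - b) ^ i * (a - c X) ^ (m - i)`. For determinant one, this is
`(a - c X) ^ m * p ((d X - b) / (a - c X))`, that is, the slash action `p |_{-m} A⁻¹`. -/
def symPoly (A : Matrix (Fin 2) (Fin 2) ℂ) (p : PolyLE m) : Polynomial ℂ :=
  ∑ i : Fin (m + 1), Polynomial.C (p i) *
    ((Polynomial.C (A 1 1) * Polynomial.X - Polynomial.C (A 0 1)) ^ (i : ℕ) *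
      (Polynomial.C (A 0 0) - Polynomial.C (A 1 0) * Polynomial.X) ^ (m - i))

/-- The action of matrices on `ℂ[X]_m`. -/
def symEnd (A : Matrix (Fin 2) (Fin 2) ℂ) : Module.End ℂ (PolyLE m) where
  toFun p j := (symPoly A p).coeff j
  map_add' p q := by
    ext j
    simp [symPoly, add_mul, Finset.sum_add_distrib]
  map_smul' c p := by
    ext j
    simp [symPoly, Finset.mul_sum, mul_assoc]

/-- The homogeneous polynomial in two variables associated with `p`. -/
def homEval (p : PolyLE m) (u v : ℂ) : ℂ := ∑ i : Fin (m + 1), p i * (u ^ (i : ℕ) * v ^ (m - i))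

lemma symPoly_natDegree (A : Matrix (Fin 2) (Fin 2) ℂ) (p : PolyLE m) :
    (symPoly A p).natDegree < m + 1 := by
  refine Nat.lt_succ_of_le (Polynomial.natDegree_sum_le_of_forall_le _ _ fun i _ => ?_)
  have h1 : (Polynomial.C (A 1 1) * Polynomial.X - Polynomial.C (A 0 1)).natDegree ≤ 1 := by
    compute_degree
  have h2 : (Polynomial.C (A 0 0) - Polynomial.C (A 1 0) * Polynomial.X).natDegree ≤ 1 := by
    compute_degree
  have hi : (i : ℕ) ≤ m := Nat.lt_succ_iff.1 i.2
  refine (Polynomial.natDegree_C_mul_le _ _).trans ((Polynomial.natDegree_mul_le).trans ?_)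
  have h3 := Polynomial.natDegree_pow_le_of_le (i : ℕ) h1
  have h4 := Polynomial.natDegree_pow_le_of_le (m - i : ℕ) h2
  omega

lemma homEval_symEnd_one (A : Matrix (Fin 2) (Fin 2) ℂ) (p : PolyLE m) (x : ℂ) :
    homEval (symEnd A p) x 1 = homEval p (A 1 1 * x - A 0 1) (A 0 0 - A 1 0 * x) := by
  have h1 := Polynomial.eval_eq_sum_range' (symPoly_natDegree A p) x
  have h2 : homEval (symEnd A p) x 1 = (symPoly A p).eval x := by
    rw [h1, Finset.sum_range]
    simp [homEval, symEnd]
  rw [h2]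
  simp [symPoly, homEval, Polynomial.eval_finsetSum]

lemma homEval_mul (p : PolyLE m) (c u v : ℂ) :
    homEval p (c * u) (c * v) = c ^ m * homEval p u v := by
  rw [homEval, homEval, Finset.mul_sum]
  refine Finset.sum_congr rfl fun i _ => ?_
  have hi : (i : ℕ) + (m - i) = m := Nat.add_sub_cancel' (Nat.lt_succ_iff.1 i.2)
  calc p i * ((c * u) ^ (i : ℕ) * (c * v) ^ (m - i))
      = c ^ ((i : ℕ) + (m - i)) * (p i * (u ^ (i : ℕ) * v ^ (m - i))) := by
        rw [mul_pow, mul_pow, pow_add]; ring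
    _ = _ := by rw [hi]

lemma homEval_symEnd (A : Matrix (Fin 2) (Fin 2) ℂ) (p : PolyLE m) (u v : ℂ) :
    homEval (symEnd A p) u v = homEval p (A 1 1 * u - A 0 1 * v) (A 0 0 * v - A 1 0 * u) := by
  have key : ∀ w ∈ ({0}ᶜ : Set ℂ), homEval (symEnd A p) u w =
      homEval p (A 1 1 * u - A 0 1 * w) (A 0 0 * w - A 1 0 * u) := by
    intro w hw
    have hw : w ≠ 0 := hw
    have h1 := homEval_mul (symEnd A p) w (u / w) 1
    rw [homEval_symEnd_one, ← homEval_mul, mul_div_cancel₀ _ hw, mul_one] at h1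
    rw [h1]
    congr 1 <;> field_simp
  have hc1 : Continuous fun w => homEval (symEnd A p) u w := by unfold homEval; fun_prop
  have hc2 : Continuous fun w => homEval p (A 1 1 * u - A 0 1 * w) (A 0 0 * w - A 1 0 * u) := by
    unfold homEval; fun_prop
  exact congrFun (Continuous.ext_on (dense_compl_singleton (0 : ℂ)) hc1 hc2 key) v

lemma homEval_injective {p q : PolyLE m} (h : ∀ x, homEval p x 1 = homEval q x 1) : p = q := by
  have h1 : (∑ i : Fin (m + 1), Polynomial.monomial (i : ℕ) (p i)) =
      ∑ i : Fin (m + 1), Polynomial.monomial (i : ℕ) (q i) := by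
    refine Polynomial.funext fun x => ?_
    simpa [homEval, Polynomial.eval_finsetSum, Polynomial.eval_monomial] using h x
  ext j
  have h2 := congrArg (fun r => Polynomial.coeff r (j : ℕ)) h1
  simpa [Polynomial.finsetSum_coeff, Polynomial.coeff_monomial, Fin.val_inj] using h2

/-- The action of matrices on `ℂ[X]_m` as a homomorphism of monoids. -/
def symHom (m : ℕ) : Matrix (Fin 2) (Fin 2) ℂ →* Module.End ℂ (PolyLE m) where
  toFun := symEnd
  map_one' := LinearMap.ext fun p => homEval_injective fun x => by
    simp [homEval_symEnd]
  map_mul' A B := LinearMap.ext fun p => homEval_injective fun x => by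
    rw [Module.End.mul_apply, homEval_symEnd, homEval_symEnd, homEval_symEnd]
    simp only [Matrix.mul_apply, Fin.sum_univ_two]
    congr 1 <;> ring

/-- The inclusion of `SL₂(ℝ)` into the complex matrices. -/
def slToC : SL2 ℝ →* Matrix (Fin 2) (Fin 2) ℂ where
  toFun g := toC g.1
  map_one' := by rw [Matrix.SpecialLinearGroup.coe_one, map_one]
  map_mul' g h := by rw [Matrix.SpecialLinearGroup.coe_mul, map_mul]

/-- The representation `sym^m` of `SL₂(ℝ)` on `ℂ[X]_m`. -/
def sym (m : ℕ) : Representation ℂ (SL2 ℝ) (PolyLE m) := (symHom m).comp slToC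

/-- The arithmetic type `sym^m`, extended to `SL₂(ℚ)`. -/
def symQ (m : ℕ) : Representation ℂ (SL2 ℚ) (PolyLE m) :=
  (sym m).comp (Matrix.SpecialLinearGroup.map (algebraMap ℚ ℝ))

/-- The orbit map `A ↦ sym^m(A) p`. -/
def symOrbit (p : PolyLE m) (A : M2 ℂ) : PolyLE m := symHom m (Matrix.of A) p

lemma contDiff_coeff_mul {E : Type*} [NormedAddCommGroup E] [NormedSpace ℂ E]
    {P Q : E → Polynomial ℂ} (hP : ∀ n, ContDiff ℂ ∞ fun x => (P x).coeff n)
    (hQ : ∀ n, ContDiff ℂ ∞ fun x => (Q x).coeff n) (n : ℕ) :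
    ContDiff ℂ ∞ fun x => (P x * Q x).coeff n := by
  simp only [Polynomial.coeff_mul]
  exact ContDiff.sum fun i _ => (hP _).mul (hQ _)

lemma contDiff_coeff_pow {E : Type*} [NormedAddCommGroup E] [NormedSpace ℂ E]
    {P : E → Polynomial ℂ} (hP : ∀ n, ContDiff ℂ ∞ fun x => (P x).coeff n) (k n : ℕ) :
    ContDiff ℂ ∞ fun x => (P x ^ k).coeff n := by
  induction k generalizing n with
  | zero => simpa using contDiff_const
  | succ k ih =>
    simp only [pow_succ]
    exact contDiff_coeff_mul ih hP n

lemma contDiff_symOrbit (p : PolyLE m) : ContDiff ℂ ∞ (symOrbit p) := by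
  refine contDiff_pi.2 fun j => ?_
  show ContDiff ℂ ∞ fun A : M2 ℂ => (symPoly (Matrix.of A) p).coeff j
  simp only [symPoly, Polynomial.finsetSum_coeff, Polynomial.coeff_C_mul, Matrix.of_apply]
  refine ContDiff.sum fun i _ => contDiff_const.mul
    (contDiff_coeff_mul (contDiff_coeff_pow (fun n => ?_) _) (contDiff_coeff_pow (fun n => ?_) _) _)
  · simp only [Polynomial.coeff_sub, Polynomial.coeff_C_mul, Polynomial.coeff_C,
      Polynomial.coeff_X]
    split_ifs <;> fun_prop
  · simp only [Polynomial.coeff_sub, Polynomial.coeff_C_mul, Polynomial.coeff_C,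
      Polynomial.coeff_X]
    split_ifs <;> fun_prop

/-- The identity matrix. -/
def oneM : M2 ℂ := Matrix.of.symm 1

lemma symOrbit_oneM (p : PolyLE m) : symOrbit p oneM = p := by
  simp [symOrbit, oneM]

/-- The differential of `sym^m`: the derivative of `A ↦ sym^m(A)` at the identity in the
direction `X`. -/
def dsymFun (X : Matrix (Fin 2) (Fin 2) ℂ) (p : PolyLE m) : PolyLE m :=
  fderiv ℂ (symOrbit p) oneM (Matrix.of.symm X)

lemma symOrbit_diff (p : PolyLE m) : Differentiable ℂ (symOrbit p) :=
  (contDiff_symOrbit p).differentiable (by simp)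

/-- Left multiplication by a matrix. -/
def mulL (B : Matrix (Fin 2) (Fin 2) ℂ) : M2 ℂ →L[ℂ] M2 ℂ :=
  LinearMap.toContinuousLinearMap
    { toFun A := Matrix.of.symm (B * Matrix.of A)
      map_add' A A' := congrArg Matrix.of.symm (mul_add B (Matrix.of A) (Matrix.of A'))
      map_smul' c A := congrArg Matrix.of.symm (Matrix.mul_smul B c (Matrix.of A)) }

lemma mulL_apply (B : Matrix (Fin 2) (Fin 2) ℂ) (A : M2 ℂ) :
    mulL B A = Matrix.of.symm (B * Matrix.of A) := rfl

lemma symHom_dsymFun (B X : Matrix (Fin 2) (Fin 2) ℂ) (p : PolyLE m) :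
    symHom m B (dsymFun X p) = fderiv ℂ (symOrbit p) (Matrix.of.symm B) (Matrix.of.symm (B * X)) := by
  have h0 : mulL B oneM = Matrix.of.symm B := by simp [mulL_apply, oneM]
  have h1 : (fun A => symOrbit p (mulL B A)) = fun A => symHom m B (symOrbit p A) := by
    ext1 A
    simp only [symOrbit, mulL_apply, Equiv.apply_symm_apply, map_mul, Module.End.mul_apply]
  have h2 := ((symOrbit_diff p (mulL B oneM)).hasFDerivAt.comp oneM (mulL B).hasFDerivAt).fderiv
  have h3 := ((LinearMap.toContinuousLinearMap (symHom m B)).hasFDerivAt.comp oneM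
    (symOrbit_diff p oneM).hasFDerivAt).fderiv
  have h4 : fderiv ℂ (symOrbit p ∘ mulL B) oneM =
    fderiv ℂ (LinearMap.toContinuousLinearMap (symHom m B) ∘ symOrbit p) oneM :=
    congrArg (fun f => fderiv ℂ f oneM) h1
  rw [h2, h3, h0] at h4
  have h5 := DFunLike.congr_fun h4 (Matrix.of.symm X)
  exact h5.symm

/-- The differential of `sym^m` as a representation of `𝔤`. -/
def dsym (m : ℕ) : sl2 →ₗ⁅ℂ⁆ Module.End ℂ (PolyLE m) where
  toFun X :=
    { toFun p := dsymFun X.1 p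
      map_add' p q := by
        have h1 : symOrbit (p + q) = symOrbit p + symOrbit q := by
          ext1 A; simp [symOrbit]
        rw [dsymFun, h1, fderiv_add (symOrbit_diff p _) (symOrbit_diff q _)]; rfl
      map_smul' c p := by
        have h1 : symOrbit (c • p) = c • symOrbit p := by
          ext1 A; simp [symOrbit]
        rw [dsymFun, h1, fderiv_const_smul (symOrbit_diff p _)]; rfl }
  map_add' X Y := LinearMap.ext fun p =>
    (fderiv ℂ (symOrbit p) oneM).map_add (Matrix.of.symm X.1) (Matrix.of.symm Y.1)
  map_smul' c X := LinearMap.ext fun p =>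
    (fderiv ℂ (symOrbit p) oneM).map_smul c (Matrix.of.symm X.1)
  map_lie' {X Y} := LinearMap.ext fun p => by
    show dsymFun (X.1 * Y.1 - Y.1 * X.1) p = dsymFun X.1 (dsymFun Y.1 p) - dsymFun Y.1 (dsymFun X.1 p)
    have hm : ∀ Z : Matrix (Fin 2) (Fin 2) ℂ, mulR Z oneM = Matrix.of.symm Z := fun Z => by
      simp [mulR_apply, oneM]
    have h1 : ∀ Z W : Matrix (Fin 2) (Fin 2) ℂ, dsymFun Z (dsymFun W p) =
        vecDeriv (vecDeriv (symOrbit p) (mulR W)) (mulR Z) oneM := by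
      intro Z W
      have h2 : symOrbit (dsymFun W p) = vecDeriv (symOrbit p) (mulR W) := by
        ext1 A
        rw [symOrbit, symHom_dsymFun]; rfl
      rw [dsymFun, h2, vecDeriv, hm]
    have h3 := vecDeriv_bracket ((contDiff_symOrbit p).contDiffAt (x := oneM).of_le
      (by norm_cast)) (mulR X.1) (mulR Y.1)
    rw [h1, h1, h3, hm, hm]
    rfl

/-- The irreducible `(m + 1)`-dimensional `(𝔤, K_∞)`-module `sym^m`, regarded as an adelic module
with trivial action of `SL₂(𝔸_f)`. -/
def symModule (m : ℕ) : AdelicModule (PolyLE m) where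
  lie := dsym m
  rhoInf := (sym m).comp Kinf.subtype
  rhoFin := Representation.trivial ℂ (SL2 Af) (PolyLE m)
  kFinite p := inferInstance
  deriv_rot p l := by
    have h0 : toC (rot 0).1.1 = 1 := by
      ext i j; fin_cases i <;> fin_cases j <;> simp [rot, toC]
    have hc : HasDerivAt (fun t : ℝ => (Matrix.of.symm (toC (rot t).1.1) : M2 ℂ))
        (Matrix.of.symm Jgen.1) 0 := by
      have hcos := (Real.hasDerivAt_cos 0).ofReal_comp
      have hsin := (Real.hasDerivAt_sin 0).ofReal_comp
      simp only [Real.sin_zero, Real.cos_zero, neg_zero] at hcos hsin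
      refine hasDerivAt_pi.2 fun i => hasDerivAt_pi.2 fun j => ?_
      fin_cases i <;> fin_cases j
      · simpa [toC, rot, Jgen] using! hcos
      · simpa [toC, rot, Jgen] using! hsin.neg
      · simpa [toC, rot, Jgen] using! hsin
      · simpa [toC, rot, Jgen] using! hcos
    have h1 : HasFDerivAt (symOrbit p) (fderiv ℂ (symOrbit p) oneM)
        (Matrix.of.symm (toC (rot 0).1.1)) := by
      rw [h0]; exact (symOrbit_diff p oneM).hasFDerivAt
    have h2 := (h1.restrictScalars ℝ).comp_hasDerivAt (0 : ℝ) hc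
    exact ((LinearMap.toContinuousLinearMap l).restrictScalars ℝ).hasFDerivAt.comp_hasDerivAt
      (0 : ℝ) h2
  ad k X p := by
    show symHom m (toC k.1.1) (dsymFun X.1 p) =
      dsymFun (toC k.1.1 * X.1 * toC (k.1⁻¹ : SL2 ℝ).1) (symHom m (toC k.1.1) p)
    have hk := toC_inv_mul k.1
    have h1 : symOrbit (symHom m (toC k.1.1) p) = symOrbit p ∘ mulR (toC k.1.1) := by
      ext1 A
      simp [symOrbit, mulR_apply]
    have h2 : mulR (toC k.1.1) oneM = Matrix.of.symm (toC k.1.1) := by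
      simp [mulR_apply, oneM]
    have h3 := ((symOrbit_diff p (mulR (toC k.1.1) oneM)).hasFDerivAt.comp oneM
      (mulR (toC k.1.1)).hasFDerivAt).fderiv
    rw [symHom_dsymFun, dsymFun, h1, h3, h2]
    have h4 : mulR (toC k.1.1) (Matrix.of.symm (toC k.1.1 * X.1 * toC (k.1⁻¹ : SL2 ℝ).1)) =
        Matrix.of.symm (toC k.1.1 * X.1) := by
      rw [mulR_apply, Equiv.apply_symm_apply, mul_assoc, hk, mul_one]
    rw [ContinuousLinearMap.comp_apply, h4]
  comm_lie h X p := rfl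
  comm_inf h k p := rfl
  smooth p := ⟨⊤, fun u _ => rfl⟩

end Sym

section RestrictedTensor

variable {E : HeightOneSpectrum ℤ → Type*} [∀ v, AddCommGroup (E v)] [∀ v, Module ℂ (E v)]

/-- The restricted tensor product `⨂'_v E v` over the finite places with respect to vectors `x v`:
it is spanned by the pure tensors almost all of whose components equal the given vectors. -/
def restrictedTensor (x : ∀ v, E v) : Submodule ℂ (PiTensorProduct ℂ E) :=
  Submodule.span ℂ {t | ∃ w : ∀ v, E v, (∀ᶠ v in Filter.cofinite, w v = x v) ∧
    t = PiTensorProduct.tprod ℂ w}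

lemma eventually_mem_Kfin (g : SL2 Af) : ∀ᶠ v in Filter.cofinite, localComponent v g ∈ Kfin v := by
  have h : ∀ i j, ∀ᶠ v in Filter.cofinite, (g i j) v ∈ v.adicCompletionIntegers ℚ :=
    fun i j => (g i j).2
  filter_upwards [h 0 0, h 0 1, h 1 0, h 1 1] with v h00 h01 h10 h11
  have hdet := (localComponent v g).2
  let A : Matrix (Fin 2) (Fin 2) (v.adicCompletionIntegers ℚ) :=
    !![⟨_, h00⟩, ⟨_, h01⟩; ⟨_, h10⟩, ⟨_, h11⟩]
  have hA : (algebraMap (v.adicCompletionIntegers ℚ) (v.adicCompletion ℚ)).mapMatrix A =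
      (localComponent v g).1 := by
    ext i j; fin_cases i <;> fin_cases j <;> rfl
  have hA1 : A.det = 1 := by
    rw [← hA, ← RingHom.map_det] at hdet
    exact Subtype.val_injective hdet
  exact ⟨⟨A, hA1⟩, Subtype.ext hA⟩

/-- The action of `SL₂(𝔸_f)` on the restricted tensor product of representations of the groups
`SL₂(ℚ_v)` with respect to vectors that are spherical at almost all places. -/
def restrictedTensorRep
    (π : ∀ v : HeightOneSpectrum ℤ, Representation ℂ (SL2 (v.adicCompletion ℚ)) (E v))
    (x : ∀ v, E v)
    (hx : ∀ᶠ v : HeightOneSpectrum ℤ in Filter.cofinite,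
      ∀ k : SL2 (v.adicCompletion ℚ), k ∈ Kfin v → π v k (x v) = x v) :
    Representation ℂ (SL2 Af) (restrictedTensor x) where
  toFun g := (PiTensorProduct.map fun v => π v (localComponent v g)).restrict (by
    intro t ht
    refine (Submodule.span_le (p := (restrictedTensor x).comap
      (PiTensorProduct.map fun v => π v (localComponent v g)))).2 ?_ ht
    rintro _ ⟨w, hw, rfl⟩
    refine Submodule.subset_span ⟨fun v => π v (localComponent v g) (w v), ?_,
      PiTensorProduct.map_tprod _ _⟩
    filter_upwards [hw, hx, eventually_mem_Kfin g] with v h1 h2 h3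
    rw [h1, h2 _ h3])
  map_one' := LinearMap.ext fun t => Subtype.ext (by
    show PiTensorProduct.map (fun v => π v (localComponent v 1)) t.1 = t.1
    simp only [map_one]
    rw [PiTensorProduct.map_one]; rfl)
  map_mul' g h := LinearMap.ext fun t => Subtype.ext (by
    show PiTensorProduct.map (fun v => π v (localComponent v (g * h))) t.1 =
      PiTensorProduct.map (fun v => π v (localComponent v g))
        (PiTensorProduct.map (fun v => π v (localComponent v h)) t.1)
    simp only [map_mul]
    rw [PiTensorProduct.map_mul]; rfl)

/-- The space of the restricted tensor product `⨂'_v 1_v` of the trivial representations over the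
finite places. -/
abbrev TrivialTensor : Type :=
  restrictedTensor (E := fun _ : HeightOneSpectrum ℤ => ℂ) (fun _ => (1 : ℂ))

/-- The representation `⨂'_v 1_v` of `SL₂(𝔸_f)`, the restricted tensor product of the trivial
representations of the groups `SL₂(ℚ_v)`. -/
def trivialTensorRep : Representation ℂ (SL2 Af) TrivialTensor :=
  restrictedTensorRep (fun v => Representation.trivial ℂ (SL2 (v.adicCompletion ℚ)) ℂ)
    (fun _ => (1 : ℂ)) (Filter.Eventually.of_forall fun _ _ _ => rfl)

lemma trivialTensorRep_apply (g : SL2 Af) (t : TrivialTensor) : trivialTensorRep g t = t := by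
  refine Subtype.ext ?_
  show PiTensorProduct.map (fun _ : HeightOneSpectrum ℤ => (1 : Module.End ℂ ℂ)) t.1 = t.1
  rw [PiTensorProduct.map_one]; rfl

/-- The representation `⨂'_v 1_v`, regarded as an adelic module with trivial action of
`(𝔤, K_∞)`. -/
def trivialTensorModule : AdelicModule TrivialTensor where
  lie := 0
  rhoInf := Representation.trivial ℂ Kinf TrivialTensor
  rhoFin := trivialTensorRep
  kFinite t := by
    refine Submodule.finiteDimensional_of_le (S₂ := Submodule.span ℂ {t}) (Submodule.span_le.2 ?_)
    rintro _ ⟨k, rfl⟩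
    exact Submodule.mem_span_singleton_self _
  deriv_rot t l := by simpa using hasDerivAt_const (0 : ℝ) (l t)
  ad k X t := by simp
  comm_lie h X t := by simp
  comm_inf h k t := by simp
  smooth t := ⟨⊤, fun u _ => trivialTensorRep_apply u t⟩

end RestrictedTensor

section Lift

variable {V : Type*} [NormedAddCommGroup V] [NormedSpace ℂ V]

/-- The slash action `(f |_k g)(τ) = (c τ + d)^{-k} f(g τ)` of `SL₂(ℝ)` in the variable `τ`. -/
def slash (k : ℤ) (f : UpperHalfPlane → V) (g : SL2 ℝ) (τ : UpperHalfPlane) : V :=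
  (((g 1 0 : ℝ) : ℂ) * (τ : ℂ) + ((g 1 1 : ℝ) : ℂ)) ^ (-k) • f (g • τ)

open scoped Classical in
/-- The function `f̃(γ g_∞ k_f) = ρ(γ) (f |_k g_∞)(i)` on `SL₂(𝔸)` associated with a function `f` on
the upper half plane that is modular of weight `k` and type `ρ`, where `γ ∈ SL₂(ℚ)`,
`g_∞ ∈ SL₂(ℝ)`, and `k_f ∈ K_f` (the value does not depend on the decomposition). -/
def adelicLift (ρ : Representation ℂ (SL2 ℚ) V) (k : ℤ) (f : UpperHalfPlane → V) (g : GA) : V :=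
  if h : ∃ t : SL2 ℚ × SL2 ℝ × Kf, g = diag t.1 * (t.2.1, (t.2.2 : SL2 Af)) then
    ρ h.choose.1 (slash k f h.choose.2.1 UpperHalfPlane.I)
  else 0

/-- The function `𝔢_{j,m-j}(τ) = (-1)^{m-j} / j! * y^{j-m} (X - τ)^j (X - τ̄)^{m-j}`, with values in
`ℂ[X]_m`. -/
def eFun (m j : ℕ) (τ : UpperHalfPlane) : PolyLE m := fun i =>
  ((-1) ^ (m - j) / (j.factorial : ℂ) * ((τ.im : ℝ) : ℂ) ^ ((j : ℤ) - (m : ℤ))) *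
    ((Polynomial.X - Polynomial.C (τ : ℂ)) ^ j *
      (Polynomial.X - Polynomial.C (starRingEnd ℂ (τ : ℂ))) ^ (m - j)).coeff (i : ℕ)

/-- The vector-valued automorphic form `𝔢̃_{j,m-j}` associated with `𝔢_{j,m-j}`, which is a modular
form of weight `m - 2 j` and type `sym^m`. -/
def eTilde (m j : ℕ) : GA → PolyLE m := adelicLift (symQ m) ((m : ℤ) - 2 * (j : ℤ)) (eFun m j)

end Lift

end VVAut

end

open scoped TensorProduct
open VVAut

open scoped ContDiff TensorProduct
open IsDedekindDomain

noncomputable section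

namespace VVAut

attribute [local instance 100] LieRing.ofAssociativeRing

/-! ### The functions `g ↦ sym^m(g_∞) p` -/

section Sections

variable {m : ℕ}

/-! The functions `𝔢_{j,m-j}` are modular of type `sym^m` under all of `SL₂(ℝ)`, not only under a
discrete subgroup (`slash_eFun`). With strong approximation this gives `𝔢̃_{j,m-j}(g) = sym^m(g_∞)
𝔢_{j,m-j}(i)` (`eTilde_eq`), so everything takes place among the functions `secFn p : g ↦ sym^m(g_∞)
p`. The map `secFn` is injective and turns `sym^m` into right translation and its differential into
left invariant derivation, while `SL₂(𝔸_f)` fixes its image `secRange m`. As `sym^m` is irreducible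
over `𝔤`, every nonzero `secFn p` generates `secRange m`; this gives the first two assertions, the
restricted tensor product of trivial representations being a line.

Multiplication by `secFn p` is injective because `sym^m(g_∞)` is invertible at every point. For the
same reason the values of a basis of `secRange m` are linearly independent at every point, so that
multiplication is injective on the whole tensor product (`mulTensor_injective`). The statement on
subquotients follows because tensoring preserves surjections.

The analytic content is that the products are automorphic, and there the only difficulty is
finiteness under `𝔷`. A `K`-finite and `𝔷`-finite `f` lies in a family of finite-dimensional spaces
`T n`, `n ∈ ℤ`, preserved by the weight operator `i J` and shifted by the raising and lowering
operators (`exists_isGradedFn`). By the Leibniz rule, products with weight vectors of `sym^m` form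
such a family again (`gradedProd_isGraded`). Central elements have weight zero under `ad(i J)`,
hence preserve each member of a family (`center_mem_shiftSpace`), which bounds their orbits. -/

/-- Complexification of real matrices as a continuous linear map. -/
def cplx : M2 ℝ →L[ℝ] M2 ℂ :=
  ContinuousLinearMap.pi fun i => ContinuousLinearMap.pi fun j =>
    Complex.ofRealCLM ∘L ContinuousLinearMap.proj (R := ℝ) (φ := fun _ : Fin 2 => ℝ) j ∘L
      ContinuousLinearMap.proj (R := ℝ) (φ := fun _ : Fin 2 => Fin 2 → ℝ) i

lemma homEval_smul (c : ℂ) (p : PolyLE m) (u v : ℂ) :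
    homEval (c • p) u v = c * homEval p u v := by
  simp [homEval, Finset.mul_sum, mul_assoc]

lemma symHom_smul (c : ℂ) (A : Matrix (Fin 2) (Fin 2) ℂ) (p : PolyLE m) :
    symHom m (c • A) p = c ^ m • symHom m A p := by
  refine homEval_injective fun x => ?_
  rw [homEval_smul]
  show homEval (symEnd _ p) x 1 = c ^ m * homEval (symEnd _ p) x 1
  rw [homEval_symEnd, homEval_symEnd, ← homEval_mul]
  simp only [Matrix.smul_apply, smul_eq_mul]
  congr 1 <;> ring

lemma symOrbit_smul (c : ℂ) (A : M2 ℂ) (p : PolyLE m) :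
    symOrbit p (c • A) = c ^ m • symOrbit p A := symHom_smul c (Matrix.of A) p

lemma sym_apply (x : SL2 ℝ) (p : PolyLE m) : sym m x p = symOrbit p (cplx (entries x)) := rfl

/-- Homogeneity of degree `m` pulls the normalising scalar out of `sym^m`. What remains is a
polynomial map times a power of the determinant, from which smoothness and derivatives can be read
off. -/
lemma sym_retr {A : M2 ℝ} (hA : A ∈ posDet) (p : PolyLE m) :
    sym m (retr A) p = ((Real.sqrt (Matrix.of A).det)⁻¹ ^ m : ℝ) • symOrbit p (cplx A) := by
  have h : entries (retr A) = (Real.sqrt (Matrix.of A).det)⁻¹ • A := by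
    rw [entries, retr_val hA]; rfl
  have h2 : ∀ (c : ℝ) (B : M2 ℂ), c • B = (c : ℂ) • B := fun c B => by
    ext i j; simp
  rw [sym_apply, h, map_smul, h2, symOrbit_smul]
  ext i
  simp

lemma contDiff_det : ContDiff ℝ ∞ fun A : M2 ℝ => (Matrix.of A).det := by
  simp only [Matrix.det_fin_two, Matrix.of_apply]
  fun_prop

/-- The smooth function `(x, y) ↦ sym^m(x) p` on `SL₂(𝔸)`. -/
def secFn : PolyLE m →ₗ[ℂ] SmoothFn (PolyLE m) where
  toFun p := ⟨fun g => sym m g.1 p, ⟨⊤, fun x y u _ => rfl⟩, fun y => by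
    have h1 : ContDiffOn ℝ ∞ (fun A : M2 ℝ =>
        ((Real.sqrt (Matrix.of A).det)⁻¹ ^ m : ℝ) • symOrbit p (cplx A)) posDet := by
      have e1 : ContDiffOn ℝ ∞ (fun A : M2 ℝ => Real.sqrt (Matrix.of A).det) posDet :=
        contDiff_det.contDiffOn.sqrt fun A hA => (mem_posDet.1 hA).ne'
      have e2 := (e1.inv fun A hA => (Real.sqrt_pos.2 (mem_posDet.1 hA)).ne').pow m
      exact e2.smul (((contDiff_symOrbit p).restrict_scalars ℝ).comp cplx.contDiff).contDiffOn
    exact h1.congr fun A hA => sym_retr hA p⟩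
  map_add' p q := SmoothFn.ext fun g => map_add (sym m g.1) p q
  map_smul' c p := SmoothFn.ext fun g => map_smul (sym m g.1) c p

lemma secFn_apply (p : PolyLE m) (g : GA) : (secFn p).1 g = sym m g.1 p := rfl

lemma secFn_injective : Function.Injective (secFn (m := m)) := by
  intro p q h
  have h1 := congrArg (fun F : SmoothFn (PolyLE m) => F.1 1) h
  simpa [secFn_apply] using h1

lemma rightShift_secFn (h : GA) (p : PolyLE m) :
    rightShift h (secFn p) = secFn (sym m h.1 p) := SmoothFn.ext fun g => by
  rw [rightShift_apply, secFn_apply, secFn_apply, Prod.fst_mul, map_mul]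
  rfl

/-- Vanishing trace removes the linear term of `det (1 + t X)`, so the normalisation in `retr` is
stationary at `t = 0` and contributes nothing to first derivatives. -/
lemma det_line (A X : Matrix (Fin 2) (Fin 2) ℝ) (hA : A.det = 1) (hX : X.trace = 0) (t : ℝ) :
    (A + t • (A * X)).det = 1 + t ^ 2 * X.det := by
  have h : A + t • (A * X) = A * (1 + t • X) := by
    rw [mul_add, mul_one, Matrix.mul_smul]
  rw [h, Matrix.det_mul, hA, one_mul]
  rw [Matrix.trace_fin_two] at hX
  simp [Matrix.det_fin_two]
  linear_combination t * hX

/-- Along the line `g + t g X` the extended function is a scalar factor with derivative zero times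
`sym^m(g (1 + t X)) p`. Only the second factor counts, and `symHom_dsymFun` moves its derivative
from `g` to the identity. -/
lemma lieReal_secFn (X : Matrix (Fin 2) (Fin 2) ℝ) (hX : X.trace = 0) (p : PolyLE m) :
    lieReal X (secFn p) = secFn (dsymFun (toC X) p) := by
  refine SmoothFn.ext fun g => ?_
  have hg := entries_mem_posDet g.1
  have h1 := (realExt_differentiableAt (secFn p) g.2 hg).hasFDerivAt
  let c : ℝ → M2 ℝ := fun t => entries g.1 + t • mulR X (entries g.1)
  have hc : HasDerivAt c (mulR X (entries g.1)) 0 := by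
    have e1 := ((hasDerivAt_id (0 : ℝ)).smul_const (mulR X (entries g.1))).const_add
      (entries g.1)
    rw [one_smul] at e1
    exact e1
  have hc0 : c 0 = entries g.1 := by simp [c]
  have hdet : ∀ t, (Matrix.of (c t)).det = 1 + t ^ 2 * X.det := fun t =>
    det_line g.1.1 X g.1.2 hX t
  have h2 := (hc0 ▸ h1).comp_hasDerivAt (0 : ℝ) hc
  have h3 : HasDerivAt (fun t => (Real.sqrt (Matrix.of (c t)).det)⁻¹ ^ m) 0 0 := by
    simp only [hdet]
    have e1 : HasDerivAt (fun t : ℝ => 1 + t ^ 2 * X.det) 0 0 := by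
      simpa using! ((hasDerivAt_pow 2 (0 : ℝ)).mul_const X.det).const_add 1
    have e2 := ((e1.sqrt (by simp)).inv (by simp)).pow m
    simpa using! e2
  have h4 : HasDerivAt (fun t => symOrbit p (cplx (c t)))
      (fderiv ℂ (symOrbit p) (cplx (entries g.1)) (cplx (mulR X (entries g.1)))) 0 := by
    have e1 := ((symOrbit_diff p (cplx (c 0))).hasFDerivAt.restrictScalars ℝ).comp_hasDerivAt
      (0 : ℝ) (cplx.hasFDerivAt.comp_hasDerivAt (0 : ℝ) hc)
    rw [hc0] at e1
    exact e1
  have h5 := h3.smul h4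
  have h6 : (fun t => realExt (secFn p).1 g.2 (c t)) =ᶠ[nhds 0]
      fun t => ((Real.sqrt (Matrix.of (c t)).det)⁻¹ ^ m : ℝ) • symOrbit p (cplx (c t)) := by
    have e1 : c ⁻¹' posDet ∈ nhds 0 := by
      refine hc.continuousAt.preimage_mem_nhds (isOpen_posDet.mem_nhds ?_)
      rw [hc0]; exact hg
    filter_upwards [e1] with t ht using sym_retr ht p
  -- Two computations of one derivative: by the chain rule for the extension, and by the product
  -- rule for the explicit formula.
  have h7 := h2.unique (h5.congr_of_eventuallyEq h6)
  have h8 : (lieReal X (secFn p)).1 g =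
    fderiv ℝ (realExt (secFn p).1 g.2) (entries g.1) (mulR X (entries g.1)) := rfl
  rw [h8]
  have hd1 : (Matrix.of (entries g.1)).det = 1 := g.1.2
  refine (hc0 ▸ h7).trans ?_
  have h9 : (secFn (dsymFun (toC X) p)).1 g = symHom m (toC g.1.1) (dsymFun (toC X) p) := rfl
  refine Eq.trans ?_ h9.symm
  rw [symHom_dsymFun, hd1, ← map_mul]
  simp only [Real.sqrt_one, inv_one, one_pow, one_smul, zero_smul, add_zero]
  rfl

lemma toC_reM_add_imM (X : Matrix (Fin 2) (Fin 2) ℂ) :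
    toC (reM X) + Complex.I • toC (imM X) = X := by
  ext i j
  simp [toC, reM, imM, mul_comm Complex.I, Complex.re_add_im]

lemma dsymFun_add (X Y : Matrix (Fin 2) (Fin 2) ℂ) (p : PolyLE m) :
    dsymFun (X + Y) p = dsymFun X p + dsymFun Y p :=
  (fderiv ℂ (symOrbit p) oneM).map_add (Matrix.of.symm X) (Matrix.of.symm Y)

lemma dsymFun_smul (c : ℂ) (X : Matrix (Fin 2) (Fin 2) ℂ) (p : PolyLE m) :
    dsymFun (c • X) p = c • dsymFun X p :=
  (fderiv ℂ (symOrbit p) oneM).map_smul c (Matrix.of.symm X)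

lemma lieAct_secFn (X : sl2) (p : PolyLE m) : lieAct X (secFn p) = secFn (dsym m X p) := by
  have hX : Matrix.trace X.1 = 0 := X.2
  rw [Matrix.trace_fin_two] at hX
  have h1 : (reM X.1).trace = 0 := by
    simpa [Matrix.trace_fin_two, reM] using congrArg Complex.re hX
  have h2 : (imM X.1).trace = 0 := by
    simpa [Matrix.trace_fin_two, imM] using congrArg Complex.im hX
  rw [lieAct_apply, lieReal_secFn _ h1, lieReal_secFn _ h2, ← map_smul, ← map_add,
    ← dsymFun_smul, ← dsymFun_add, toC_reM_add_imM]
  rfl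

/-- The space of the functions `secFn p`. -/
def secRange (m : ℕ) : Submodule ℂ (SmoothFn (PolyLE m)) := LinearMap.range secFn

instance : FiniteDimensional ℂ (secRange m) :=
  Module.Finite.range (secFn (m := m))

lemma secFn_mem (p : PolyLE m) : secFn p ∈ secRange m := ⟨p, rfl⟩

lemma secRange_isStable : IsStable (secRange m) where
  lie_mem := by
    rintro X _ ⟨p, rfl⟩
    rw [lieAct_secFn]; exact secFn_mem _
  inf_mem := by
    rintro k _ ⟨p, rfl⟩
    rw [rightShift_secFn]; exact secFn_mem _
  fin_mem := by
    rintro h _ ⟨p, rfl⟩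
    rw [rightShift_secFn]; exact secFn_mem _

/-! ### The action of the enveloping algebra -/

section General

variable {V : Type*} [NormedAddCommGroup V] [NormedSpace ℂ V]

lemma envAct_ι (X : sl2) (F : SmoothFn V) :
    envAct (UniversalEnvelopingAlgebra.ι ℂ X) F = lieAct X F := by
  rw [envAct, UniversalEnvelopingAlgebra.lift_ι_apply]

/-- Induction on elements of the universal enveloping algebra. -/
lemma envInduction {P : Ug → Prop} (hι : ∀ X, P (UniversalEnvelopingAlgebra.ι ℂ X))
    (hC : ∀ c, P (algebraMap ℂ Ug c)) (hadd : ∀ {a b}, P a → P b → P (a + b))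
    (hmul : ∀ {a b}, P a → P b → P (a * b)) (u : Ug) : P u := by
  let S : Subalgebra ℂ Ug :=
    { carrier := {u | P u}
      mul_mem' := hmul
      add_mem' := hadd
      algebraMap_mem' := hC }
  let φ : sl2 →ₗ⁅ℂ⁆ S :=
    { toFun X := ⟨UniversalEnvelopingAlgebra.ι ℂ X, hι X⟩
      map_add' X Y := Subtype.ext (map_add _ X Y)
      map_smul' c X := Subtype.ext (map_smul _ c X)
      map_lie' {X Y} := Subtype.ext (LieHom.map_lie _ X Y) }
  -- The lift of `ι` into `S`, followed by the inclusion, agrees with the identity on generators;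
  -- hence every element comes from `S`.
  have h : (S.val.comp (UniversalEnvelopingAlgebra.lift ℂ φ)) = AlgHom.id ℂ Ug := by
    apply UniversalEnvelopingAlgebra.hom_ext
    ext X
    simp [φ]
  have h2 := DFunLike.congr_fun h u
  rw [AlgHom.id_apply] at h2
  rw [← h2]
  exact (UniversalEnvelopingAlgebra.lift ℂ φ u).2

lemma envAct_mem {W : Submodule ℂ (SmoothFn V)} (hW : ∀ X, ∀ F ∈ W, lieAct X F ∈ W) (u : Ug) :
    ∀ F ∈ W, envAct u F ∈ W := by
  refine envInduction (P := fun u => ∀ F ∈ W, envAct u F ∈ W) ?_ ?_ ?_ ?_ u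
  · intro X F hF
    rw [envAct_ι]; exact hW X F hF
  · intro c F hF
    rw [AlgHom.commutes]
    exact W.smul_mem c hF
  · intro _ _ ha hb F hF
    rw [map_add]; exact W.add_mem (ha F hF) (hb F hF)
  · intro _ _ ha hb F hF
    rw [map_mul]; exact ha _ (hb F hF)

end General

/-! ### Moderate growth and automorphy of the functions `secFn p` -/

lemma one_le_finprod_normFin (y : SL2 Af) : 1 ≤ ∏ᶠ v, normFin v (localComponent v y) :=
  finprod_induction (fun r : ℝ => 1 ≤ r) le_rfl
    (fun _ _ ha hb => one_le_mul_of_one_le_of_one_le ha hb) fun v => one_le_normFin v _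

lemma normInf_le_adelicNorm (g : GA) : normInf g.1 ≤ adelicNorm g :=
  le_mul_of_one_le_right (zero_le_one.trans (one_le_normInf _)) (one_le_finprod_normFin _)

lemma norm_cplx_entries_le (x : SL2 ℝ) : ‖cplx (entries x)‖ ≤ normInf x := by
  have h0 : 0 ≤ normInf x := Real.sqrt_nonneg _
  refine (pi_norm_le_iff_of_nonneg h0).2 fun i => (pi_norm_le_iff_of_nonneg h0).2 fun j => ?_
  have h1 : ‖cplx (entries x) i j‖ = |x i j| := Complex.norm_real _
  rw [h1, normInf]
  refine Real.abs_le_sqrt ?_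
  refine (Finset.single_le_sum (f := fun j => x i j ^ 2) (fun _ _ => sq_nonneg _)
    (Finset.mem_univ j)).trans ?_
  exact Finset.single_le_sum (f := fun i => ∑ j, x i j ^ 2)
    (fun _ _ => Finset.sum_nonneg fun _ _ => sq_nonneg _) (Finset.mem_univ i)

/-- Compactness bounds the orbit map on the unit ball, and homogeneity of degree `m` scales the
bound. -/
lemma exists_norm_symOrbit_le (p : PolyLE m) : ∃ C, 0 ≤ C ∧ ∀ A, ‖symOrbit p A‖ ≤ C * ‖A‖ ^ m := by
  obtain ⟨C, hC⟩ := (isCompact_closedBall (0 : M2 ℂ) 1).exists_bound_of_continuousOn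
    (contDiff_symOrbit p).continuous.continuousOn
  have hC0 : 0 ≤ C := (norm_nonneg _).trans (hC 0 (by simp))
  refine ⟨C, hC0, fun A => ?_⟩
  -- Zero cannot be rescaled to the unit sphere; writing it as `0 • 0` covers `m = 0`, where `0 ^ m
  -- = 1`, along with the rest.
  by_cases hA : A = 0
  · subst hA
    have h1 : symOrbit p (0 : M2 ℂ) = (0 : ℂ) ^ m • symOrbit p 0 := by
      rw [← symOrbit_smul, smul_zero]
    rw [h1, norm_smul, norm_pow, norm_zero, norm_zero, mul_comm]
    exact mul_le_mul_of_nonneg_right (hC 0 (by simp)) (by positivity)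
  · have hn : (‖A‖ : ℂ) ≠ 0 := by simpa using hA
    have h1 : A = (‖A‖ : ℂ) • ((‖A‖ : ℂ)⁻¹ • A) := by rw [smul_smul, mul_inv_cancel₀ hn, one_smul]
    have h2 : ‖(‖A‖ : ℂ)⁻¹ • A‖ ≤ 1 := by
      rw [norm_smul, norm_inv, Complex.norm_real, norm_norm, inv_mul_cancel₀ (norm_ne_zero_iff.2 hA)]
    conv_lhs => rw [h1, symOrbit_smul, norm_smul, norm_pow, Complex.norm_real, norm_norm]
    rw [mul_comm]
    exact mul_le_mul_of_nonneg_right (hC _ (by simpa using h2)) (by positivity)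

lemma secFn_moderate (p : PolyLE m) : HasModerateGrowth (secFn p) := by
  obtain ⟨C, hC0, hC⟩ := exists_norm_symOrbit_le p
  refine ⟨C, m, fun g => ?_⟩
  rw [secFn_apply, sym_apply]
  refine (hC _).trans (mul_le_mul_of_nonneg_left ?_ hC0)
  exact pow_le_pow_left₀ (norm_nonneg _)
    ((norm_cplx_entries_le _).trans (normInf_le_adelicNorm g)) m

/-- Both finiteness conditions hold because the orbits stay in the finite-dimensional stable space
`secRange m`. -/
lemma secFn_mem_autForm (p : PolyLE m) : secFn p ∈ AutForm (symQ m) := by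
  refine ⟨fun γ g => ?_, ?_, ?_, secFn_moderate p⟩
  · rw [secFn_apply, secFn_apply, Prod.fst_mul, map_mul]
    rfl
  · refine Submodule.finiteDimensional_of_le (S₂ := secRange m) (Submodule.span_le.2 ?_)
    rintro _ ⟨k, rfl⟩
    show rightShift (k : GA) (secFn p) ∈ secRange m
    rw [rightShift_secFn]; exact secFn_mem _
  · refine Submodule.finiteDimensional_of_le (S₂ := secRange m) (Submodule.span_le.2 ?_)
    rintro _ ⟨z, rfl⟩
    exact envAct_mem secRange_isStable.lie_mem _ _ (secFn_mem p)

lemma secRange_isSubrep : IsSubrep (symQ m) (secRange m) where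
  toIsStable := secRange_isStable
  le_autForm := by
    rintro _ ⟨p, rfl⟩
    exact secFn_mem_autForm p

end Sections

/-! ### Irreducibility of `sym^m` -/

section Irreducible

variable {m : ℕ}

/-- The monomial `X ^ i`, as an element of `ℂ[X]_m` (zero for `m < i`). -/
def monom (m i : ℕ) : PolyLE m := fun j => if (j : ℕ) = i then 1 else 0

lemma sum_monom (p : PolyLE m) : ∑ i : Fin (m + 1), p i • monom m i = p := by
  ext j
  simp [monom, Finset.sum_apply, Fin.val_inj]

lemma homEval_monom {i : ℕ} (hi : i ≤ m) (u v : ℂ) :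
    homEval (monom m i) u v = u ^ i * v ^ (m - i) := by
  rw [homEval, Finset.sum_eq_single (⟨i, Nat.lt_succ_of_le hi⟩ : Fin (m + 1))]
  · simp [monom]
  · intro j _ hj
    have : (j : ℕ) ≠ i := fun h => hj (Fin.ext h)
    simp [monom, this]
  · simp

/-- The linear functional `p ↦ homEval p u v`. -/
def homEvalLin (u v : ℂ) : PolyLE m →ₗ[ℂ] ℂ where
  toFun p := homEval p u v
  map_add' p q := by simp [homEval, add_mul, Finset.sum_add_distrib]
  map_smul' c p := homEval_smul c p u v

/-- Differentiating the action of `1 + t X` exhibits `dsym` as a first order differential operator;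
the action of the standard triple on monomials is read off from it. -/
lemma homEval_dsymFun_monom (X : Matrix (Fin 2) (Fin 2) ℂ) {i : ℕ} (hi : i ≤ m) (x : ℂ) :
    homEval (dsymFun X (monom m i)) x 1 =
      i * x ^ (i - 1) * (X 1 1 * x - X 0 1) + x ^ i * ((m - i : ℕ) * (X 0 0 - X 1 0 * x)) := by
  have hc : HasDerivAt (fun t : ℂ => oneM + t • (Matrix.of.symm X : M2 ℂ)) (Matrix.of.symm X) 0 := by
    have e1 := ((hasDerivAt_id (0 : ℂ)).smul_const (Matrix.of.symm X : M2 ℂ)).const_add oneM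
    rw [one_smul] at e1
    exact e1
  have h0 : oneM + (0 : ℂ) • (Matrix.of.symm X : M2 ℂ) = oneM := by simp
  have h1 := (h0.symm ▸ (symOrbit_diff (monom m i) oneM).hasFDerivAt :
    HasFDerivAt (symOrbit (monom m i)) (fderiv ℂ (symOrbit (monom m i)) oneM)
      (oneM + (0 : ℂ) • (Matrix.of.symm X : M2 ℂ))).comp_hasDerivAt (0 : ℂ) hc
  have h2 := (LinearMap.toContinuousLinearMap (homEvalLin (m := m) x 1)).hasFDerivAt.comp_hasDerivAt
    (0 : ℂ) h1
  have h3 : HasDerivAt (fun t : ℂ => (x + t * (X 1 1 * x - X 0 1)) ^ i *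
      (1 + t * (X 0 0 - X 1 0 * x)) ^ (m - i)) (i * x ^ (i - 1) * (X 1 1 * x - X 0 1) +
        x ^ i * ((m - i : ℕ) * (X 0 0 - X 1 0 * x))) 0 := by
    have e1 : HasDerivAt (fun t : ℂ => x + t * (X 1 1 * x - X 0 1)) (X 1 1 * x - X 0 1) 0 := by
      simpa using! ((hasDerivAt_id (0 : ℂ)).mul_const (X 1 1 * x - X 0 1)).const_add x
    have e2 : HasDerivAt (fun t : ℂ => 1 + t * (X 0 0 - X 1 0 * x)) (X 0 0 - X 1 0 * x) 0 := by
      simpa using! ((hasDerivAt_id (0 : ℂ)).mul_const (X 0 0 - X 1 0 * x)).const_add 1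
    simpa using! (e1.pow i).mul (e2.pow (m - i))
  refine h2.unique (h3.congr_of_eventuallyEq (Filter.Eventually.of_forall fun t => ?_))
  show homEval (symEnd (Matrix.of (oneM + t • (Matrix.of.symm X : M2 ℂ))) (monom m i)) x 1 = _
  rw [homEval_symEnd, homEval_monom hi]
  simp only [oneM, Matrix.of_apply, Pi.add_apply, Pi.smul_apply, Matrix.of_symm_apply,
    smul_eq_mul, Matrix.one_apply_eq, ne_eq, zero_ne_one, one_ne_zero, not_false_eq_true,
    Matrix.one_apply_ne]
  congr 1 <;> ring

/-- The standard basis of `𝔰𝔩₂`. -/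
def stdH : sl2 := ⟨!![1, 0; 0, -1], by
  change Matrix.trace (!![1, 0; 0, -1] : Matrix (Fin 2) (Fin 2) ℂ) = 0
  simp [Matrix.trace_fin_two]⟩

/-- The raising operator of `𝔰𝔩₂`. -/
def stdE : sl2 := ⟨!![0, 1; 0, 0], by
  change Matrix.trace (!![0, 1; 0, 0] : Matrix (Fin 2) (Fin 2) ℂ) = 0
  simp [Matrix.trace_fin_two]⟩

/-- The lowering operator of `𝔰𝔩₂`. -/
def stdF : sl2 := ⟨!![0, 0; 1, 0], by
  change Matrix.trace (!![0, 0; 1, 0] : Matrix (Fin 2) (Fin 2) ℂ) = 0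
  simp [Matrix.trace_fin_two]⟩

lemma dsym_stdH {i : ℕ} (hi : i ≤ m) :
    dsym m stdH (monom m i) = ((m : ℂ) - 2 * i) • monom m i := by
  refine homEval_injective fun x => (homEval_dsymFun_monom _ hi x).trans ?_
  rw [homEval_smul, homEval_monom hi]
  -- The exponent `i - 1` is truncated, so `x ^ (i - 1) * x = x ^ i` needs `i > 0`; for `i = 0` the
  -- coefficient vanishes.
  rcases i with _ | i
  · simp [stdH]
  · simp only [stdH, Matrix.of_apply, Matrix.cons_val', Matrix.cons_val_one, Matrix.cons_val_zero,
      Matrix.cons_val_fin_one, Nat.cast_sub hi, Nat.add_sub_cancel, one_pow]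
    push_cast
    ring

lemma dsym_stdE {i : ℕ} (hi : i ≤ m) :
    dsym m stdE (monom m i) = (-(i : ℂ)) • monom m (i - 1) := by
  refine homEval_injective fun x => (homEval_dsymFun_monom _ hi x).trans ?_
  rw [homEval_smul, homEval_monom (by omega)]
  simp [stdE]

lemma dsym_stdF {i : ℕ} (hi : i < m) :
    dsym m stdF (monom m i) = (-((m - i : ℕ) : ℂ)) • monom m (i + 1) := by
  refine homEval_injective fun x => (homEval_dsymFun_monom _ hi.le x).trans ?_
  rw [homEval_smul, homEval_monom (by omega)]
  simp [stdF]
  ring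

lemma dsym_stdF_last : dsym m stdF (monom m m) = 0 := by
  refine homEval_injective fun x => (homEval_dsymFun_monom _ le_rfl x).trans ?_
  simp [stdF, homEval]

/-- Up to sign the raising operator is differentiation in `X`; applied often enough to a nonzero
polynomial it leaves a nonzero constant. -/
lemma monom_zero_mem {N : Submodule ℂ (PolyLE m)} (hN : ∀ p ∈ N, dsym m stdE p ∈ N) (n : ℕ)
    (hn : n ≤ m) (c : ℕ → ℂ) (hc : ∃ i ≤ n, c i ≠ 0)
    (hm : ∑ i ∈ Finset.range (n + 1), c i • monom m i ∈ N) : monom m 0 ∈ N := by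
  induction n generalizing c with
  | zero =>
    obtain ⟨i, hi, hci⟩ := hc
    obtain rfl : i = 0 := by omega
    simp only [zero_add, Finset.sum_range_one] at hm
    exact (N.smul_mem_iff hci).1 hm
  | succ n ih =>
    by_cases h : c (n + 1) = 0
    · refine ih (by omega) c ?_ ?_
      · obtain ⟨i, hi, hci⟩ := hc
        refine ⟨i, ?_, hci⟩
        by_contra hlt
        obtain rfl : i = n + 1 := by omega
        exact hci h
      · rwa [Finset.sum_range_succ, h, zero_smul, add_zero] at hm
    -- The new coefficients are those of minus the derivative, and the one in degree `n` is nonzero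
    -- because `c (n + 1)` is.
    · refine ih (by omega) (fun i => -((i + 1 : ℕ) : ℂ) * c (i + 1)) ⟨n, le_rfl, ?_⟩ ?_
      · exact mul_ne_zero (neg_ne_zero.2 (Nat.cast_ne_zero.2 n.succ_ne_zero)) h
      · have h1 := hN _ hm
        rw [map_sum, Finset.sum_range_succ', map_smul, dsym_stdE (Nat.zero_le m)] at h1
        simp only [Nat.cast_zero, neg_zero, zero_smul, smul_zero, add_zero] at h1
        convert h1 using 1
        refine Finset.sum_congr rfl fun i hi => ?_
        rw [Finset.mem_range] at hi
        rw [map_smul, dsym_stdE (by omega), smul_smul, mul_comm, Nat.add_sub_cancel]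

/-- The raising operator leads from any nonzero vector to the constants, and the lowering operator,
whose coefficients `-(m - i)` are nonzero for `i < m`, leads from there to every monomial. -/
lemma sym_irreducible (N : Submodule ℂ (PolyLE m)) (hN : ∀ X, ∀ p ∈ N, dsym m X p ∈ N) :
    N = ⊥ ∨ N = ⊤ := by
  refine or_iff_not_imp_left.2 fun hne => ?_
  obtain ⟨p, hp, hp0⟩ := N.exists_mem_ne_zero_of_ne_bot hne
  have h0 : monom m 0 ∈ N := by
    refine monom_zero_mem (hN stdE) m le_rfl
      (fun i => if h : i < m + 1 then p ⟨i, h⟩ else 0) ?_ ?_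
    · obtain ⟨i, hi⟩ := Function.ne_iff.1 hp0
      exact ⟨i, by omega, by rw [dif_pos i.2]; exact hi⟩
    · rw [Finset.sum_range]
      convert hp
      conv_rhs => rw [← sum_monom p]
      exact Finset.sum_congr rfl fun i _ => by rw [dif_pos i.2]
  have h1 : ∀ i ≤ m, monom m i ∈ N := by
    intro i
    induction i with
    | zero => exact fun _ => h0
    | succ i ih =>
      intro hi
      have h2 := hN stdF _ (ih (by omega))
      rw [dsym_stdF (by omega)] at h2
      refine (N.smul_mem_iff (neg_ne_zero.2 (Nat.cast_ne_zero.2 ?_))).1 h2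
      omega
  rw [eq_top_iff]
  intro q _
  rw [← sum_monom q]
  exact N.sum_mem fun i _ => N.smul_mem _ (h1 i (Nat.lt_succ_iff.1 i.2))

/-- The preimage under `secFn` of a stable space is a `𝔤`-submodule of `sym^m`; if it contains `p ≠
0`, irreducibility makes it everything. -/
lemma generated_secFn {p : PolyLE m} (hp : p ≠ 0) : generated (secFn p) = secRange m := by
  refine le_antisymm (sInf_le ⟨secRange_isStable, secFn_mem p⟩) (le_sInf ?_)
  rintro W ⟨hW, hpW⟩
  have h1 : W.comap secFn = ⊤ := by
    refine (sym_irreducible (W.comap secFn) fun X q hq => ?_).resolve_left fun h => hp ?_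
    · rw [Submodule.mem_comap, ← lieAct_secFn]
      exact hW.lie_mem X _ hq
    · have : p ∈ W.comap secFn := hpW
      rwa [h, Submodule.mem_bot] at this
  rintro _ ⟨q, rfl⟩
  have : q ∈ W.comap secFn := h1 ▸ trivial
  exact this

end Irreducible

/-! ### Strong approximation -/

section StrongApproximation

open HeightOneSpectrum WithZero

/-- A generator of a prime ideal of `ℤ` is a uniformizer there, and a unit elsewhere because
distinct maximal ideals do not contain one another. Such numbers are the building blocks for
prescribing valuations. -/
lemma exists_int_generator (v : HeightOneSpectrum ℤ) :
    ∃ a : ℤ, v.valuation ℚ (a : ℚ) = exp (-1 : ℤ) ∧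
      ∀ w : HeightOneSpectrum ℤ, w ≠ v → w.valuation ℚ (a : ℚ) = 1 := by
  obtain ⟨a, ha⟩ := (IsPrincipalIdealRing.principal v.asIdeal).principal
  have ha' : v.asIdeal = Ideal.span {a} := ha
  have ha0 : a ≠ 0 := by
    rintro rfl
    exact v.ne_bot (by rw [ha']; simp)
  have h1 : ∀ w : HeightOneSpectrum ℤ, w.valuation ℚ (a : ℚ) = w.intValuation a :=
    fun w => w.valuation_of_algebraMap a
  refine ⟨a, (h1 v).trans (v.intValuation_singleton ha0 ha'), fun w hw => (h1 w).trans ?_⟩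
  rw [intValuation_eq_one_iff]
  intro hmem
  have h2 : v.asIdeal ≤ w.asIdeal := by
    rw [ha', Ideal.span_singleton_le_iff_mem]; exact hmem
  exact hw (HeightOneSpectrum.ext (v.isMaximal.eq_of_le w.isPrime.ne_top h2).symm)

/-- There is a rational number with given valuations, almost all of which are trivial. -/
lemma exists_rat_valuation (n : HeightOneSpectrum ℤ → ℤ) (hn : ∀ᶠ v in Filter.cofinite, n v = 0) :
    ∃ q : ℚ, ∀ v : HeightOneSpectrum ℤ, v.valuation ℚ q = exp (n v) := by
  classical
  choose a ha ha' using exists_int_generator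
  let S := hn.toFinset
  -- The sign compensates for the valuation `exp (-1)` of the uniformizer.
  refine ⟨∏ v ∈ S, (a v : ℚ) ^ (-n v), fun w => ?_⟩
  have h1 : ∀ v, w.valuation ℚ ((a v : ℚ) ^ (-n v)) = if v = w then exp (n w) else 1 := by
    intro v
    rw [map_zpow₀]
    split_ifs with h
    · subst h
      rw [ha, ← exp_zsmul]
      simp
    · rw [ha' v w (Ne.symm h), one_zpow]
  rw [map_prod, Finset.prod_congr rfl fun v _ => h1 v, Finset.prod_ite_eq']
  split_ifs with h
  · rfl
  · have : n w = 0 := by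
      by_contra hne
      exact h (hn.mem_toFinset.2 hne)
    rw [this, exp_zero]

/-- Principal parts: an element of a completion is congruent modulo the local integers to a
rational number that is integral at all other places. -/
lemma exists_rat_principal_part (v : HeightOneSpectrum ℤ) (u : v.adicCompletion ℚ) :
    ∃ r : ℚ, u - algebraMap ℚ (v.adicCompletion ℚ) r ∈ v.adicCompletionIntegers ℚ ∧
      ∀ w : HeightOneSpectrum ℤ, w ≠ v → w.valuation ℚ r ≤ 1 := by
  classical
  have hopen : IsOpen ((fun y => u - y) ⁻¹' (v.adicCompletionIntegers ℚ : Set (v.adicCompletion ℚ))) :=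
    (Valued.isOpen_valuationSubring _).preimage (by fun_prop)
  -- Density of `ℚ` gives a rational number with the right principal part at `v`, but without
  -- control at other places.
  obtain ⟨s, hs⟩ := (denseRange_algebraMap (K := ℚ) v).exists_mem_open hopen ⟨u, by simp⟩
  have hs' : u - algebraMap ℚ (v.adicCompletion ℚ) s ∈ v.adicCompletionIntegers ℚ := hs
  by_cases hs0 : s = 0
  · refine ⟨0, ?_, fun w _ => by simp⟩
    rwa [hs0] at hs'
  have hvs : v.valuation ℚ s ≠ 0 := (Valuation.ne_zero_iff _).2 hs0
  -- Here `q` carries the pole of `s` at `v` and is a unit elsewhere. Approximating the `v`-integral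
  -- `s / q` by an integer `a` up to `|s|⁻¹` makes `s - a q` integral at `v`, while `a q` is
  -- integral at all other places.
  obtain ⟨q, hq⟩ := exists_rat_valuation (fun w => if w = v then log (v.valuation ℚ s) else 0) (by
    refine (Set.finite_singleton v).subset fun w hw => ?_
    by_contra hne
    exact hw (if_neg hne))
  have hqv : v.valuation ℚ q = v.valuation ℚ s := by rw [hq, if_pos rfl, exp_log hvs]
  have hq0 : q ≠ 0 := by
    rintro rfl
    rw [map_zero] at hqv
    exact hvs hqv.symm
  obtain ⟨a, ha⟩ := v.exists_valuation_sub_lt_of_integer (K := ℚ) (x := s / q)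
    (by rw [map_div₀, hqv, div_self hvs]) (Units.mk0 _ hvs)⁻¹
  refine ⟨a * q, ?_, fun w hw => ?_⟩
  · have h1 : v.valuation ℚ (s - a * q) ≤ 1 := by
      have h2 : s - a * q = -((algebraMap ℤ ℚ a - s / q) * q) := by
        field_simp
        simp [mul_comm]
      rw [h2, Valuation.map_neg, map_mul, hqv]
      calc _ ≤ (v.valuation ℚ s)⁻¹ * v.valuation ℚ s := by
            refine mul_le_mul_left ?_ _
            simpa using ha.le
        _ = 1 := inv_mul_cancel₀ hvs
    have h3 : algebraMap ℚ (v.adicCompletion ℚ) (s - a * q) ∈ v.adicCompletionIntegers ℚ := by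
      rw [mem_adicCompletionIntegers]
      exact (valuedAdicCompletion_eq_valuation' v _).trans_le h1
    have h4 := add_mem hs' h3
    rwa [map_sub, sub_add_sub_cancel] at h4
  · rw [map_mul, hq, if_neg hw, exp_zero, mul_one]
    exact w.valuation_le_one a

/-- The decomposition `𝔸_f = ℚ + ∏_v ℤ_v`. -/
lemma exists_rat_sub_integral (u : Af) :
    ∃ r : ℚ, ∀ v, (u - algebraMap ℚ Af r) v ∈ v.adicCompletionIntegers ℚ := by
  classical
  have hu : ∀ᶠ v in Filter.cofinite, u v ∈ v.adicCompletionIntegers ℚ := u.2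
  choose r hr hr' using fun v => exists_rat_principal_part v (u v)
  let S := hu.toFinset
  refine ⟨∑ v ∈ S, r v, fun w => ?_⟩
  have hint : ∀ x : ℚ, w.valuation ℚ x ≤ 1 →
      algebraMap ℚ (w.adicCompletion ℚ) x ∈ w.adicCompletionIntegers ℚ := fun x hx => by
    rw [mem_adicCompletionIntegers]
    exact (valuedAdicCompletion_eq_valuation' w x).trans_le hx
  have h0 : (u - algebraMap ℚ Af (∑ v ∈ S, r v)) w =
      u w - algebraMap ℚ (w.adicCompletion ℚ) (∑ v ∈ S, r v) := rfl
  rw [h0, map_sum]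
  by_cases hw : w ∈ S
  -- At `w` the summand `r w` cancels the pole of `u`, and all other summands are integral there.
  · rw [← Finset.add_sum_erase _ _ hw, ← sub_sub]
    exact sub_mem (hr w) (sum_mem fun v hv => hint _ (hr' v w (Finset.ne_of_mem_erase hv).symm))
  · refine sub_mem ?_ (sum_mem fun v hv => hint _ (hr' v w ?_))
    · by_contra hne
      exact hw (hu.mem_toFinset.2 hne)
    · rintro rfl
      exact hw hv

lemma mem_Kfin_iff (v : HeightOneSpectrum ℤ) (g : SL2 (v.adicCompletion ℚ)) :
    g ∈ Kfin v ↔ ∀ i j, g i j ∈ v.adicCompletionIntegers ℚ := by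
  constructor
  · rintro ⟨k, rfl⟩ i j
    exact (k i j).2
  · intro h
    let A : Matrix (Fin 2) (Fin 2) (v.adicCompletionIntegers ℚ) := fun i j => ⟨_, h i j⟩
    have hA : (algebraMap (v.adicCompletionIntegers ℚ) (v.adicCompletion ℚ)).mapMatrix A = g.1 := by
      ext i j; rfl
    have hA1 : A.det = 1 := by
      have hdet := g.2
      rw [← hA, ← RingHom.map_det] at hdet
      exact Subtype.val_injective hdet
    exact ⟨⟨A, hA1⟩, Subtype.ext hA⟩

lemma mem_Kf_iff (g : SL2 Af) : g ∈ Kf ↔ ∀ v i j, (g i j) v ∈ v.adicCompletionIntegers ℚ := by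
  rw [Kf, Subgroup.mem_iInf]
  exact forall_congr' fun v => mem_Kfin_iff v _

/-- Upper triangular unipotent matrices. -/
def unip {R : Type*} [CommRing R] (u : R) : SL2 R := ⟨!![1, u; 0, 1], by simp⟩

/-- Diagonal matrices. -/
def diagQ (q : ℚˣ) : SL2 ℚ := ⟨!![((q⁻¹ : ℚˣ) : ℚ), 0; 0, (q : ℚ)], by simp⟩

/-- A primitive vector is the lower row of an element of `K_f`. -/
lemma exists_mem_Kf_row (c d : Af) (h : ∀ v, max (Valued.v (c v)) (Valued.v (d v)) = 1) :
    ∃ k ∈ Kf, k 1 0 = c ∧ k 1 1 = d := by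
  classical
  have hc : ∀ v, c v ∈ v.adicCompletionIntegers ℚ := fun v => by
    rw [mem_adicCompletionIntegers]; exact (le_max_left _ _).trans (h v).le
  have hd : ∀ v, d v ∈ v.adicCompletionIntegers ℚ := fun v => by
    rw [mem_adicCompletionIntegers]; exact (le_max_right _ _).trans (h v).le
  have key : ∀ v : HeightOneSpectrum ℤ, ∃ a b : v.adicCompletion ℚ,
      a ∈ v.adicCompletionIntegers ℚ ∧ b ∈ v.adicCompletionIntegers ℚ ∧
        a * d v - b * c v = 1 := by
    intro v
    have hunit : ∀ x : v.adicCompletion ℚ, Valued.v x = 1 →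
        x⁻¹ ∈ v.adicCompletionIntegers ℚ ∧ x⁻¹ * x = 1 := fun x hx => by
      refine ⟨?_, inv_mul_cancel₀ fun h0 => ?_⟩
      · rw [mem_adicCompletionIntegers, map_inv₀, hx, inv_one]
      · rw [h0, map_zero] at hx
        exact zero_ne_one hx
    -- One of the two entries is a local unit; its inverse, placed in the opposite corner, completes
    -- the row to determinant one.
    rcases max_choice (Valued.v (c v)) (Valued.v (d v)) with h1 | h1
    · obtain ⟨h2, h3⟩ := hunit (c v) (h1.symm.trans (h v))
      exact ⟨0, -(c v)⁻¹, zero_mem _, neg_mem h2, by rw [neg_mul, h3]; ring⟩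
    · obtain ⟨h2, h3⟩ := hunit (d v) (h1.symm.trans (h v))
      exact ⟨(d v)⁻¹, 0, h2, zero_mem _, by rw [h3]; ring⟩
  choose a b ha hb hab using key
  let a' : Af := ⟨a, Filter.Eventually.of_forall ha⟩
  let b' : Af := ⟨b, Filter.Eventually.of_forall hb⟩
  have hdet : a' * d - b' * c = 1 := FiniteAdeleRing.ext _ hab
  let k : SL2 Af := ⟨!![a', b'; c, d], by rw [Matrix.det_fin_two_of, hdet]⟩
  refine ⟨k, (mem_Kf_iff k).2 fun v i j => ?_, rfl, rfl⟩
  fin_cases i <;> fin_cases j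
  exacts [ha v, hb v, hc v, hd v]

lemma det_eq_one {R : Type*} [CommRing R] (g : SL2 R) : g 0 0 * g 1 1 - g 0 1 * g 1 0 = 1 := by
  have := g.2
  rwa [Matrix.det_fin_two] at this

/-- The lower row of an element of `SL₂(𝔸_f)` is a rational multiple of a primitive vector. -/
lemma exists_rat_row_norm (g : SL2 Af) :
    ∃ q : ℚˣ, ∀ v : HeightOneSpectrum ℤ,
      max (Valued.v ((g 1 0) v)) (Valued.v ((g 1 1) v)) = v.valuation ℚ (q : ℚ) := by
  have hdet : ∀ v, (g 0 0) v * (g 1 1) v - (g 0 1) v * (g 1 0) v = 1 := fun v =>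
    congrArg (adeleEval v) (det_eq_one g)
  have h0 : ∀ v, max (Valued.v ((g 1 0) v)) (Valued.v ((g 1 1) v)) ≠ 0 := by
    intro v h
    have h1 : (g 1 0) v = 0 := (Valuation.zero_iff _).1 (le_zero_iff.1 ((le_max_left _ _).trans h.le))
    have h2 : (g 1 1) v = 0 := (Valuation.zero_iff _).1 (le_zero_iff.1 ((le_max_right _ _).trans h.le))
    have h3 := hdet v
    rw [h1, h2] at h3
    simp at h3
  have h1 : ∀ᶠ v in Filter.cofinite, max (Valued.v ((g 1 0) v)) (Valued.v ((g 1 1) v)) = 1 := by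
    filter_upwards [eventually_mem_Kfin g] with v hv
    rw [mem_Kfin_iff] at hv
    have hv' : ∀ i j, Valued.v ((g i j) v) ≤ 1 := fun i j =>
      (mem_adicCompletionIntegers ..).1 (hv i j)
    refine le_antisymm (max_le (hv' 1 0) (hv' 1 1)) ?_
    -- If both entries of the lower row were non-units, the determinant would have valuation less
    -- than one.
    by_contra hlt
    rw [not_le, max_lt_iff] at hlt
    have h5 : Valued.v ((g 0 0) v * (g 1 1) v - (g 0 1) v * (g 1 0) v) < 1 := by
      refine Valuation.map_sub_lt _ ?_ ?_
      · rw [map_mul, mul_comm]; exact mul_lt_one_of_lt_of_le hlt.2 (hv' 0 0)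
      · rw [map_mul, mul_comm]; exact mul_lt_one_of_lt_of_le hlt.1 (hv' 0 1)
    rw [hdet, map_one] at h5
    exact lt_irrefl _ h5
  obtain ⟨q, hq⟩ := exists_rat_valuation
    (fun v => log (max (Valued.v ((g 1 0) v)) (Valued.v ((g 1 1) v)))) (by
      filter_upwards [h1] with v hv
      rw [hv, log_one])
  have hq' : ∀ v, max (Valued.v ((g 1 0) v)) (Valued.v ((g 1 1) v)) = v.valuation ℚ q := fun v => by
    rw [hq, exp_log (h0 v)]
  have hq0 : q ≠ 0 := by
    rintro rfl
    -- A single place, here the prime 2, suffices to see that `q` is nonzero.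
    obtain ⟨v⟩ : Nonempty (HeightOneSpectrum ℤ) :=
      ⟨Rat.HeightOneSpectrum.primesEquiv.symm ⟨2, Nat.prime_two⟩⟩
    exact h0 v ((hq' v).trans (map_zero _))
  exact ⟨Units.mk0 q hq0, hq'⟩

/-- Strong approximation for `SL₂` over `ℚ`. -/
lemma strong_approximation_fin (g : SL2 Af) :
    ∃ γ : SL2 ℚ, (Matrix.SpecialLinearGroup.map (algebraMap ℚ Af) γ)⁻¹ * g ∈ Kf := by
  obtain ⟨q, hq⟩ := exists_rat_row_norm g
  have hval : ∀ (v : HeightOneSpectrum ℤ) (x : Af),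
      Valued.v ((algebraMap ℚ Af ((q⁻¹ : ℚˣ) : ℚ) * x) v) =
        (v.valuation ℚ (q : ℚ))⁻¹ * Valued.v (x v) := fun v x => by
    have h1 : (algebraMap ℚ Af ((q⁻¹ : ℚˣ) : ℚ) * x) v =
      algebraMap ℚ (v.adicCompletion ℚ) ((q⁻¹ : ℚˣ) : ℚ) * x v := rfl
    have h2 : Valued.v (algebraMap ℚ (v.adicCompletion ℚ) ((q⁻¹ : ℚˣ) : ℚ)) =
      v.valuation ℚ ((q⁻¹ : ℚˣ) : ℚ) := valuedAdicCompletion_eq_valuation' v _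
    rw [h1, map_mul, h2, Units.val_inv_eq_inv_val, map_inv₀]
  obtain ⟨k, hk, hkc, hkd⟩ := exists_mem_Kf_row (algebraMap ℚ Af ((q⁻¹ : ℚˣ) : ℚ) * g 1 0)
    (algebraMap ℚ Af ((q⁻¹ : ℚˣ) : ℚ) * g 1 1) (fun v => by
      have h0 : v.valuation ℚ (q : ℚ) ≠ 0 := (Valuation.ne_zero_iff _).2 q.ne_zero
      rw [hval, hval, ← inv_mul_cancel₀ h0, ← hq, mul_max])
  let ι := Matrix.SpecialLinearGroup.map (n := Fin 2) (algebraMap ℚ Af)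
  -- Dividing the lower row of `g` by `q` makes it primitive, hence the lower row of some `k ∈ K_f`.
  -- So `h` has lower row `(0, 1)` and is unipotent; its remaining entry is rational modulo integral
  -- adeles, and a rational unipotent matrix removes the rational part.
  let h : SL2 Af := (ι (diagQ q))⁻¹ * g * k⁻¹
  have hι : ∀ i, ((ι (diagQ q))⁻¹ * g) 1 i = algebraMap ℚ Af ((q⁻¹ : ℚˣ) : ℚ) * g 1 i := by
    intro i
    have h1 : (diagQ q)⁻¹ = diagQ q⁻¹ := by
      rw [inv_eq_iff_mul_eq_one]
      apply Matrix.SpecialLinearGroup.ext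
      intro i j
      rw [Matrix.SpecialLinearGroup.coe_mul, Matrix.mul_apply, Fin.sum_univ_two]
      fin_cases i <;> fin_cases j <;> simp [diagQ]
    have h2 : (ι (diagQ q⁻¹)) 1 0 = 0 := map_zero (algebraMap ℚ Af)
    have h3 : (ι (diagQ q⁻¹)) 1 1 = algebraMap ℚ Af ((q⁻¹ : ℚˣ) : ℚ) := rfl
    rw [← map_inv, h1, Matrix.SpecialLinearGroup.coe_mul, Matrix.mul_apply, Fin.sum_univ_two,
      h2, h3, zero_mul, zero_add]
  have hrow : ∀ i, ((ι (diagQ q))⁻¹ * g) 1 i = k 1 i := by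
    intro i
    fin_cases i
    · exact (hι 0).trans hkc.symm
    · exact (hι 1).trans hkd.symm
  have hk1 := det_eq_one k
  have h10 : h 1 0 = 0 := by
    simp only [h]
    rw [Matrix.SpecialLinearGroup.coe_mul, Matrix.mul_apply, Fin.sum_univ_two, hrow, hrow,
      Matrix.SpecialLinearGroup.SL2_inv_expl]
    simp
    ring
  have h11 : h 1 1 = 1 := by
    simp only [h]
    rw [Matrix.SpecialLinearGroup.coe_mul, Matrix.mul_apply, Fin.sum_univ_two, hrow, hrow,
      Matrix.SpecialLinearGroup.SL2_inv_expl]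
    simp
    linear_combination hk1
  have h00 : h 0 0 = 1 := by
    have := det_eq_one h
    rw [h10, h11] at this
    simpa using this
  obtain ⟨r, hr⟩ := exists_rat_sub_integral (h 0 1)
  refine ⟨diagQ q * unip r, ?_⟩
  have e1 : (ι (diagQ q * unip r))⁻¹ * g = (ι (unip r))⁻¹ * h * k := by
    simp only [h, map_mul]; group
  show (ι (diagQ q * unip r))⁻¹ * g ∈ Kf
  rw [e1]
  refine Kf.mul_mem ?_ hk
  clear e1
  clear_value h
  have e2 : (ι (unip r))⁻¹ * h = unip (h 0 1 - algebraMap ℚ Af r) := by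
    rw [inv_mul_eq_iff_eq_mul]
    apply Matrix.SpecialLinearGroup.ext
    intro i j
    have h1 : ∀ i j, (ι (unip r)) i j = algebraMap ℚ Af ((unip r : SL2 ℚ) i j) := fun _ _ => rfl
    rw [Matrix.SpecialLinearGroup.coe_mul, Matrix.mul_apply, Fin.sum_univ_two, h1, h1]
    fin_cases i <;> fin_cases j <;> simp [unip, h10, h11, h00]
  rw [e2, mem_Kf_iff]
  intro v i j
  fin_cases i <;> fin_cases j
  exacts [one_mem (v.adicCompletionIntegers ℚ), hr v, zero_mem (v.adicCompletionIntegers ℚ),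
    one_mem (v.adicCompletionIntegers ℚ)]

lemma strong_approximation (g : GA) :
    ∃ (γ : SL2 ℚ) (x : SL2 ℝ), ∃ k ∈ Kf, g = diag γ * (x, k) := by
  obtain ⟨γ, hγ⟩ := strong_approximation_fin g.2
  refine ⟨γ, (diag γ).1⁻¹ * g.1, _, hγ, Prod.ext ?_ ?_⟩
  · rw [Prod.fst_mul, mul_inv_cancel_left]
  · exact (mul_inv_cancel_left _ _).symm

end StrongApproximation

/-! ### The lifts `𝔢̃_{j,m-j}` as functions `secFn p` -/

section ModularLift

variable {m : ℕ}

lemma homEval_eFun_one {j : ℕ} (hj : j ≤ m) (τ : UpperHalfPlane) (x : ℂ) :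
    homEval (eFun m j τ) x 1 =
      ((-1) ^ (m - j) / (j.factorial : ℂ) * ((τ.im : ℝ) : ℂ) ^ ((j : ℤ) - (m : ℤ))) *
        ((x - τ) ^ j * (x - starRingEnd ℂ τ) ^ (m - j)) := by
  have hdeg : ((Polynomial.X - Polynomial.C (τ : ℂ)) ^ j *
      (Polynomial.X - Polynomial.C (starRingEnd ℂ (τ : ℂ))) ^ (m - j)).natDegree < m + 1 := by
    refine Nat.lt_succ_of_le (Polynomial.natDegree_mul_le.trans ?_)
    have h3 := Polynomial.natDegree_pow_le_of_le j
      (Polynomial.natDegree_X_sub_C_le (τ : ℂ))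
    have h4 := Polynomial.natDegree_pow_le_of_le (m - j)
      (Polynomial.natDegree_X_sub_C_le (starRingEnd ℂ (τ : ℂ)))
    omega
  have h1 := Polynomial.eval_eq_sum_range' hdeg x
  rw [Finset.sum_range] at h1
  simp only [Polynomial.eval_mul, Polynomial.eval_pow, Polynomial.eval_sub, Polynomial.eval_X,
    Polynomial.eval_C] at h1
  rw [h1, homEval, Finset.mul_sum]
  refine Finset.sum_congr rfl fun i _ => ?_
  rw [one_pow, mul_one, eFun, mul_assoc]

/-- Homogeneity gives the formula for `w ≠ 0` and continuity extends it to `w = 0`. The two-variable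
form is what a change of variables by a matrix requires. -/
lemma homEval_eFun {j : ℕ} (hj : j ≤ m) (τ : UpperHalfPlane) (u w : ℂ) :
    homEval (eFun m j τ) u w =
      ((-1) ^ (m - j) / (j.factorial : ℂ) * ((τ.im : ℝ) : ℂ) ^ ((j : ℤ) - (m : ℤ))) *
        ((u - τ * w) ^ j * (u - starRingEnd ℂ τ * w) ^ (m - j)) := by
  have key : ∀ w ∈ ({0}ᶜ : Set ℂ), homEval (eFun m j τ) u w =
      ((-1) ^ (m - j) / (j.factorial : ℂ) * ((τ.im : ℝ) : ℂ) ^ ((j : ℤ) - (m : ℤ))) *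
        ((u - τ * w) ^ j * (u - starRingEnd ℂ τ * w) ^ (m - j)) := by
    intro w hw
    have hw : w ≠ 0 := hw
    have h1 := homEval_mul (eFun m j τ) w (u / w) 1
    rw [homEval_eFun_one hj, mul_div_cancel₀ _ hw, mul_one] at h1
    have hm : w ^ m = w ^ j * w ^ (m - j) := by rw [← pow_add, Nat.add_sub_cancel' hj]
    rw [h1, hm]
    have e1 : u - τ * w = w * (u / w - τ) := by field_simp
    have e2 : u - starRingEnd ℂ τ * w = w * (u / w - starRingEnd ℂ τ) := by field_simp
    rw [e1, e2, mul_pow, mul_pow]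
    ring
  have hc1 : Continuous fun w => homEval (eFun m j τ) u w := by unfold homEval; fun_prop
  exact congrFun (Continuous.ext_on (dense_compl_singleton (0 : ℂ)) hc1 (by fun_prop) key) w

/-- The functions `𝔢_{j,m-j}` are modular of weight `m - 2 j` and type `sym^m` under `SL₂(ℝ)`. -/
lemma slash_eFun {j : ℕ} (hj : j ≤ m) (x : SL2 ℝ) :
    slash ((m : ℤ) - 2 * (j : ℤ)) (eFun m j) x UpperHalfPlane.I =
      sym m x (eFun m j UpperHalfPlane.I) := by
  refine homEval_injective fun z => ?_
  have hR : homEval (sym m x (eFun m j UpperHalfPlane.I)) z 1 =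
    homEval (symEnd (toC x.1) (eFun m j UpperHalfPlane.I)) z 1 := rfl
  rw [slash, homEval_smul, hR, homEval_symEnd, homEval_eFun hj, homEval_eFun hj]
  simp only [UpperHalfPlane.coe_I, Complex.conj_I]
  have hdet := det_eq_one x
  have hw : ((x 1 0 : ℝ) : ℂ) * Complex.I + ((x 1 1 : ℝ) : ℂ) ≠ 0 := by
    intro h
    have h1 := congrArg Complex.re h
    have h2 := congrArg Complex.im h
    simp at h1 h2
    rw [h1, h2] at hdet
    simp at hdet
  have hw' : -((x 1 0 : ℝ) : ℂ) * Complex.I + ((x 1 1 : ℝ) : ℂ) ≠ 0 := by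
    intro h
    have h1 := congrArg Complex.re h
    have h2 := congrArg Complex.im h
    simp at h1 h2
    rw [h1, h2] at hdet
    simp at hdet
  have hτ := UpperHalfPlane.coe_specialLinearGroup_apply x UpperHalfPlane.I
  simp only [Algebra.algebraMap_self, RingHom.id_apply, UpperHalfPlane.coe_I] at hτ
  have hτ' : starRingEnd ℂ ((x • UpperHalfPlane.I : UpperHalfPlane) : ℂ) =
      (-((x 0 0 : ℝ) : ℂ) * Complex.I + ((x 0 1 : ℝ) : ℂ)) /
        (-((x 1 0 : ℝ) : ℂ) * Complex.I + ((x 1 1 : ℝ) : ℂ)) := by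
    rw [hτ]
    simp
  have hdetC : ((x 0 0 : ℝ) : ℂ) * ((x 1 1 : ℝ) : ℂ) - ((x 0 1 : ℝ) : ℂ) * ((x 1 0 : ℝ) : ℂ) = 1 := by
    exact_mod_cast hdet
  have him : (((x • UpperHalfPlane.I : UpperHalfPlane).im : ℝ) : ℂ) =
      ((((x 1 0 : ℝ) : ℂ) * Complex.I + ((x 1 1 : ℝ) : ℂ)) *
        (-((x 1 0 : ℝ) : ℂ) * Complex.I + ((x 1 1 : ℝ) : ℂ)))⁻¹ := by
    have h1 := Complex.sub_conj ((x • UpperHalfPlane.I : UpperHalfPlane) : ℂ)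
    have h2 : (((x • UpperHalfPlane.I : UpperHalfPlane).im : ℝ) : ℂ) * (2 * Complex.I) =
        ((x • UpperHalfPlane.I : UpperHalfPlane) : ℂ) -
          starRingEnd ℂ ((x • UpperHalfPlane.I : UpperHalfPlane) : ℂ) := by
      rw [h1, UpperHalfPlane.coe_im]; push_cast; ring
    rw [hτ', hτ, div_sub_div _ _ hw hw'] at h2
    have h3 : (2 * Complex.I) ≠ 0 := mul_ne_zero two_ne_zero Complex.I_ne_zero
    rw [← mul_left_inj' h3, h2, div_eq_mul_inv, mul_comm (_⁻¹)]
    congr 1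
    linear_combination (2 * Complex.I) * hdetC
  have ht : ∀ i j, toC x.1 i j = ((x i j : ℝ) : ℂ) := fun _ _ => rfl
  set w : ℂ := ((x 1 0 : ℝ) : ℂ) * Complex.I + ((x 1 1 : ℝ) : ℂ) with hwdef
  set w' : ℂ := -((x 1 0 : ℝ) : ℂ) * Complex.I + ((x 1 1 : ℝ) : ℂ) with hwdef'
  -- With `τ = x i`, the linear forms vanishing at `i` and `-i` become `w (z - τ)` and `w' (z -
  -- τ̄)`, where `w = c i + d` and `w'` is its conjugate.
  have e1 : toC x.1 1 1 * z - toC x.1 0 1 * 1 - Complex.I *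
      (toC x.1 0 0 * 1 - toC x.1 1 0 * z) =
        w * (z - ((x • UpperHalfPlane.I : UpperHalfPlane) : ℂ) * 1) := by
    have e0 : w * ((x • UpperHalfPlane.I : UpperHalfPlane) : ℂ) = _ :=
      (congrArg (w * ·) hτ).trans (mul_div_cancel₀ _ hw)
    simp only [ht]
    linear_combination e0 - z * hwdef
  have e2 : toC x.1 1 1 * z - toC x.1 0 1 * 1 - -Complex.I *
      (toC x.1 0 0 * 1 - toC x.1 1 0 * z) =
        w' * (z - starRingEnd ℂ ((x • UpperHalfPlane.I : UpperHalfPlane) : ℂ) * 1) := by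
    have e0 : w' * starRingEnd ℂ ((x • UpperHalfPlane.I : UpperHalfPlane) : ℂ) = _ :=
      (congrArg (w' * ·) hτ').trans (mul_div_cancel₀ _ hw')
    simp only [ht]
    linear_combination e0 - z * hwdef'
  rw [e1, e2, him, mul_pow, mul_pow]
  have hI1 : (((UpperHalfPlane.I).im : ℝ) : ℂ) = 1 := by simp
  -- The weight `m - 2 j` is exactly right: since `Im τ = (w w')⁻¹`, the automorphy factor and the
  -- power of `y` combine to the factors produced by the linear forms.
  have hpow : w ^ (-((m : ℤ) - 2 * (j : ℤ))) * ((w * w')⁻¹) ^ ((j : ℤ) - (m : ℤ)) =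
      w ^ j * w' ^ (m - j) := by
    rw [inv_zpow', mul_zpow, ← mul_assoc, ← zpow_add₀ hw, ← zpow_natCast, ← zpow_natCast,
      Nat.cast_sub hj]
    congr 2 <;> ring
  rw [hI1, one_zpow]
  linear_combination ((-1) ^ (m - j) / (j.factorial : ℂ) *
    ((z - ((x • UpperHalfPlane.I : UpperHalfPlane) : ℂ)) ^ j *
      (z - starRingEnd ℂ ((x • UpperHalfPlane.I : UpperHalfPlane) : ℂ)) ^ (m - j))) * hpow

/-- If `g = γ x k`, then `sym^m(γ)` and the factor `sym^m(x)` from `slash_eFun` combine to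
`sym^m(g_∞)`. This does not involve the decomposition, so the choice made in `adelicLift` is
immaterial. -/
lemma eTilde_eq {j : ℕ} (hj : j ≤ m) :
    eTilde m j = (secFn (eFun m j UpperHalfPlane.I)).1 := by
  funext g
  have h : ∃ t : SL2 ℚ × SL2 ℝ × Kf, g = diag t.1 * (t.2.1, (t.2.2 : SL2 Af)) := by
    obtain ⟨γ, x, k, hk, hg⟩ := strong_approximation g
    exact ⟨(γ, x, ⟨k, hk⟩), hg⟩
  rw [eTilde, adelicLift, dif_pos h, slash_eFun hj, secFn_apply]
  conv_rhs => rw [h.choose_spec, Prod.fst_mul, map_mul]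
  rfl

lemma eFun_I_ne_zero {j : ℕ} (hj : j ≤ m) : eFun m j UpperHalfPlane.I ≠ 0 := by
  intro h
  -- The point `(1, 0)` picks out the leading coefficient `(-1)^(m-j) / j!`.
  have h1 := homEval_eFun hj UpperHalfPlane.I 1 0
  rw [h] at h1
  have hf : (j.factorial : ℂ) ≠ 0 := Nat.cast_ne_zero.2 j.factorial_ne_zero
  simp [homEval] at h1
  exact div_ne_zero (pow_ne_zero _ (neg_ne_zero.2 one_ne_zero)) hf h1.symm

end ModularLift

/-! ### The restricted tensor product of trivial representations -/

section TrivialTensor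

open scoped Classical in
-- Changing one entry does not affect whether almost all entries are `1`, and otherwise enters as a
-- factor. Linearity in each variable, hence multilinearity of `cofiniteProd`, follows at once.
lemma finprod_update_smul {ι : Type*} (w : ι → ℂ) (i : ι) (x : ℂ) :
    (if (Function.mulSupport (Function.update w i x)).Finite then
        ∏ᶠ j, Function.update w i x j else 0) =
    x * (if (Function.mulSupport w).Finite then ∏ᶠ j, Function.update w i 1 j else 0) := by
  have hsub : ∀ (w : ι → ℂ) (x : ℂ), Function.mulSupport (Function.update w i x) ⊆
      Function.mulSupport w ∪ {i} := fun w x j hj => by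
    by_cases hji : j = i
    · exact Or.inr hji
    · refine Or.inl ?_
      rwa [Function.mem_mulSupport, Function.update_of_ne hji] at hj
  have hiff : (Function.mulSupport (Function.update w i x)).Finite ↔
      (Function.mulSupport w).Finite := by
    refine ⟨fun h => ?_, fun h => (h.union (Set.finite_singleton i)).subset (hsub w x)⟩
    refine (h.union (Set.finite_singleton i)).subset ?_
    simpa using hsub (Function.update w i x) (w i)
  simp only [hiff]
  split_ifs with h
  · have h1 : (Function.mulSupport (Function.update w i 1)).Finite :=
      (h.union (Set.finite_singleton i)).subset (hsub w 1)
    have h2 : (Function.mulSupport (Function.update (1 : ι → ℂ) i x)).Finite :=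
      (Set.finite_singleton i).subset (by simpa using hsub 1 x)
    have h3 : ∏ᶠ j, Function.update (1 : ι → ℂ) i x j = x := by
      rw [finprod_eq_single _ i fun j hj => by rw [Function.update_of_ne hj]; rfl,
        Function.update_self]
    conv_rhs => rw [← h3, ← finprod_mul_distrib h2 h1]
    refine finprod_congr fun j => ?_
    by_cases hj : j = i
    · subst hj; simp
    · simp [Function.update_of_ne hj]
  · simp

open scoped Classical in
/-- The product of a family almost all of whose members are `1`, extended by zero to a multilinear
map on all families. -/
def cofiniteProd (ι : Type*) : MultilinearMap ℂ (fun _ : ι => ℂ) ℂ where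
  toFun w := if (Function.mulSupport w).Finite then ∏ᶠ i, w i else 0
  map_update_add' {inst} w i x y := by
    -- The decidability instance in the definition of multilinearity is arbitrary and has to be
    -- identified with the classical one.
    have hd : inst = fun a b => Classical.propDecidable (a = b) := Subsingleton.elim _ _
    subst hd
    have h := finprod_update_smul w i
    simp only [h]
    split_ifs <;> ring
  map_update_smul' {inst} w i c x := by
    have hd : inst = fun a b => Classical.propDecidable (a = b) := Subsingleton.elim _ _
    subst hd
    have h := finprod_update_smul w i
    simp only [h, smul_eq_mul]
    split_ifs <;> ring

/-- The pure tensor `⨂ 1`. -/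
def trivialTensorOne : TrivialTensor :=
  ⟨PiTensorProduct.tprod ℂ fun _ => (1 : ℂ), Submodule.subset_span
    ⟨fun _ => 1, Filter.Eventually.of_forall fun _ => rfl, rfl⟩⟩

/-- The restricted tensor product of one-dimensional spaces is one-dimensional. -/
def trivialTensorEquiv : ℂ ≃ₗ[ℂ] TrivialTensor := by
  -- The product functional `L` shows that `⨂ 1` is nonzero and gives the coordinate with respect to
  -- it.
  let L : TrivialTensor →ₗ[ℂ] ℂ :=
    PiTensorProduct.lift (cofiniteProd (HeightOneSpectrum ℤ)) ∘ₗ Submodule.subtype _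
  have hL : L trivialTensorOne = 1 := by
    show PiTensorProduct.lift (cofiniteProd (HeightOneSpectrum ℤ)) (PiTensorProduct.tprod ℂ _) = 1
    rw [PiTensorProduct.lift.tprod]
    simp [cofiniteProd]
  refine LinearEquiv.ofLinearMap (LinearMap.toSpanSingleton ℂ TrivialTensor trivialTensorOne) L ?_ ?_
  · refine LinearMap.ext fun t => ?_
    obtain ⟨t, ht⟩ := t
    show L ⟨t, ht⟩ • trivialTensorOne = ⟨t, ht⟩
    refine Subtype.ext ?_
    show PiTensorProduct.lift (cofiniteProd (HeightOneSpectrum ℤ)) t • trivialTensorOne.1 = t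
    induction ht using Submodule.span_induction with
    | mem t ht =>
      classical
      obtain ⟨w, hw, rfl⟩ := ht
      have hfin : (Function.mulSupport w).Finite := hw
      -- Only finitely many components differ from `1`, so multilinearity pulls them out as a
      -- scalar.
      have h1 : w = hfin.toFinset.piecewise (fun i => w i • (1 : ℂ)) (fun _ => 1) := by
        ext i
        by_cases hi : i ∈ hfin.toFinset
        · simp [Finset.piecewise_eq_of_mem _ _ _ hi]
        · rw [Finset.piecewise_eq_of_notMem _ _ _ hi]
          by_contra hne
          exact hi (hfin.mem_toFinset.2 hne)
      have h2 := (PiTensorProduct.tprod ℂ (s := fun _ : HeightOneSpectrum ℤ => ℂ)).map_piecewise_smul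
        w (fun _ => 1) hfin.toFinset
      rw [← h1] at h2
      rw [h2, map_smul, ← finprod_eq_prod _ hfin, smul_assoc]
      show _ • L trivialTensorOne • trivialTensorOne.1 = _
      rw [hL, one_smul]
      rfl
    | zero => simp
    | add x y _ _ hx hy => rw [map_add, add_smul, hx, hy]
    | smul c x _ hx => rw [map_smul, smul_assoc, hx]
  · ext
    simp [hL]

end TrivialTensor

/-! ### The decomposition of `secRange m` -/

section Decomposition

variable {m : ℕ}

/-- The space of the functions `secFn p` is isomorphic to `ℂ[X]_m`. -/
def secEquiv (m : ℕ) : PolyLE m ≃ₗ[ℂ] secRange m := LinearEquiv.ofInjective secFn secFn_injective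

lemma secEquiv_coe (p : PolyLE m) : (secEquiv m p : SmoothFn (PolyLE m)) = secFn p := rfl

/-- The isomorphism of the space of the functions `secFn p` with `sym^m ⊗ ⨂'_v 1_v`. -/
def secTensorEquiv (m : ℕ) : secRange m ≃ₗ[ℂ] PolyLE m ⊗[ℂ] TrivialTensor :=
  (secEquiv m).symm ≪≫ₗ (TensorProduct.rid ℂ (PolyLE m)).symm ≪≫ₗ
    TensorProduct.congr (LinearEquiv.refl ℂ _) trivialTensorEquiv

lemma secTensorEquiv_secEquiv (p : PolyLE m) :
    secTensorEquiv m (secEquiv m p) = p ⊗ₜ trivialTensorEquiv 1 := by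
  simp [secTensorEquiv]

lemma secTensorEquiv_intertwines (h : IsSubrep (symQ m) (secRange m)) :
    Intertwines h.toModule ((symModule m).tensor trivialTensorModule)
      (secTensorEquiv m).toLinearMap where
  lie X v := by
    obtain ⟨p, rfl⟩ := (secEquiv m).surjective v
    have h1 : h.toModule.lie X (secEquiv m p) = secEquiv m (dsym m X p) :=
      Subtype.ext (lieAct_secFn X p)
    show secTensorEquiv m _ = tensorLie _ _ X (secTensorEquiv m (secEquiv m p))
    rw [h1, secTensorEquiv_secEquiv, secTensorEquiv_secEquiv]
    simp [tensorLie, symModule, trivialTensorModule]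
  inf k v := by
    obtain ⟨p, rfl⟩ := (secEquiv m).surjective v
    have h1 : h.toModule.rhoInf k (secEquiv m p) = secEquiv m (sym m k.1 p) :=
      Subtype.ext (rightShift_secFn _ p)
    show secTensorEquiv m _ = (TensorProduct.map _ _) (secTensorEquiv m (secEquiv m p))
    rw [h1, secTensorEquiv_secEquiv, secTensorEquiv_secEquiv]
    rfl
  fin y v := by
    obtain ⟨p, rfl⟩ := (secEquiv m).surjective v
    have h1 : h.toModule.rhoFin y (secEquiv m p) = secEquiv m p :=
      Subtype.ext ((rightShift_secFn _ p).trans (by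
        show secFn (sym m 1 p) = secFn p
        rw [map_one]; rfl))
    show secTensorEquiv m _ = (TensorProduct.map _ _) (secTensorEquiv m (secEquiv m p))
    rw [h1, secTensorEquiv_secEquiv, TensorProduct.map_tmul]
    exact congrArg (p ⊗ₜ[ℂ] ·) (trivialTensorRep_apply y _).symm

end Decomposition

/-! ### Compactness of `K_f` and right translation by finite adelic elements -/

section FiniteShift

variable {V : Type*} [NormedAddCommGroup V] [NormedSpace ℂ V]

/-- Transported from the compactness of `ℤ_p`. -/
instance (v : HeightOneSpectrum ℤ) : CompactSpace (v.adicCompletionIntegers ℚ) := by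
  have hp : Fact (Nat.Prime (Rat.HeightOneSpectrum.primesEquiv v : ℕ)) :=
    ⟨(Rat.HeightOneSpectrum.primesEquiv v).2⟩
  let e := Rat.HeightOneSpectrum.adicCompletion.padicEquiv v
  let p : ℕ := Rat.HeightOneSpectrum.primesEquiv v
  have h1 : IsCompact (PadicInt.subring p : Set ℚ_[p]) :=
    isCompact_iff_compactSpace.2 (PadicInt.compactSpace p)
  have h2 := h1.image e.toHomeomorph.symm.continuous
  have h3 : e.toHomeomorph.symm '' (PadicInt.subring p : Set ℚ_[p]) =
      (v.adicCompletionIntegers ℚ : Set (v.adicCompletion ℚ)) := by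
    rw [← (Rat.HeightOneSpectrum.adicCompletion.padicEquiv_bijOn v).image_eq]
    exact e.toHomeomorph.toEquiv.symm_image_image _
  rw [h3] at h2
  exact isCompact_iff_compactSpace.1 h2

/-- Closed points make the locus `det = 1` closed among the adelic matrices, as the compactness of
`K_f` requires. -/
instance : T1Space Af :=
  inferInstanceAs (T1Space (RestrictedProduct (fun v : HeightOneSpectrum ℤ => v.adicCompletion ℚ)
    (fun v => (v.adicCompletionIntegers ℚ : Set (v.adicCompletion ℚ))) Filter.cofinite))

/-- This is the continuous image of a product of compact spaces under the structure map of the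
restricted product. -/
lemma isCompact_integral : IsCompact {a : Af | ∀ v, a v ∈ v.adicCompletionIntegers ℚ} := by
  have : ∀ v : HeightOneSpectrum ℤ, CompactSpace
      ((v.adicCompletionIntegers ℚ : Set (v.adicCompletion ℚ)) : Type) := fun v =>
    inferInstanceAs (CompactSpace (v.adicCompletionIntegers ℚ))
  have h1 := isCompact_range (RestrictedProduct.isEmbedding_structureMap
    (R := fun v : HeightOneSpectrum ℤ => v.adicCompletion ℚ)
    (A := fun v => (v.adicCompletionIntegers ℚ : Set (v.adicCompletion ℚ)))
    (𝓕 := Filter.cofinite)).continuous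
  have h2 : {a : Af | ∀ v, a v ∈ v.adicCompletionIntegers ℚ} =
      (Set.range (RestrictedProduct.structureMap
        (fun v : HeightOneSpectrum ℤ => v.adicCompletion ℚ)
        (fun v => (v.adicCompletionIntegers ℚ : Set (v.adicCompletion ℚ)))
        Filter.cofinite) : Set Af) := by
    refine Set.ext fun a => ⟨fun h => ⟨fun v => ⟨a v, h v⟩, rfl⟩, ?_⟩
    rintro ⟨b, rfl⟩ v
    exact (b v).2
  rw [h2]
  exact h1

lemma isCompact_Kf : IsCompact (Kf : Set (SL2 Af)) := by
  have h1 : IsCompact (Set.univ.pi fun _ : Fin 2 => Set.univ.pi fun _ : Fin 2 =>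
      {a : Af | ∀ v, a v ∈ v.adicCompletionIntegers ℚ}) :=
    isCompact_univ_pi fun _ => isCompact_univ_pi fun _ => isCompact_integral
  have h2 := (Matrix.SpecialLinearGroup.isClosedEmbedding_val (n := Fin 2) (R := Af)).isCompact_preimage
    h1
  refine (congrArg IsCompact (Set.ext fun g => ?_)).mpr h2
  rw [SetLike.mem_coe, mem_Kf_iff]
  exact ⟨fun h i _ j _ v => h v i j, fun h v i j => h i trivial j trivial v⟩

lemma exists_finset_cover (U : OpenSubgroup (SL2 Af)) :
    ∃ s : Finset (SL2 Af), ∀ k ∈ Kf, ∃ a ∈ s, a⁻¹ * k ∈ U := by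
  obtain ⟨s, -, hs⟩ := isCompact_Kf.elim_nhds_subcover (fun a => (fun k => a⁻¹ * k) ⁻¹' (U : Set (SL2 Af)))
    (fun a _ => (U.isOpen.preimage (by fun_prop)).mem_nhds (by simp [one_mem]))
  refine ⟨s, fun k hk => ?_⟩
  obtain ⟨a, ha, hak⟩ := Set.mem_iUnion₂.1 (hs hk)
  exact ⟨a, ha, hak⟩

/-- A smooth function is fixed by an open subgroup `U`, and finitely many cosets `a U` cover the
compact `K_f`; so `K_f` contributes only finitely many translates. This is needed because
translation by `y ∈ SL₂(𝔸_f)` commutes with `K_∞` but not with `K_f`. -/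
lemma isKFinite_of_inf {F : SmoothFn V} (hF : FiniteDimensional ℂ
    (Submodule.span ℂ (Set.range fun k : Kinf => rightShift (infIn k) F))) : IsKFinite F := by
  obtain ⟨⟨U, hU⟩, -⟩ := F.2
  obtain ⟨s, hs⟩ := exists_finset_cover U
  let S : SL2 Af → Submodule ℂ (SmoothFn V) := fun a =>
    (Submodule.span ℂ (Set.range fun k : Kinf => rightShift (infIn k) F)).map (rightShift (finIn a))
  have hS : FiniteDimensional ℂ (s.sup S : Submodule ℂ (SmoothFn V)) :=
    Submodule.finiteDimensional_finset_sup s S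
  refine Submodule.finiteDimensional_of_le (S₂ := s.sup S) (Submodule.span_le.2 ?_)
  rintro _ ⟨⟨⟨x, y⟩, hx, hy⟩, rfl⟩
  obtain ⟨a, ha, hay⟩ := hs y hy
  refine Finset.le_sup (f := S) ha ?_
  refine ⟨rightShift (infIn ⟨x, hx⟩) F, Submodule.subset_span ⟨_, rfl⟩, ?_⟩
  refine SmoothFn.ext fun p => ?_
  have h1 := hU (p.1 * x) (p.2 * a) (a⁻¹ * y) hay
  have h2 : p.2 * a * (a⁻¹ * y) = p.2 * y := by group
  rw [h2] at h1
  show F.1 (p * finIn a * infIn ⟨x, hx⟩) = F.1 (p.1 * x, p.2 * y)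
  rw [h1]
  refine congrArg F.1 (Prod.ext ?_ ?_)
  · show p.1 * 1 * x = p.1 * x
    rw [mul_one]
  · show p.2 * a * 1 = p.2 * a
    rw [mul_one]

lemma rightShift_finIn_lieAct (y : SL2 Af) (X : sl2) (F : SmoothFn V) :
    rightShift (finIn y) (lieAct X F) = lieAct X (rightShift (finIn y) F) := by
  have h1 := rightShift_lieAct (finIn y) X F
  have h2 : (finIn y).1 = 1 := rfl
  rwa [h2, Ad_one] at h1

lemma rightShift_finIn_envAct (y : SL2 Af) (u : Ug) : ∀ F : SmoothFn V,
    rightShift (finIn y) (envAct u F) = envAct u (rightShift (finIn y) F) := by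
  refine envInduction (P := fun u => ∀ F : SmoothFn V,
    rightShift (finIn y) (envAct u F) = envAct u (rightShift (finIn y) F)) ?_ ?_ ?_ ?_ u
  · intro X F
    rw [envAct_ι, envAct_ι, rightShift_finIn_lieAct]
  · intro c F
    rw [AlgHom.commutes]
    exact map_smul _ c F
  · intro _ _ ha hb F
    rw [map_add, LinearMap.add_apply, LinearMap.add_apply, map_add, ha, hb]
  · intro _ _ ha hb F
    rw [map_mul, Module.End.mul_apply, Module.End.mul_apply, ha, hb]

lemma normFin_mul_le (v : HeightOneSpectrum ℤ) (g h : SL2 (v.adicCompletion ℚ)) :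
    normFin v (g * h) ≤ normFin v g * normFin v h := by
  have hle : ∀ (g : SL2 (v.adicCompletion ℚ)) i j, ‖g i j‖ ≤ normFin v g := by
    intro g i j
    fin_cases i <;> fin_cases j <;> simp [normFin]
  have h1 : ∀ i j, ‖(g * h) i j‖ ≤ normFin v g * normFin v h := by
    intro i j
    have h0 : ∀ k, ‖g i k * h k j‖ ≤ normFin v g * normFin v h := fun k => by
      rw [norm_mul]
      exact mul_le_mul (hle _ _ _) (hle _ _ _) (norm_nonneg _)
        (zero_le_one.trans (one_le_normFin v g))
    rw [Matrix.SpecialLinearGroup.coe_mul, Matrix.mul_apply, Fin.sum_univ_two]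
    exact (IsUltrametricDist.norm_add_le_max _ _).trans (max_le (h0 0) (h0 1))
  exact max_le (max_le (h1 0 0) (h1 0 1)) (max_le (h1 1 0) (h1 1 1))

lemma normFin_mulSupport_finite (y : SL2 Af) :
    (Function.mulSupport fun v => normFin v (localComponent v y)).Finite := by
  refine Set.Finite.subset (eventually_mem_Kfin y) fun v hv hmem => hv ?_
  have hmem := (mem_Kfin_iff v _).1 hmem
  have h1 : ∀ i j, ‖localComponent v y i j‖ ≤ 1 := fun i j =>
    Valued.toNormedField.norm_le_one_iff.2 (hmem i j)
  exact le_antisymm (max_le (max_le (h1 0 0) (h1 0 1)) (max_le (h1 1 0) (h1 1 1)))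
    (one_le_normFin v _)

/-- The local norms are submultiplicative by the ultrametric inequality, so a finite adelic
translation costs only a constant and moderate growth survives. -/
lemma adelicNorm_mul_finIn_le (g : GA) (y : SL2 Af) :
    adelicNorm (g * finIn y) ≤ (∏ᶠ v, normFin v (localComponent v y)) * adelicNorm g := by
  have h1 : (g * finIn y).1 = g.1 := mul_one _
  have h2 : (g * finIn y).2 = g.2 * y := rfl
  have h0 : ∀ v (y : SL2 (v.adicCompletion ℚ)), 0 ≤ normFin v y := fun v y =>
    zero_le_one.trans (one_le_normFin v y)
  rw [adelicNorm, adelicNorm, h1, h2, mul_left_comm]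
  refine mul_le_mul_of_nonneg_left ?_ (Real.sqrt_nonneg _)
  rw [mul_comm, ← finprod_mul_distrib (normFin_mulSupport_finite g.2) (normFin_mulSupport_finite y)]
  refine finprod_le_finprod (normFin_mulSupport_finite (g.2 * y)) (fun v => h0 v _) ?_ fun v => ?_
  · exact ((normFin_mulSupport_finite g.2).union (normFin_mulSupport_finite y)).subset
      (Function.mulSupport_mul _ _)
  · show normFin v (localComponent v (g.2 * y)) ≤ _
    rw [map_mul]
    exact normFin_mul_le v _ _

lemma rightShift_finIn_mem_autForm {ρ : Representation ℂ (SL2 ℚ) V} (y : SL2 Af) {F : SmoothFn V}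
    (hF : F ∈ AutForm ρ) : rightShift (finIn y) F ∈ AutForm ρ := by
  obtain ⟨h1, h2, h3, C, a, h4⟩ := hF
  refine ⟨fun γ g => ?_, isKFinite_of_inf ?_, ?_, |C| * (∏ᶠ v, normFin v (localComponent v y)) ^ a, a,
    fun g => ?_⟩
  · rw [rightShift_apply, rightShift_apply, mul_assoc, h1]
  · have hfd := h2.inf
    refine Submodule.finiteDimensional_of_le (S₂ := (Submodule.span ℂ
      (Set.range fun k : Kinf => rightShift (infIn k) F)).map (rightShift (finIn y)))
      (Submodule.span_le.2 ?_)
    rintro _ ⟨k, rfl⟩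
    refine ⟨rightShift (infIn k) F, Submodule.subset_span ⟨k, rfl⟩, ?_⟩
    show rightShift (finIn y) (rightShift (infIn k) F) =
      rightShift (infIn k) (rightShift (finIn y) F)
    rw [← Module.End.mul_apply, ← Module.End.mul_apply, ← map_mul, ← map_mul]
    congr 2
    exact Prod.ext (by simp [finIn, infIn]) (by simp [finIn, infIn])
  · have hfd : FiniteDimensional ℂ (Submodule.span ℂ
      (Set.range fun z : Subalgebra.center ℂ Ug => envAct (z : Ug) F)) := h3
    refine Submodule.finiteDimensional_of_le (S₂ := (Submodule.span ℂ
      (Set.range fun z : Subalgebra.center ℂ Ug => envAct (z : Ug) F)).map (rightShift (finIn y)))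
      (Submodule.span_le.2 ?_)
    rintro _ ⟨z, rfl⟩
    exact ⟨envAct (z : Ug) F, Submodule.subset_span ⟨z, rfl⟩, rightShift_finIn_envAct y _ F⟩
  · have h5 := adelicNorm_mul_finIn_le g y
    have h6 := zero_le_one.trans (one_le_adelicNorm (g * finIn y))
    calc ‖F.1 (g * finIn y)‖ ≤ C * adelicNorm (g * finIn y) ^ a := h4 _
      _ ≤ |C| * ((∏ᶠ v, normFin v (localComponent v y)) * adelicNorm g) ^ a := by
        have := le_abs_self C
        gcongr
      _ = _ := by rw [mul_pow, mul_assoc]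

end FiniteShift

/-! ### Graded families of subspaces -/

section Graded

/-- The Casimir element of an `𝔰𝔩₂`-triple commutes with the triple. -/
lemma casimir_commute {A : Type*} [Ring A] {h e f : A} (he : h * e - e * h = 2 * e)
    (hf : h * f - f * h = -(2 * f)) (hef : e * f - f * e = h) :
    Commute (4 * (f * e) + h * h + 2 * h) h ∧ Commute (4 * (f * e) + h * h + 2 * h) e ∧
      Commute (4 * (f * e) + h * h + 2 * h) f := by
  refine ⟨?_, ?_, ?_⟩
  -- In each case the commutator is first written through the brackets of the triple, into which the
  -- relations are then substituted.
  · have h1 : (4 * (f * e) + h * h + 2 * h) * h - h * (4 * (f * e) + h * h + 2 * h) =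
        -(4 * (f * (h * e - e * h) + (h * f - f * h) * e)) := by noncomm_ring
    rw [commute_iff_eq, ← sub_eq_zero, h1, he, hf]
    noncomm_ring
  · have h1 : (4 * (f * e) + h * h + 2 * h) * e - e * (4 * (f * e) + h * h + 2 * h) =
        -(4 * ((e * f - f * e) * e)) + h * (h * e - e * h) + (h * e - e * h) * h +
          2 * (h * e - e * h) := by noncomm_ring
    rw [commute_iff_eq, ← sub_eq_zero, h1, he, hef]
    have h2 : -(4 * (h * e)) + h * (2 * e) + 2 * e * h + 2 * (2 * e) =
        -(2 * (h * e - e * h)) + 4 * e := by noncomm_ring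
    rw [h2, he]
    noncomm_ring
  · have h1 : (4 * (f * e) + h * h + 2 * h) * f - f * (4 * (f * e) + h * h + 2 * h) =
        4 * (f * (e * f - f * e)) + h * (h * f - f * h) + (h * f - f * h) * h +
          2 * (h * f - f * h) := by noncomm_ring
    rw [commute_iff_eq, ← sub_eq_zero, h1, hf, hef]
    have h2 : 4 * (f * h) + h * -(2 * f) + -(2 * f) * h + 2 * -(2 * f) =
        -(2 * (h * f - f * h)) - 4 * f := by noncomm_ring
    rw [h2, hf]
    noncomm_ring

variable {M : Type*} [AddCommGroup M] [Module ℂ M]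

/-- The images of a subspace stable under `h` and the Casimir operator `c` under the powers of the
raising operator `e`. -/
lemma raising_stable {h e f c : Module.End ℂ M} (he : h * e - e * h = (2 : ℂ) • e)
    (hc : (4 : ℂ) • (f * e) + h * h + (2 : ℂ) • h = c) (hce : Commute c e) {V : Submodule ℂ M}
    (hV : ∀ v ∈ V, h v ∈ V) (hcV : ∀ v ∈ V, c v ∈ V) (k : ℕ) :
    (∀ v ∈ V.map (e ^ k), h v ∈ V.map (e ^ k)) ∧
      (∀ v ∈ V.map (e ^ k), e v ∈ V.map (e ^ (k + 1))) ∧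
      (∀ v ∈ V.map (e ^ (k + 1)), f v ∈ V.map (e ^ k)) := by
  have h1 : ∀ k, ∀ v ∈ V.map (e ^ k), e v ∈ V.map (e ^ (k + 1)) := by
    rintro k _ ⟨v, hv, rfl⟩
    exact ⟨v, hv, by rw [pow_succ']; rfl⟩
  have h2 : ∀ k, ∀ v ∈ V.map (e ^ (k + 1)), ∃ w ∈ V.map (e ^ k), v = e w := by
    rintro k _ ⟨v, hv, rfl⟩
    exact ⟨(e ^ k) v, ⟨v, hv, rfl⟩, by rw [pow_succ']; rfl⟩
  have h3 : ∀ k, ∀ v ∈ V.map (e ^ k), h v ∈ V.map (e ^ k) := by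
    intro k
    induction k with
    | zero => simpa using hV
    | succ k ih =>
      intro v hv
      obtain ⟨w, hw, rfl⟩ := h2 k v hv
      have h4 : h (e w) = e (h w) + (2 : ℂ) • e w := by
        have := LinearMap.congr_fun he w
        simp only [LinearMap.sub_apply, Module.End.mul_apply, LinearMap.smul_apply] at this
        rw [← this]; abel
      rw [h4]
      exact Submodule.add_mem _ (h1 k _ (ih w hw)) (Submodule.smul_mem _ _ (h1 k w hw))
  have h4 : ∀ v ∈ V.map (e ^ k), c v ∈ V.map (e ^ k) := by
    rintro _ ⟨v, hv, rfl⟩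
    refine ⟨c v, hcV v hv, ?_⟩
    exact (LinearMap.congr_fun (hce.pow_right k).eq v).symm
  refine ⟨h3 k, h1 k, fun v hv => ?_⟩
  obtain ⟨w, hw, rfl⟩ := h2 k v hv
  -- The Casimir relation expresses `f e` through `c` and `h`, so lowering undoes raising up to
  -- operators that preserve the space.
  have h5 : f (e w) = (4 : ℂ)⁻¹ • (c w - h (h w) - (2 : ℂ) • h w) := by
    have := LinearMap.congr_fun hc w
    simp only [LinearMap.add_apply, Module.End.mul_apply, LinearMap.smul_apply] at this
    rw [← this]
    module
  rw [h5]
  exact Submodule.smul_mem _ _ (Submodule.sub_mem _ (Submodule.sub_mem _ (h4 w hw)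
    (h3 k _ (h3 k w hw))) (Submodule.smul_mem _ _ (h3 k w hw)))

/-- A family of finite-dimensional subspaces that is shifted by the raising and lowering operators
of an `𝔰𝔩₂`-triple. -/
structure IsGradedFor (h e f : Module.End ℂ M) (T : ℤ → Submodule ℂ M) : Prop where
  fin : ∀ n, FiniteDimensional ℂ (T n)
  h_mem : ∀ n, ∀ v ∈ T n, h v ∈ T n
  e_mem : ∀ n, ∀ v ∈ T n, e v ∈ T (n + 1)
  f_mem : ∀ n, ∀ v ∈ T n, f v ∈ T (n - 1)

lemma exists_isGradedFor {h e f : Module.End ℂ M} (he : h * e - e * h = 2 * e)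
    (hf : h * f - f * h = -(2 * f)) (hef : e * f - f * e = h) (V : Submodule ℂ M)
    [FiniteDimensional ℂ V] (hV : ∀ v ∈ V, h v ∈ V)
    (hcV : ∀ v ∈ V, (4 * (f * e) + h * h + 2 * h) v ∈ V) :
    ∃ T : ℤ → Submodule ℂ M, IsGradedFor h e f T ∧ T 0 = V := by
  obtain ⟨-, hce, hcf⟩ := casimir_commute he hf hef
  have h2 : ∀ x : Module.End ℂ M, (2 : ℂ) • x = 2 * x := fun x => by
    rw [two_smul, two_mul]
  have h4 : ∀ x : Module.End ℂ M, (4 : ℂ) • x = 4 * x := fun x => by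
    rw [ofNat_smul_eq_nsmul ℂ 4 x, nsmul_eq_mul]; rfl
  have hp := raising_stable (by rw [h2]; exact he) (by rw [h2, h4]) hce hV hcV
  -- The negative half uses the triple `(-h, f, e)`. Its Casimir operator `4 e f + h² - 2 h` is the
  -- same one, because `e f = h + f e`.
  have hm := raising_stable (h := -h) (e := f) (f := e) (c := 4 * (f * e) + h * h + 2 * h)
    (by rw [h2, neg_mul, mul_neg, ← neg_inj, ← hf]; abel)
    (by rw [h2, h4]
        have : e * f = h + f * e := by rw [← hef]; abel
        rw [this]; noncomm_ring) hcf
    (fun v hv => V.neg_mem (hV v hv)) hcV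
  let T : ℤ → Submodule ℂ M
    | .ofNat k => V.map (e ^ k)
    -- The index `negSucc k` stands for `-(k + 1)`, which explains the exponent.
    | .negSucc k => V.map (f ^ (k + 1))
  refine ⟨T, ⟨?_, ?_, ?_, ?_⟩, (congrArg V.map (pow_zero e)).trans (Submodule.map_id V)⟩
  · rintro (k | k)
    · exact Module.Finite.map V (e ^ k)
    · exact Module.Finite.map V (f ^ (k + 1))
  · rintro (k | k) v hv
    · exact (hp k).1 v hv
    · exact (neg_mem_iff).1 ((hm (k + 1)).1 v hv)
  · rintro (k | k) v hv
    · exact (hp k).2.1 v hv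
    · rcases k with _ | k
      · simpa [T] using (hm 0).2.2 v hv
      · exact (hm (k + 1)).2.2 v hv
  · rintro (k | k) v hv
    · rcases k with _ | k
      · have hv' : v ∈ V.map (f ^ 0) := by simpa [T] using hv
        exact (hm 0).2.1 v hv'
      · have h5 : Int.ofNat (k + 1) - 1 = Int.ofNat k := by simp
        rw [h5]
        exact (hp k).2.2 v hv
    · exact (hm (k + 1)).2.1 v hv

end Graded

/-! ### The Cayley transform of the standard triple -/

section Cayley

variable {V : Type*} [NormedAddCommGroup V] [NormedSpace ℂ V]

/-- The matrix `C` with `J C = C diag(-i, i)`. -/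
def cayley : Matrix (Fin 2) (Fin 2) ℂ := !![1, Complex.I; Complex.I, 1]

/-- The semisimple element `C H C⁻¹ = i J`. -/
def cayH : sl2 := ⟨!![0, -Complex.I; Complex.I, 0], by
  change Matrix.trace (!![0, -Complex.I; Complex.I, 0] : Matrix (Fin 2) (Fin 2) ℂ) = 0
  simp [Matrix.trace_fin_two]⟩

/-- The raising operator `C E C⁻¹`. -/
def cayE : sl2 := ⟨!![-Complex.I / 2, 1 / 2; 1 / 2, Complex.I / 2], by
  change Matrix.trace (!![-Complex.I / 2, 1 / 2; 1 / 2, Complex.I / 2] :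
    Matrix (Fin 2) (Fin 2) ℂ) = 0
  simp [Matrix.trace_fin_two]; ring⟩

/-- The lowering operator `C F C⁻¹`. -/
def cayF : sl2 := ⟨!![Complex.I / 2, 1 / 2; 1 / 2, -Complex.I / 2], by
  change Matrix.trace (!![Complex.I / 2, 1 / 2; 1 / 2, -Complex.I / 2] :
    Matrix (Fin 2) (Fin 2) ℂ) = 0
  simp [Matrix.trace_fin_two]; ring⟩

lemma sl2_bracket_val (X Y : sl2) : (⁅X, Y⁆ : sl2).1 = X.1 * Y.1 - Y.1 * X.1 := rfl

lemma cayH_cayE : ⁅cayH, cayE⁆ = (2 : ℂ) • cayE := by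
  refine Subtype.ext ?_
  rw [sl2_bracket_val]
  show _ = (2 : ℂ) • cayE.1
  have hI := Complex.I_mul_I
  ext i j
  fin_cases i <;> fin_cases j <;> simp [cayH, cayE] <;> grind

lemma cayH_cayF : ⁅cayH, cayF⁆ = -((2 : ℂ) • cayF) := by
  refine Subtype.ext ?_
  rw [sl2_bracket_val]
  show _ = -((2 : ℂ) • cayF.1)
  have hI := Complex.I_mul_I
  ext i j
  fin_cases i <;> fin_cases j <;> simp [cayH, cayF] <;> grind

lemma cayE_cayF : ⁅cayE, cayF⁆ = cayH := by
  refine Subtype.ext ?_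
  rw [sl2_bracket_val]
  have hI := Complex.I_mul_I
  ext i j
  fin_cases i <;> fin_cases j <;> simp [cayH, cayE, cayF] <;> grind

lemma exists_cay_combination (X : sl2) :
    ∃ a b c : ℂ, X = a • cayH + b • cayE + c • cayF := by
  have hX : Matrix.trace X.1 = 0 := X.2
  rw [Matrix.trace_fin_two] at hX
  have hI := Complex.I_mul_I
  refine ⟨Complex.I * (X.1 0 1 - X.1 1 0) / 2, Complex.I * X.1 0 0 + (X.1 0 1 + X.1 1 0) / 2,
    -Complex.I * X.1 0 0 + (X.1 0 1 + X.1 1 0) / 2, Subtype.ext ?_⟩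
  show X.1 = _ • cayH.1 + _ • cayE.1 + _ • cayF.1
  ext i j
  fin_cases i <;> fin_cases j <;> simp [cayH, cayE, cayF] <;> grind

/-- This is the reason for the Cayley transform: its weight operator belongs to the complexified Lie
algebra of `K_∞`, so `K_∞`-finiteness controls it. -/
lemma cayH_eq : cayH = Complex.I • Jgen := by
  refine Subtype.ext ?_
  show _ = Complex.I • Jgen.1
  ext i j
  fin_cases i <;> fin_cases j <;> simp [cayH, Jgen]

lemma cayley_stdH : cayH.1 * cayley = cayley * stdH.1 := by
  ext i j
  fin_cases i <;> fin_cases j <;> simp [cayH, cayley, stdH]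

lemma cayley_stdE : cayE.1 * cayley = cayley * stdE.1 := by
  have hI := Complex.I_mul_I
  ext i j
  fin_cases i <;> fin_cases j <;> simp [cayE, cayley, stdE] <;> grind

lemma cayley_stdF : cayF.1 * cayley = cayley * stdF.1 := by
  have hI := Complex.I_mul_I
  ext i j
  fin_cases i <;> fin_cases j <;> simp [cayF, cayley, stdF] <;> grind

lemma ring_triple {A : Type*} [Ring A] [Algebra ℂ A] (φ : sl2 →ₗ⁅ℂ⁆ A) :
    φ cayH * φ cayE - φ cayE * φ cayH = 2 * φ cayE ∧
      φ cayH * φ cayF - φ cayF * φ cayH = -(2 * φ cayF) ∧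
      φ cayE * φ cayF - φ cayF * φ cayE = φ cayH := by
  refine ⟨?_, ?_, ?_⟩
  · rw [← LieRing.of_associative_ring_bracket, ← LieHom.map_lie, cayH_cayE, map_smul, two_smul,
      two_mul]
  · rw [← LieRing.of_associative_ring_bracket, ← LieHom.map_lie, cayH_cayF, map_neg, map_smul,
      two_smul, two_mul]
  · rw [← LieRing.of_associative_ring_bracket, ← LieHom.map_lie, cayE_cayF]

end Cayley

/-! ### Finiteness under the center of the enveloping algebra -/

section ZFinite

variable {V : Type*} [NormedAddCommGroup V] [NormedSpace ℂ V]

/-- A graded family of spaces of smooth functions. -/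
abbrev IsGradedFn (T : ℤ → Submodule ℂ (SmoothFn V)) : Prop :=
  IsGradedFor (lieAct cayH) (lieAct cayE) (lieAct cayF) T

/-- The elements of the enveloping algebra of weight `2 n` that shift a graded family by `n`. -/
def shiftSpace (T : ℤ → Submodule ℂ (SmoothFn V)) (n : ℤ) : Submodule ℂ Ug where
  carrier := {u | UniversalEnvelopingAlgebra.ι ℂ cayH * u - u * UniversalEnvelopingAlgebra.ι ℂ cayH =
    (2 * n : ℂ) • u ∧ ∀ s, ∀ F ∈ T s, envAct u F ∈ T (s + n)}
  zero_mem' := by simp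
  add_mem' {a b} ha hb := by
    refine ⟨?_, fun s F hF => ?_⟩
    · rw [smul_add, ← ha.1, ← hb.1]; noncomm_ring
    · rw [map_add]; exact Submodule.add_mem _ (ha.2 s F hF) (hb.2 s F hF)
  smul_mem' c a ha := by
    refine ⟨?_, fun s F hF => ?_⟩
    · rw [smul_comm, ← ha.1, mul_smul_comm, smul_mul_assoc, smul_sub]
    · rw [map_smul]; exact Submodule.smul_mem _ _ (ha.2 s F hF)

lemma shiftSpace_mul {T : ℤ → Submodule ℂ (SmoothFn V)} {n k : ℤ} {a b : Ug}
    (ha : a ∈ shiftSpace T n) (hb : b ∈ shiftSpace T k) : a * b ∈ shiftSpace T (n + k) := by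
  refine ⟨?_, fun s F hF => ?_⟩
  · have h1 : UniversalEnvelopingAlgebra.ι ℂ cayH * (a * b) -
        a * b * UniversalEnvelopingAlgebra.ι ℂ cayH =
        (UniversalEnvelopingAlgebra.ι ℂ cayH * a - a * UniversalEnvelopingAlgebra.ι ℂ cayH) * b +
        a * (UniversalEnvelopingAlgebra.ι ℂ cayH * b - b * UniversalEnvelopingAlgebra.ι ℂ cayH) := by
      noncomm_ring
    rw [h1, ha.1, hb.1, smul_mul_assoc, mul_smul_comm, ← add_smul]
    push_cast
    ring_nf
  · rw [map_mul, add_comm n k, ← add_assoc]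
    exact ha.2 _ _ (hb.2 s F hF)

/-- The enveloping algebra is generated by the triple, whose members shift by `0`, `1` and `-1`, and
shifts add under multiplication. -/
lemma iSup_shiftSpace {T : ℤ → Submodule ℂ (SmoothFn V)} (hT : IsGradedFn T) (u : Ug) :
    u ∈ ⨆ n, shiftSpace T n := by
  have hle : ∀ n, shiftSpace T n ≤ ⨆ n, shiftSpace T n := le_iSup (shiftSpace T)
  obtain ⟨h1, h2, -⟩ := ring_triple (UniversalEnvelopingAlgebra.ι ℂ (L := sl2))
  refine envInduction (P := fun u => u ∈ ⨆ n, shiftSpace T n) ?_ ?_ ?_ ?_ u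
  · intro X
    obtain ⟨a, b, c, rfl⟩ := exists_cay_combination X
    rw [map_add, map_add, map_smul, map_smul, map_smul]
    refine Submodule.add_mem _ (Submodule.add_mem _ (Submodule.smul_mem _ _ (hle 0 ⟨?_, ?_⟩))
      (Submodule.smul_mem _ _ (hle 1 ⟨?_, ?_⟩))) (Submodule.smul_mem _ _ (hle (-1) ⟨?_, ?_⟩))
    · simp
    · intro s F hF
      rw [envAct_ι, add_zero]; exact hT.h_mem s F hF
    · rw [h1]
      simp [two_smul, two_mul]
    · intro s F hF
      rw [envAct_ι]; exact hT.e_mem s F hF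
    · rw [h2]
      simp [two_smul, two_mul]
    · intro s F hF
      rw [envAct_ι]; exact hT.f_mem s F hF
  · intro c
    refine hle 0 ⟨?_, fun s F hF => ?_⟩
    · rw [Algebra.commutes c]; simp
    · rw [AlgHom.commutes, add_zero]
      exact Submodule.smul_mem _ c hF
  · intro _ _ ha hb
    exact Submodule.add_mem _ ha hb
  · intro a b ha hb
    induction ha using Submodule.iSup_induction' with
    | zero => rw [zero_mul]; exact Submodule.zero_mem _
    | add x y _ _ hx hy => rw [add_mul]; exact Submodule.add_mem _ hx hy
    | mem n x hx =>
      induction hb using Submodule.iSup_induction' with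
      | zero => rw [mul_zero]; exact Submodule.zero_mem _
      | add y z _ _ hy hz => rw [mul_add]; exact Submodule.add_mem _ hy hz
      | mem k y hy => exact hle _ (shiftSpace_mul hx hy)

/-- A central element has eigenvalue zero under `ad` of the weight operator. Eigenspaces are
independent, so its components of nonzero weight vanish. No description of `𝔷` as polynomials in the
Casimir element is needed. -/
lemma center_mem_shiftSpace {T : ℤ → Submodule ℂ (SmoothFn V)} (hT : IsGradedFn T) {z : Ug}
    (hz : z ∈ Subalgebra.center ℂ Ug) : z ∈ shiftSpace T 0 := by
  let A : Module.End ℂ Ug := LinearMap.mulLeft ℂ (UniversalEnvelopingAlgebra.ι ℂ cayH) -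
    LinearMap.mulRight ℂ (UniversalEnvelopingAlgebra.ι ℂ cayH)
  have hle : ∀ n : ℤ, shiftSpace T n ≤ A.eigenspace (2 * n : ℂ) := fun n u hu =>
    Module.End.mem_eigenspace_iff.2 hu.1
  have h1 := iSup_shiftSpace hT z
  rw [iSup_split_single _ (0 : ℤ)] at h1
  obtain ⟨z₀, hz₀, z₁, hz₁, rfl⟩ := Submodule.mem_sup.1 h1
  have h2 : z₁ ∈ A.eigenspace 0 := by
    have h3 : z₀ ∈ A.eigenspace 0 := by simpa using hle 0 hz₀
    have h4 : z₀ + z₁ ∈ A.eigenspace 0 := by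
      rw [Module.End.mem_eigenspace_iff, zero_smul]
      show UniversalEnvelopingAlgebra.ι ℂ cayH * _ - _ * UniversalEnvelopingAlgebra.ι ℂ cayH = 0
      rw [Subalgebra.mem_center_iff.1 hz, sub_self]
    simpa using Submodule.sub_mem _ h4 h3
  have h3 : z₁ ∈ ⨆ (μ : ℂ) (_ : μ ≠ 0), A.eigenspace μ := by
    refine (iSup₂_le fun n hn => ?_ : (⨆ (n : ℤ) (_ : n ≠ 0), shiftSpace T n) ≤ _) hz₁
    refine (hle n).trans (le_iSup₂_of_le (2 * n : ℂ) ?_ le_rfl)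
    exact mul_ne_zero two_ne_zero (Int.cast_ne_zero.2 hn)
  have h4 := (A.eigenspaces_iSupIndep 0).le_bot ⟨h2, h3⟩
  rw [(Submodule.mem_bot ℂ).1 h4, add_zero]
  exact hz₀

/-- Shift zero keeps the whole `𝔷`-orbit inside one finite-dimensional member. -/
lemma IsGradedFor.isZFinite {T : ℤ → Submodule ℂ (SmoothFn V)} (hT : IsGradedFn T) {s : ℤ}
    {F : SmoothFn V} (hF : F ∈ T s) : IsZFinite F := by
  have := hT.fin s
  refine Submodule.finiteDimensional_of_le (S₂ := T s) (Submodule.span_le.2 ?_)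
  rintro _ ⟨z, rfl⟩
  have h1 := (center_mem_shiftSpace hT z.2).2 s F hF
  rwa [add_zero] at h1

/-- The Casimir element. -/
def casimir : Ug :=
  4 * (UniversalEnvelopingAlgebra.ι ℂ cayF * UniversalEnvelopingAlgebra.ι ℂ cayE) +
    UniversalEnvelopingAlgebra.ι ℂ cayH * UniversalEnvelopingAlgebra.ι ℂ cayH +
    2 * UniversalEnvelopingAlgebra.ι ℂ cayH

lemma casimir_mem_center : casimir ∈ Subalgebra.center ℂ Ug := by
  obtain ⟨h1, h2, h3⟩ := ring_triple (UniversalEnvelopingAlgebra.ι ℂ (L := sl2))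
  obtain ⟨c1, c2, c3⟩ := casimir_commute h1 h2 h3
  rw [Subalgebra.mem_center_iff]
  intro u
  refine envInduction (P := fun u => u * casimir = casimir * u) ?_ ?_ ?_ ?_ u
  · intro X
    obtain ⟨a, b, c, rfl⟩ := exists_cay_combination X
    rw [map_add, map_add, map_smul, map_smul, map_smul]
    exact (((c1.smul_right a).add_right (c2.smul_right b)).add_right (c3.smul_right c)).symm
  · intro c
    exact Algebra.commutes c casimir
  · intro _ _ ha hb
    rw [add_mul, mul_add, ha, hb]
  · intro a b ha hb
    rw [mul_assoc, hb, ← mul_assoc, ha, mul_assoc]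

lemma envAct_center_comm {z : Ug} (hz : z ∈ Subalgebra.center ℂ Ug) (u : Ug) (F : SmoothFn V) :
    envAct z (envAct u F) = envAct u (envAct z F) := by
  rw [← Module.End.mul_apply, ← Module.End.mul_apply, ← map_mul, ← map_mul,
    Subalgebra.mem_center_iff.1 hz]

/-- The smooth functions that are finite under the center of the enveloping algebra. -/
def zFiniteSubmodule (V : Type*) [NormedAddCommGroup V] [NormedSpace ℂ V] :
    Submodule ℂ (SmoothFn V) where
  carrier := {F | IsZFinite F}
  zero_mem' := orbit_zero _
  add_mem' ha hb := orbit_add (T := fun z : Subalgebra.center ℂ Ug => envAct (z : Ug)) ha hb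
  smul_mem' c _ ha := orbit_smul (T := fun z : Subalgebra.center ℂ Ug => envAct (z : Ug)) c ha

/-- The center commutes with `X`, so the orbit of `X F` is the image under `X` of the orbit of `F`.
-/
lemma IsZFinite.lieAct {F : SmoothFn V} (hF : IsZFinite F) (X : sl2) :
    IsZFinite (VVAut.lieAct X F) := by
  have hfd : FiniteDimensional ℂ (Submodule.span ℂ
    (Set.range fun z : Subalgebra.center ℂ Ug => envAct (z : Ug) F)) := hF
  refine Submodule.finiteDimensional_of_le (S₂ := (Submodule.span ℂ
    (Set.range fun z : Subalgebra.center ℂ Ug => envAct (z : Ug) F)).map (VVAut.lieAct X))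
    (Submodule.span_le.2 ?_)
  rintro _ ⟨z, rfl⟩
  refine ⟨envAct (z : Ug) F, Submodule.subset_span ⟨z, rfl⟩, ?_⟩
  rw [← envAct_ι, ← envAct_center_comm z.2, envAct_ι]

/-- The span of the orbit of a `K_∞`-finite function is stable under the Lie algebra of `K_∞`. -/
lemma lieAct_Jgen_mem {F : SmoothFn V} (hF : IsKFinite F) {G : SmoothFn V}
    (hG : G ∈ Submodule.span ℂ (Set.range fun k : Kinf => rightShift (infIn k) F)) :
    lieAct Jgen G ∈ Submodule.span ℂ (Set.range fun k : Kinf => rightShift (infIn k) F) := by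
  set W := Submodule.span ℂ (Set.range fun k : Kinf => rightShift (infIn k) F) with hW
  have hfd : FiniteDimensional ℂ W := hF.inf
  have hst : ∀ (k : Kinf), ∀ G ∈ W, rightShift (infIn k) G ∈ W := by
    intro k G hG
    have h1 : W ≤ W.comap (rightShift (infIn k)) := by
      refine Submodule.span_le.2 ?_
      rintro _ ⟨k', rfl⟩
      show rightShift (infIn k) (rightShift (infIn k') F) ∈ W
      rw [← Module.End.mul_apply, ← map_mul, ← map_mul]
      exact Submodule.subset_span ⟨k * k', rfl⟩
    exact h1 hG
  by_contra hne
  -- A functional that kills `W` but not the derivative is impossible: it vanishes along the rotated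
  -- functions, and so on their derivative at `t = 0`.
  obtain ⟨l, hl0, hl⟩ := Submodule.exists_le_ker_of_notMem hne
  have h1 := deriv_functional (W := ⊤) (F := G) (c := fun t => ⟨rightShift (infIn (rot t)) G, trivial⟩)
    (d := ⟨lieAct Jgen G, trivial⟩) (fun t => rfl) rfl
    (Submodule.finiteDimensional_of_le (S₂ := W) (Submodule.span_le.2 (by
      rintro _ ⟨k, rfl⟩
      exact hst k G hG))) (l ∘ₗ Submodule.subtype ⊤)
  have h2 : (fun t : ℝ => (l ∘ₗ Submodule.subtype ⊤)
      (⟨rightShift (infIn (rot t)) G, trivial⟩ : (⊤ : Submodule ℂ (SmoothFn V)))) = fun _ => 0 :=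
    funext fun t => hl (hst (rot t) G hG)
  rw [h2] at h1
  exact hl0 (h1.unique (hasDerivAt_const (0 : ℝ) (0 : ℂ)))

/-- A `K`-finite and `𝔷`-finite function is contained in a graded family. -/
lemma exists_isGradedFn {F : SmoothFn V} (hK : IsKFinite F) (hZ : IsZFinite F) :
    ∃ T : ℤ → Submodule ℂ (SmoothFn V), IsGradedFn T ∧ F ∈ T 0 := by
  let W := Submodule.span ℂ (Set.range fun k : Kinf => rightShift (infIn k) F)
  have hW : FiniteDimensional ℂ W := hK.inf
  -- The smallest space containing `F` and stable under the weight operator. It lies in the span of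
  -- the `K_∞`-orbit, hence is finite-dimensional.
  let D : Submodule ℂ (SmoothFn V) := Submodule.span ℂ (Set.range fun a : ℕ => (lieAct cayH ^ a) F)
  have hDh : ∀ G ∈ D, lieAct cayH G ∈ D := by
    intro G hG
    have h1 : D ≤ D.comap (lieAct cayH) := by
      refine Submodule.span_le.2 ?_
      rintro _ ⟨a, rfl⟩
      refine Submodule.subset_span ⟨a + 1, ?_⟩
      show (lieAct cayH ^ (a + 1)) F = lieAct cayH ((lieAct cayH ^ a) F)
      rw [pow_succ']; rfl
    exact h1 hG
  have hDW : D ≤ W := by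
    refine Submodule.span_le.2 ?_
    rintro _ ⟨a, rfl⟩
    induction a with
    | zero => exact Submodule.subset_span ⟨1, by simp⟩
    | succ a ih =>
      show (lieAct cayH ^ (a + 1)) F ∈ W
      have hJ : ∀ G : SmoothFn V, lieAct cayH G = Complex.I • lieAct Jgen G := fun G => by
        rw [cayH_eq, map_smul]; rfl
      rw [pow_succ', Module.End.mul_apply, hJ]
      exact W.smul_mem _ (lieAct_Jgen_mem hK ih)
  have hDZ : D ≤ zFiniteSubmodule V := by
    refine Submodule.span_le.2 ?_
    rintro _ ⟨a, rfl⟩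
    induction a with
    | zero => exact hZ
    | succ a ih =>
      show IsZFinite ((lieAct cayH ^ (a + 1)) F)
      rw [pow_succ', Module.End.mul_apply]
      exact IsZFinite.lieAct ih _
  have hDfd : FiniteDimensional ℂ D := Submodule.finiteDimensional_of_le hDW
  obtain ⟨s, hs⟩ := Module.Finite.iff_fg.1 hDfd
  let S : SmoothFn V → Submodule ℂ (SmoothFn V) := fun G =>
    Submodule.span ℂ (Set.range fun z : Subalgebra.center ℂ Ug => envAct (z : Ug) G)
  -- The space `𝔷 D` is finite-dimensional since `D` is spanned by finitely many `𝔷`-finite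
  -- functions. It is stable under the weight operator, which commutes with `𝔷`, and under the
  -- central Casimir element, so it can serve as degree zero.
  let V₀ : Submodule ℂ (SmoothFn V) :=
    Submodule.span ℂ {G | ∃ z ∈ Subalgebra.center ℂ Ug, ∃ d ∈ D, G = envAct z d}
  have hV₀fd : FiniteDimensional ℂ V₀ := by
    have h1 : ∀ G ∈ s, FiniteDimensional ℂ (S G) := fun G hG =>
      hDZ (hs ▸ Submodule.subset_span hG)
    have h2 : FiniteDimensional ℂ (⨆ G : s, S G : Submodule ℂ (SmoothFn V)) := by
      have : ∀ G : s, FiniteDimensional ℂ (S G) := fun G => h1 G G.2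
      exact Submodule.finiteDimensional_iSup _
    refine Submodule.finiteDimensional_of_le (S₂ := ⨆ G : s, S G) (Submodule.span_le.2 ?_)
    rintro _ ⟨z, hz, d, hd, rfl⟩
    have h3 : D ≤ (⨆ G : s, S G).comap (envAct z) := by
      rw [← hs]
      refine Submodule.span_le.2 fun G hG => ?_
      exact (le_iSup (fun G : s => S G) ⟨G, hG⟩) (Submodule.subset_span ⟨⟨z, hz⟩, rfl⟩)
    exact h3 hd
  have hV₀h : ∀ G ∈ V₀, lieAct cayH G ∈ V₀ := by
    intro G hG
    have h1 : V₀ ≤ V₀.comap (lieAct cayH) := by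
      refine Submodule.span_le.2 ?_
      rintro _ ⟨z, hz, d, hd, rfl⟩
      refine Submodule.subset_span ⟨z, hz, lieAct cayH d, hDh d hd, ?_⟩
      rw [← envAct_ι, ← envAct_ι, envAct_center_comm hz]
    exact h1 hG
  have hV₀c : ∀ G ∈ V₀, envAct casimir G ∈ V₀ := by
    intro G hG
    have h1 : V₀ ≤ V₀.comap (envAct casimir) := by
      refine Submodule.span_le.2 ?_
      rintro _ ⟨z, hz, d, hd, rfl⟩
      refine Submodule.subset_span ⟨casimir * z, mul_mem casimir_mem_center hz, d, hd, ?_⟩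
      rw [map_mul]; rfl
    exact h1 hG
  obtain ⟨h1, h2, h3⟩ := ring_triple (lieAct (V := V))
  have hcas : (envAct casimir : Module.End ℂ (SmoothFn V)) =
      4 * (lieAct cayF * lieAct cayE) + lieAct cayH * lieAct cayH + 2 * lieAct cayH := by
    have hι : ∀ X, (envAct (UniversalEnvelopingAlgebra.ι ℂ X) : Module.End ℂ (SmoothFn V)) =
      lieAct X := fun X => LinearMap.ext (envAct_ι X)
    simp only [casimir, map_add, map_mul, hι, map_ofNat]
  obtain ⟨T, hT, hT0⟩ := exists_isGradedFor h1 h2 h3 V₀ hV₀h (by rw [← hcas]; exact hV₀c)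
  refine ⟨T, hT, hT0 ▸ Submodule.subset_span ⟨1, one_mem _, F, Submodule.subset_span ⟨0, rfl⟩, ?_⟩⟩
  rw [map_one]; rfl

end ZFinite

/-! ### Products of functions -/

section Products

variable {V : Type*} [NormedAddCommGroup V] [NormedSpace ℂ V]

lemma rightShift_mulFn (h : GA) (u : SmoothFn V) (f : SmoothFn ℂ) :
    rightShift h (mulFn u f) = mulFn (rightShift h u) (rightShift h f) := rfl

lemma lieReal_mulFn (X : Matrix (Fin 2) (Fin 2) ℝ) (u : SmoothFn V) (f : SmoothFn ℂ) :
    lieReal X (mulFn u f) = mulFn (lieReal X u) f + mulFn u (lieReal X f) := by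
  refine SmoothFn.ext fun g => ?_
  have hg := entries_mem_posDet g.1
  have h1 := ((realExt_differentiableAt f g.2 hg).hasFDerivAt.smul
    (realExt_differentiableAt u g.2 hg).hasFDerivAt).fderiv
  have h2 : realExt (mulFn u f).1 g.2 = fun A => realExt f.1 g.2 A • realExt u.1 g.2 A := rfl
  have h3 : ∀ F : GA → V, ∀ G : GA → ℂ, realExt F g.2 (entries g.1) = F g ∧
      realExt G g.2 (entries g.1) = G g := fun F G => by simp [realExt, retr_entries]
  show fderiv ℝ (realExt (mulFn u f).1 g.2) (entries g.1) _ =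
    f.1 g • (lieReal X u).1 g + (lieReal X f).1 g • u.1 g
  rw [h2]
  refine (DFunLike.congr_fun h1 _).trans ?_
  rw [← (h3 u.1 f.1).1]
  conv_rhs => rw [← (h3 u.1 f.1).2]
  rfl

lemma lieAct_mulFn (X : sl2) (u : SmoothFn V) (f : SmoothFn ℂ) :
    lieAct X (mulFn u f) = mulFn (lieAct X u) f + mulFn u (lieAct X f) := by
  simp only [lieAct_apply, lieReal_mulFn, map_add, map_smul, LinearMap.add_apply,
    LinearMap.smul_apply, smul_add]
  abel

variable {m : ℕ}

/-- Differentiate `sym^m((1 + t X) C) = sym^m(C (1 + t Y))` at `t = 0`. With `C` the Cayley matrix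
this carries the formulas on monomials over to the weight vectors of `K_∞`. -/
lemma dsymFun_symHom {X Y C : Matrix (Fin 2) (Fin 2) ℂ} (h : X * C = C * Y) (p : PolyLE m) :
    dsymFun X (symHom m C p) = symHom m C (dsymFun Y p) := by
  have h1 : symOrbit (symHom m C p) = symOrbit p ∘ mulR C := by
    ext1 A
    simp [symOrbit, mulR_apply]
  have h2 : mulR C oneM = Matrix.of.symm C := by
    simp [mulR_apply, oneM]
  have h3 := ((symOrbit_diff p (mulR C oneM)).hasFDerivAt.comp oneM
    (mulR C).hasFDerivAt).fderiv
  have h4 : mulR C (Matrix.of.symm X) = Matrix.of.symm (C * Y) := by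
    rw [mulR_apply, Equiv.apply_symm_apply, h]
  rw [symHom_dsymFun, dsymFun, h1, h3, h2, ContinuousLinearMap.comp_apply, h4]

/-- The weight vectors of `K_∞` in `sym^m`. -/
def weightVec (m i : ℕ) : PolyLE m := symHom m cayley (monom m i)

lemma monom_eq_zero {i : ℕ} (hi : m < i) : monom m i = 0 := by
  ext j
  have : (j : ℕ) ≠ i := by have := j.2; omega
  simp [monom, this]

lemma dsym_cayH {i : ℕ} (hi : i ≤ m) :
    dsym m cayH (weightVec m i) = ((m : ℂ) - 2 * i) • weightVec m i := by
  rw [weightVec, ← map_smul, ← dsym_stdH hi]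
  exact dsymFun_symHom cayley_stdH _

lemma dsym_cayE {i : ℕ} (hi : i ≤ m) :
    dsym m cayE (weightVec m i) = (-(i : ℂ)) • weightVec m (i - 1) := by
  rw [weightVec, weightVec, ← map_smul, ← dsym_stdE hi]
  exact dsymFun_symHom cayley_stdE _

lemma dsym_cayF {i : ℕ} (hi : i ≤ m) :
    dsym m cayF (weightVec m i) = (-((m - i : ℕ) : ℂ)) • weightVec m (i + 1) := by
  have h : dsym m stdF (monom m i) = (-((m - i : ℕ) : ℂ)) • monom m (i + 1) := by
    rcases hi.lt_or_eq with h | rfl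
    · exact dsym_stdF h
    · rw [dsym_stdF_last]; simp
  rw [weightVec, weightVec, ← map_smul, ← h]
  exact dsymFun_symHom cayley_stdF _

/-- The Cayley matrix is invertible, so it carries the basis of monomials to another spanning
family. -/
lemma exists_sum_weightVec (p : PolyLE m) :
    ∃ c : Fin (m + 1) → ℂ, p = ∑ i, c i • weightVec m i := by
  have h1 : cayley * ((2 : ℂ)⁻¹ • !![1, -Complex.I; -Complex.I, 1]) = 1 := by
    have hI := Complex.I_mul_I
    ext i j
    fin_cases i <;> fin_cases j <;> simp [cayley] <;> grind
  refine ⟨symHom m ((2 : ℂ)⁻¹ • !![1, -Complex.I; -Complex.I, 1]) p, ?_⟩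
  conv_lhs => rw [← Module.End.one_apply (R := ℂ) p, ← map_one (symHom m), ← h1, map_mul,
    Module.End.mul_apply, ← sum_monom (symHom m _ p), map_sum]
  simp only [map_smul, weightVec]

/-- The product of a graded family of scalar functions with the functions `secFn p`. -/
def gradedProd (m : ℕ) (T : ℤ → Submodule ℂ (SmoothFn ℂ)) (s : ℤ) :
    Submodule ℂ (SmoothFn (PolyLE m)) :=
  ⨆ i : Fin (m + 1), (T (s + (i : ℕ))).map (mulFn (secFn (weightVec m i)))

lemma mulFn_mem_gradedProd {T : ℤ → Submodule ℂ (SmoothFn ℂ)} {s n : ℤ} {i : ℕ} {f : SmoothFn ℂ}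
    (hf : f ∈ T n) (hn : n = s + i) : mulFn (secFn (weightVec m i)) f ∈ gradedProd m T s := by
  subst hn
  rcases Nat.lt_or_ge m i with hi | hi
  · rw [weightVec, monom_eq_zero hi]
    simp
  · exact Submodule.mem_iSup_of_mem (⟨i, Nat.lt_succ_of_le hi⟩ : Fin (m + 1)) ⟨f, hf, rfl⟩

/-- By the Leibniz rule it suffices to treat separately the terms where `X` acts on the weight
vector and on the scalar function. -/
lemma lieAct_gradedProd {T : ℤ → Submodule ℂ (SmoothFn ℂ)} {s s' : ℤ} {X : sl2}
    (h : ∀ i ≤ m, ∀ f ∈ T (s + i), mulFn (secFn (dsym m X (weightVec m i))) f ∈ gradedProd m T s' ∧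
      mulFn (secFn (weightVec m i)) (lieAct X f) ∈ gradedProd m T s') :
    ∀ F ∈ gradedProd m T s, lieAct X F ∈ gradedProd m T s' := by
  have h1 : gradedProd m T s ≤ (gradedProd m T s').comap (lieAct X) := by
    refine iSup_le fun i => ?_
    rintro _ ⟨f, hf, rfl⟩
    show lieAct X (mulFn (secFn (weightVec m i)) f) ∈ gradedProd m T s'
    rw [lieAct_mulFn, lieAct_secFn]
    have := h i (Nat.le_of_lt_succ i.2) f hf
    exact Submodule.add_mem _ this.1 this.2
  exact h1

/-- The weight vector of index `i` has weight `m - 2 i`, which lowers the degree by `i` up to a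
global constant. Pairing it with `T (s + i)` therefore gives degree `s`, and the operators shift
both factors consistently. -/
lemma gradedProd_isGraded {T : ℤ → Submodule ℂ (SmoothFn ℂ)} (hT : IsGradedFn T) :
    IsGradedFn (gradedProd m T) where
  fin s := by
    have : ∀ i : Fin (m + 1),
        FiniteDimensional ℂ ((T (s + (i : ℕ))).map (mulFn (secFn (weightVec m i)))) := fun i => by
      have := hT.fin (s + (i : ℕ))
      exact Module.Finite.map _ _
    exact Submodule.finiteDimensional_iSup _
  h_mem s := lieAct_gradedProd fun i hi f hf => by
    rw [dsym_cayH hi, map_smul, map_smul, LinearMap.smul_apply]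
    exact ⟨Submodule.smul_mem _ _ (mulFn_mem_gradedProd hf rfl),
      mulFn_mem_gradedProd (hT.h_mem _ _ hf) rfl⟩
  e_mem s := lieAct_gradedProd fun i hi f hf => by
    rw [dsym_cayE hi, map_smul, map_smul, LinearMap.smul_apply]
    refine ⟨?_, mulFn_mem_gradedProd (hT.e_mem _ _ hf) (by ring)⟩
    rcases i with _ | i
    · simp
    · exact Submodule.smul_mem _ _ (mulFn_mem_gradedProd hf (by push_cast; ring))
  f_mem s := lieAct_gradedProd fun i hi f hf => by
    rw [dsym_cayF hi, map_smul, map_smul, LinearMap.smul_apply]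
    exact ⟨Submodule.smul_mem _ _ (mulFn_mem_gradedProd hf (by push_cast; ring)),
      mulFn_mem_gradedProd (hT.f_mem _ _ hf) (by ring)⟩

/-- A product does not inherit `𝔷`-finiteness directly, as central elements are no derivations. The
graded family of `f` supplies the finite-dimensional spaces that contain the orbit of the product.
-/
lemma isZFinite_mulFn {f : SmoothFn ℂ} (hK : IsKFinite f) (hZ : IsZFinite f) (p : PolyLE m) :
    IsZFinite (mulFn (secFn p) f) := by
  obtain ⟨T, hT, hf⟩ := exists_isGradedFn hK hZ
  obtain ⟨c, rfl⟩ := exists_sum_weightVec p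
  show mulFn (secFn (∑ i, c i • weightVec m i)) f ∈ zFiniteSubmodule (PolyLE m)
  simp only [map_sum, map_smul, LinearMap.sum_apply, LinearMap.smul_apply]
  refine Submodule.sum_mem _ fun i _ => Submodule.smul_mem _ _ ?_
  -- Degree `s = -i` is forced by `f ∈ T 0`, since `s + i = 0`.
  exact (gradedProd_isGraded hT).isZFinite (s := -(i : ℕ)) (mulFn_mem_gradedProd hf (by simp))

/-- Translation is multiplicative, so the orbit lies in the span of products from two
finite-dimensional spaces. -/
lemma isKFinite_mulFn {f : SmoothFn ℂ} (hK : IsKFinite f) (p : PolyLE m) :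
    IsKFinite (mulFn (secFn p) f) := by
  have hfd : FiniteDimensional ℂ (Submodule.span ℂ
    (Set.range fun k : Kmax => rightShift (k : GA) f)) := hK
  have h1 : FiniteDimensional ℂ (Submodule.map₂ mulFn (secRange m) (Submodule.span ℂ
      (Set.range fun k : Kmax => rightShift (k : GA) f))) :=
    Module.Finite.iff_fg.2 ((Module.Finite.iff_fg.1 inferInstance).map₂ _
      (Module.Finite.iff_fg.1 hfd))
  refine Submodule.finiteDimensional_of_le (Submodule.span_le.2 ?_) (S₂ := Submodule.map₂ mulFn
    (secRange m) (Submodule.span ℂ (Set.range fun k : Kmax => rightShift (k : GA) f)))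
  rintro _ ⟨k, rfl⟩
  show rightShift (k : GA) (mulFn (secFn p) f) ∈ Submodule.map₂ mulFn (secRange m) _
  rw [rightShift_mulFn, rightShift_secFn]
  exact Submodule.apply_mem_map₂ _ (secFn_mem _) (Submodule.subset_span ⟨k, rfl⟩)

lemma HasModerateGrowth.mulFn {u : SmoothFn V} {f : SmoothFn ℂ} (hu : HasModerateGrowth u)
    (hf : HasModerateGrowth f) : HasModerateGrowth (VVAut.mulFn u f) := by
  obtain ⟨C, a, hC⟩ := hu
  obtain ⟨D, b, hD⟩ := hf
  refine ⟨D * C, b + a, fun g => ?_⟩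
  rw [mulFn_apply, norm_smul]
  calc ‖f.1 g‖ * ‖u.1 g‖ ≤ (D * adelicNorm g ^ b) * (C * adelicNorm g ^ a) :=
        mul_le_mul (hD g) (hC g) (norm_nonneg _) ((norm_nonneg _).trans (hD g))
    _ = _ := by ring

lemma mulFn_secFn_mem_autForm {f : SmoothFn ℂ} (hf : f ∈ ScalarForm) (p : PolyLE m) :
    mulFn (secFn p) f ∈ AutForm (symQ m) := by
  refine ⟨fun γ g => ?_, isKFinite_mulFn hf.2.1 p, isZFinite_mulFn hf.2.1 hf.2.2.1 p,
    (secFn_moderate p).mulFn hf.2.2.2⟩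
  have h1 : f.1 (diag γ * g) = f.1 g := hf.1 γ g
  rw [mulFn_apply, mulFn_apply, map_smul, h1, (secFn_mem_autForm p).1 γ g]

lemma sym_injective (x : SL2 ℝ) : Function.Injective (sym m x) := by
  refine Function.LeftInverse.injective (g := sym m x⁻¹) fun p => ?_
  rw [← Module.End.mul_apply, ← map_mul, inv_mul_cancel, map_one, Module.End.one_apply]

/-- For `p ≠ 0` the function `secFn p` vanishes nowhere. -/
lemma mulFn_secFn_injective {p : PolyLE m} (hp : p ≠ 0) : Function.Injective (mulFn (secFn p)) := by
  refine (injective_iff_map_eq_zero _).2 fun f hf => SmoothFn.ext fun g => ?_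
  have h1 : f.1 g • sym m g.1 p = 0 := congrArg (fun F : SmoothFn (PolyLE m) => F.1 g) hf
  refine (smul_eq_zero.1 h1).resolve_right fun h2 => hp (sym_injective g.1 ?_)
  rw [h2, map_zero]

lemma mulFn_secFn_finIn (y : SL2 Af) (p : PolyLE m) (f : SmoothFn ℂ) :
    mulFn (secFn p) (rightShift (finIn y) f) = rightShift (finIn y) (mulFn (secFn p) f) := by
  rw [rightShift_mulFn, rightShift_secFn]
  have h : (finIn y).1 = 1 := rfl
  rw [h, map_one, Module.End.one_apply]

lemma IsStable.map₂ {U : Submodule ℂ (SmoothFn V)} {W : Submodule ℂ (SmoothFn ℂ)} (hU : IsStable U)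
    (hW : IsStable W) : IsStable (Submodule.map₂ mulFn U W) where
  lie_mem X := by
    have h : Submodule.map₂ mulFn U W ≤ (Submodule.map₂ mulFn U W).comap (lieAct X) :=
      Submodule.map₂_le.2 fun u hu f hf => by
        show lieAct X (mulFn u f) ∈ Submodule.map₂ mulFn U W
        rw [lieAct_mulFn]
        exact Submodule.add_mem _ (Submodule.apply_mem_map₂ _ (hU.lie_mem X u hu) hf)
          (Submodule.apply_mem_map₂ _ hu (hW.lie_mem X f hf))
    exact h
  inf_mem k := by
    have h : Submodule.map₂ mulFn U W ≤ (Submodule.map₂ mulFn U W).comap (rightShift (infIn k)) :=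
      Submodule.map₂_le.2 fun u hu f hf =>
        Submodule.apply_mem_map₂ _ (hU.inf_mem k u hu) (hW.inf_mem k f hf)
    exact h
  fin_mem k := by
    have h : Submodule.map₂ mulFn U W ≤ (Submodule.map₂ mulFn U W).comap (rightShift (finIn k)) :=
      Submodule.map₂_le.2 fun u hu f hf =>
        Submodule.apply_mem_map₂ _ (hU.fin_mem k u hu) (hW.fin_mem k f hf)
    exact h

lemma isSubrep_map₂ {W : Submodule ℂ (SmoothFn ℂ)}
    (hW : IsSubrep (Representation.trivial ℂ (SL2 ℚ) ℂ) W) :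
    IsSubrep (symQ m) (Submodule.map₂ mulFn (secRange m) W) where
  toIsStable := secRange_isStable.map₂ hW.toIsStable
  le_autForm := Submodule.map₂_le.2 fun u hu f hf => by
    obtain ⟨p, rfl⟩ := hu
    exact mulFn_secFn_mem_autForm (hW.le_autForm hf) p

/-- Multiplication of functions as a linear map on the tensor product. -/
def mulTensor (m : ℕ) (W : Submodule ℂ (SmoothFn ℂ)) :
    secRange m ⊗[ℂ] W →ₗ[ℂ] SmoothFn (PolyLE m) :=
  TensorProduct.lift (mulFn.domRestrict₁₂ (secRange m) W)

lemma mulTensor_tmul (W : Submodule ℂ (SmoothFn ℂ)) (u : secRange m) (f : W) :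
    mulTensor m W (u ⊗ₜ f) = mulFn u.1 f.1 := rfl

lemma range_mulTensor (W : Submodule ℂ (SmoothFn ℂ)) :
    LinearMap.range (mulTensor m W) = Submodule.map₂ mulFn (secRange m) W := by
  refine le_antisymm ?_ (Submodule.map₂_le.2 fun u hu f hf => ⟨⟨u, hu⟩ ⊗ₜ ⟨f, hf⟩, rfl⟩)
  rintro _ ⟨z, rfl⟩
  induction z using TensorProduct.induction_on with
  | zero => rw [map_zero]; exact Submodule.zero_mem _
  | tmul u f => exact Submodule.apply_mem_map₂ _ u.2 f.2
  | add x y hx hy => rw [map_add]; exact Submodule.add_mem _ hx hy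

/-- Expand a tensor as `∑ b i ⊗ c i` with `b` the basis coming from the coordinates of `ℂ[X]_m`. At
a point `g` its product is `sym^m(g_∞)` applied to the vector of the values `c i (g)`, so if it
vanishes, so do all these values. -/
lemma mulTensor_injective (W : Submodule ℂ (SmoothFn ℂ)) : Function.Injective (mulTensor m W) := by
  refine (injective_iff_map_eq_zero _).2 fun z hz => ?_
  let b : Module.Basis (Fin (m + 1)) ℂ (secRange m) := (Pi.basisFun ℂ (Fin (m + 1))).map (secEquiv m)
  obtain ⟨c, rfl⟩ := TensorProduct.eq_repr_basis_left b z
  have h1 : ∀ i g, ((c i : W) : SmoothFn ℂ).1 g = 0 := by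
    intro i g
    have h2 : sym m g.1 (fun i => ((c i : W) : SmoothFn ℂ).1 g) = 0 := by
      let ev : SmoothFn (PolyLE m) →ₗ[ℂ] PolyLE m :=
        LinearMap.proj g ∘ₗ (smoothSubmodule (PolyLE m)).subtype
      have h3 : ∀ (i : Fin (m + 1)) (f : W), ev (mulTensor m W (b i ⊗ₜ f)) =
          f.1.1 g • sym m g.1 (Pi.single i 1) := fun i f => by
        have h4 : (b i : secRange m).1 = secFn (Pi.single i 1) := by
          simp [b, secEquiv_coe]
        rw [mulTensor_tmul, h4]; rfl
      have h5 := congrArg ev hz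
      rw [map_zero, map_finsuppSum, map_finsuppSum, Finsupp.sum_fintype _ _ (by simp)] at h5
      rw [← h5, pi_eq_sum_univ' (fun i => ((c i : W) : SmoothFn ℂ).1 g), map_sum]
      simp only [h3, map_smul]
    exact congrFun (sym_injective g.1 (h2.trans (map_zero _).symm)) i
  have h2 : c = 0 := Finsupp.ext fun i => Subtype.ext (SmoothFn.ext fun g => h1 i g)
  rw [h2, Finsupp.sum_zero_index]

/-- Multiplication of functions as an isomorphism. -/
def mulEquiv (m : ℕ) (W : Submodule ℂ (SmoothFn ℂ)) :
    secRange m ⊗[ℂ] W ≃ₗ[ℂ] Submodule.map₂ mulFn (secRange m) W :=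
  (LinearEquiv.ofInjective (mulTensor m W) (mulTensor_injective W)).trans
    (LinearEquiv.ofEq _ _ (range_mulTensor W))

lemma mulEquiv_tmul (W : Submodule ℂ (SmoothFn ℂ)) (u : secRange m) (f : W) :
    (mulEquiv m W (u ⊗ₜ f)).1 = mulFn u.1 f.1 := rfl

lemma mulEquiv_intertwines {W : Submodule ℂ (SmoothFn ℂ)} (h : IsSubrep (symQ m) (secRange m))
    (hW : IsSubrep (Representation.trivial ℂ (SL2 ℚ) ℂ) W)
    (hP : IsSubrep (symQ m) (Submodule.map₂ mulFn (secRange m) W)) :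
    Intertwines (h.toModule.tensor hW.toModule) hP.toModule (mulEquiv m W).toLinearMap where
  lie X z := by
    induction z using TensorProduct.induction_on with
    | zero => simp
    | add x y hx hy => rw [map_add, map_add, hx, hy, map_add, map_add]
    | tmul u f => exact Subtype.ext (lieAct_mulFn X u.1 f.1).symm
  inf k z := by
    induction z using TensorProduct.induction_on with
    | zero => simp
    | add x y hx hy => rw [map_add, map_add, hx, hy, map_add, map_add]
    | tmul u f => rfl
  fin k z := by
    induction z using TensorProduct.induction_on with
    | zero => simp
    | add x y hx hy => rw [map_add, map_add, hx, hy, map_add, map_add]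
    | tmul u f => rfl

end Products

/-! ### Functoriality of the tensor product of adelic modules -/

section TensorIntertwines

variable {M N N' P : Type*} [AddCommGroup M] [Module ℂ M] [AddCommGroup N] [Module ℂ N]
  [AddCommGroup N'] [Module ℂ N'] [AddCommGroup P] [Module ℂ P]

lemma Intertwines.lTensor {σ : AdelicModule N} {σ' : AdelicModule N'} {φ : N →ₗ[ℂ] N'}
    (hφ : Intertwines σ σ' φ) (π : AdelicModule M) :
    Intertwines (π.tensor σ) (π.tensor σ') (φ.lTensor M) where
  lie X z := by
    induction z using TensorProduct.induction_on with
    | zero => simp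
    | add x y hx hy => rw [map_add, map_add, hx, hy, map_add, map_add]
    | tmul u f => simp [AdelicModule.tensor, tensorLie, hφ.lie]
  inf k z := by
    induction z using TensorProduct.induction_on with
    | zero => simp
    | add x y hx hy => rw [map_add, map_add, hx, hy, map_add, map_add]
    | tmul u f => simp [AdelicModule.tensor, hφ.inf]
  fin k z := by
    induction z using TensorProduct.induction_on with
    | zero => simp
    | add x y hx hy => rw [map_add, map_add, hx, hy, map_add, map_add]
    | tmul u f => simp [AdelicModule.tensor, hφ.fin]

lemma Intertwines.comp {π : AdelicModule M} {σ : AdelicModule N} {τ : AdelicModule P}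
    {ψ : N →ₗ[ℂ] P} {φ : M →ₗ[ℂ] N} (hψ : Intertwines σ τ ψ) (hφ : Intertwines π σ φ) :
    Intertwines π τ (ψ ∘ₗ φ) where
  lie X v := by rw [LinearMap.comp_apply, hφ.lie, hψ.lie, LinearMap.comp_apply]
  inf k v := by rw [LinearMap.comp_apply, hφ.inf, hψ.inf, LinearMap.comp_apply]
  fin h v := by rw [LinearMap.comp_apply, hφ.fin, hψ.fin, LinearMap.comp_apply]

lemma Intertwines.symm {π : AdelicModule M} {σ : AdelicModule N} {e : M ≃ₗ[ℂ] N}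
    (h : Intertwines π σ e.toLinearMap) : Intertwines σ π e.symm.toLinearMap where
  lie X v := e.injective (by simpa using (h.lie X (e.symm v)).symm)
  inf k v := e.injective (by simpa using (h.inf k (e.symm v)).symm)
  fin y v := e.injective (by simpa using (h.fin y (e.symm v)).symm)

end TensorIntertwines

/-- A surjection from an automorphic subrepresentation `W` remains surjective after tensoring with
`secRange m`, and the multiplication isomorphism realises the tensor product with `W` inside the
automorphic forms of type `sym^m`. -/
lemma isAutomorphic_tensor {m : ℕ} (h : IsSubrep (symQ m) (secRange m)) {M : Type*}
    [AddCommGroup M] [Module ℂ M] {π : AdelicModule M}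
    (hπ : IsAutomorphic (Representation.trivial ℂ (SL2 ℚ) ℂ) π) :
    IsAutomorphic (symQ m) (h.toModule.tensor π) := by
  obtain ⟨W, hW, φ, hφ, hφi⟩ := hπ
  refine ⟨Submodule.map₂ mulFn (secRange m) W, isSubrep_map₂ hW,
    φ.lTensor (secRange m) ∘ₗ (mulEquiv m W).symm.toLinearMap, ?_,
    (hφi.lTensor h.toModule).comp (mulEquiv_intertwines h hW (isSubrep_map₂ hW)).symm⟩
  exact (LinearMap.lTensor_surjective _ hφ).comp (mulEquiv m W).symm.surjective

end VVAut

end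

/-! ### The main theorem -/

open scoped TensorProduct
open VVAut

theorem theoremA (m : ℕ) :
    -- strong approximation, and the values of the functions `eTilde m j` do not depend on choices
    (∀ g : GA, ∃ (γ : SL2 ℚ) (x : SL2 ℝ), ∃ k ∈ Kf, g = diag γ * (x, k)) ∧
    (∀ j ≤ m, ∀ (γ : SL2 ℚ) (x : SL2 ℝ), ∀ k ∈ Kf,
      eTilde m j (diag γ * (x, k)) =
        symQ m γ (slash ((m : ℤ) - 2 * (j : ℤ)) (eFun m j) x UpperHalfPlane.I)) ∧
    -- they are vector-valued automorphic forms, and generate the same representation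
    ∃ E : Fin (m + 1) → SmoothFn (PolyLE m),
      (∀ j, (E j).1 = eTilde m j ∧ E j ∈ AutForm (symQ m)) ∧
      (∀ j, generated (E j) = generated (E (Fin.last m))) ∧
      ∃ h : IsSubrep (symQ m) (generated (E (Fin.last m))),
        -- decomposition as a restricted tensor product
        (∃ Φ : generated (E (Fin.last m)) ≃ₗ[ℂ] PolyLE m ⊗[ℂ] TrivialTensor,
          Intertwines h.toModule ((symModule m).tensor trivialTensorModule) Φ.toLinearMap) ∧
        (∀ N : Submodule ℂ (PolyLE m),
          (∀ X, ∀ p ∈ N, (symModule m).lie X p ∈ N) → (∀ k, ∀ p ∈ N, (symModule m).rhoInf k p ∈ N) →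
            N = ⊥ ∨ N = ⊤) ∧
        -- multiplication is an embedding of representations of the group over the finite adeles
        (∀ (y : SL2 Af), ∀ f ∈ ScalarForm, rightShift (finIn y) f ∈ ScalarForm) ∧
        (∀ (y : SL2 Af), ∀ F ∈ AutForm (symQ m), rightShift (finIn y) F ∈ AutForm (symQ m)) ∧
        (∀ j, (∀ f ∈ ScalarForm, mulFn (E j) f ∈ AutForm (symQ m)) ∧
          Set.InjOn (mulFn (E j)) (ScalarForm : Set (SmoothFn ℂ)) ∧
          ∀ (y : SL2 Af), ∀ f ∈ ScalarForm,
            mulFn (E j) (rightShift (finIn y) f) = rightShift (finIn y) (mulFn (E j) f)) ∧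
        -- tensor products with subrepresentations
        (∀ (W : Submodule ℂ (SmoothFn ℂ))
          (hW : IsSubrep (Representation.trivial ℂ (SL2 ℚ) ℂ) W),
          ∃ (hP : IsSubrep (symQ m) (Submodule.map₂ mulFn (generated (E (Fin.last m))) W))
            (Φ : generated (E (Fin.last m)) ⊗[ℂ] W ≃ₗ[ℂ]
              Submodule.map₂ mulFn (generated (E (Fin.last m))) W),
            Intertwines (h.toModule.tensor hW.toModule) hP.toModule Φ.toLinearMap ∧
            ∀ u f, (Φ (u ⊗ₜ[ℂ] f)).1 = mulFn u.1 f.1) ∧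
        -- tensor products with subquotients
        ∀ (M : Type*) [AddCommGroup M] [Module ℂ M] (π : AdelicModule M),
          IsAutomorphic (Representation.trivial ℂ (SL2 ℚ) ℂ) π →
            IsAutomorphic (symQ m) (h.toModule.tensor π) := by
  have hgen : ∀ j : Fin (m + 1), generated (secFn (eFun m j UpperHalfPlane.I)) = secRange m :=
    fun j => generated_secFn (eFun_I_ne_zero (Nat.le_of_lt_succ j.2))
  refine ⟨strong_approximation, fun j hj γ x k _ => ?_,
    fun j => secFn (eFun m j UpperHalfPlane.I),
    fun j => ⟨(eTilde_eq (Nat.le_of_lt_succ j.2)).symm, secFn_mem_autForm _⟩,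
    fun j => (hgen j).trans (hgen (Fin.last m)).symm, ?_⟩
  · rw [eTilde_eq hj, slash_eFun hj, secFn_apply, Prod.fst_mul, map_mul]
    rfl
  beta_reduce
  -- All remaining claims concern only the generated space, which is now the explicit space
  -- `secRange m`.
  rw [hgen (Fin.last m)]
  refine ⟨secRange_isSubrep, ⟨secTensorEquiv m, secTensorEquiv_intertwines _⟩,
    fun N hN _ => sym_irreducible N hN, fun y f hf => rightShift_finIn_mem_autForm y hf,
    fun y F hF => rightShift_finIn_mem_autForm y hF, fun j => ⟨fun f hf => ?_, ?_, ?_⟩,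
    fun W hW => ⟨isSubrep_map₂ hW, mulEquiv m W, mulEquiv_intertwines _ hW _,
      mulEquiv_tmul W⟩, fun M _ _ π hπ => isAutomorphic_tensor _ hπ⟩
  · exact mulFn_secFn_mem_autForm hf _
  · exact (mulFn_secFn_injective (eFun_I_ne_zero (Nat.le_of_lt_succ j.2))).injOn
  · exact fun y f _ => mulFn_secFn_finIn y _ f
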